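/- Let $M$ be a complex manifold of dimension $n$ (Hausdorff and second countable) with a holomorphic Poisson bivector field $\pi$, i.e. a holomorphic section of $\wedge^2 T_M$ whose Schouten bracket $[\pi,\pi]$ vanishes. Let $A_M=\bigoplus_{p,q}A_M^{p,q}$ be the space of smooth complex-valued forms on $M$, and let $\iota_\pi$ be the contraction with $\pi$, normalized by $\iota_\pi(df\wedge dg)=\pi(df,dg)$. Put $\partial_\pi=\iota_\pi\partial-\partial\iota_\pi$ and $$[\alpha,\beta]_{\partial_\pi}=(-1)^{k}\big(\partial_\pi(\alpha\wedge\beta)-\partial_\pi\alpha\wedge\beta-(-1)^{k}\alpha\wedge\partial_\pi\beta\big)$$ for $\alpha$ of degree $k$. Assume that at least one of the following holds on $A_M$: - (the $\partial\bar\partial$-lemma) $\ker\partial\cap\ker\bar\partial\cap\operatorname{im}(\partial+\bar\partial)=\operatorname{im}\partial\bar\partial$; - (the $\partial_\pi\bar\partial$-lemma) $\ker\partial_\pi\cap\ker\bar\partial\cap\operatorname{im}(\partial_\pi+\bar\partial)=\operatorname{im}\partial_\pi\bar\partial$. Then for every class $[\alpha]\in H^{1,1}_{\bar\partial}(M)$: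 1. There is a formal power series $\alpha_t=\sum_{i\ge1}\alpha_it^i$ with $\alpha_i\in A_M^{1,1}$ such that $\bar\partial\alpha_t+\tfrac12[\alpha_t,\alpha_t]_{\partial_\pi}=0$ (the bracket being extended $\mathbb C[[t]]$-bilinearly) and $\alpha_1$ represents $[\alpha]$. 2. The class $\pi^\sharp[\alpha]\in H^1(M,T_M)$ is tangent to a formal deformation of the complex structure of $M$: there is a formal power series $\varphi_t=\sum_{i\ge1}\varphi_it^i$ with $\varphi_i\in A^{0,1}(M,T_M)$ such that $\bar\partial\varphi_t+\tfrac12[\varphi_t,\varphi_t]=0$ for the Kodaira–Spencer bracket and $\varphi_1$ represents $\pi^\sharp[\alpha]$. Here $T_M$ is the holomorphic tangent bundle, $H^1(M,T_M)$ is computed by the Dolbeault complex $(A^{0,\bullet}(M,T_M),\bar\partial)$, and $\pi^\sharp$ is induced by the map $A_M^{1,1}\to A^{0,1}(M,T_M)$ given locally by $dz_i\wedge d\bar z_k\mapsto -X_{z_i}\otimes d\bar z_k$, where $X_f=\pi(df,\cdot)$. -/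

import Mathlib

open scoped ContDiff Manifold

noncomputable section

namespace HolomorphicPoisson

/-! ### Linear algebra of complex-valued forms on `ℂⁿ` -/

/-- The model space `ℂⁿ`. -/
abbrev Model (n : ℕ) : Type := EuclideanSpace ℂ (Fin n)

/-- The complexified cotangent space of `ℂⁿ` at a point: real-linear, complex-valued functionals. -/
abbrev Cotangent (n : ℕ) : Type := Model n →L[ℝ] ℂ

instance (n : ℕ) : FiniteDimensional ℂ (Cotangent n) :=
  Module.Finite.of_injective
    ({ toFun := fun l => (l : Model n →ₗ[ℝ] ℂ)
       map_add' := fun _ _ => rfl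
       map_smul' := fun _ _ => rfl } : Cotangent n →ₗ[ℂ] (Model n →ₗ[ℝ] ℂ))
    ContinuousLinearMap.coe_injective

/-- The exterior algebra of the complexified cotangent space of `ℂⁿ`; its product is the wedge
product. -/
def Lam (n : ℕ) : Type := ExteriorAlgebra ℂ (Cotangent n)

instance (n : ℕ) : Ring (Lam n) := inferInstanceAs (Ring (ExteriorAlgebra ℂ (Cotangent n)))

instance (n : ℕ) : Algebra ℂ (Lam n) :=
  inferInstanceAs (Algebra ℂ (ExteriorAlgebra ℂ (Cotangent n)))

instance (n : ℕ) : FiniteDimensional ℂ (Lam n) :=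
  Module.Finite.of_basis
    (Module.Basis.ExteriorAlgebra (Module.finBasis ℂ (Cotangent n)))

/-- Coordinates on the finite-dimensional space `Lam n`; they only serve to fix a norm on it (all
norms on it are equivalent). -/
def lamCoord (n : ℕ) :
    Lam n ≃ₗ[ℂ] (Fin (Module.finrank ℂ (Lam n)) → ℂ) :=
  (Module.finBasis ℂ (Lam n)).equivFun

instance (n : ℕ) : NormedAddCommGroup (Lam n) :=
  NormedAddCommGroup.induced (Lam n) (Fin (Module.finrank ℂ (Lam n)) → ℂ)
    (lamCoord n) (lamCoord n).injective

instance (n : ℕ) : NormedSpace ℂ (Lam n) :=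
  NormedSpace.induced ℂ (Lam n) (Fin (Module.finrank ℂ (Lam n)) → ℂ) (lamCoord n)

variable {n : ℕ}

/-- The inclusion of covectors as forms of degree one. -/
def incl : Cotangent n →ₗ[ℂ] Lam n := ExteriorAlgebra.ι ℂ

/-- The covector `dz_i`. -/
def dz (i : Fin n) : Cotangent n :=
  (EuclideanSpace.proj i : Model n →L[ℂ] ℂ).restrictScalars ℝ

/-- The covector `d\bar z_i`. -/
def dzbar (i : Fin n) : Cotangent n :=
  (Complex.conjCLE : ℂ →L[ℝ] ℂ).comp (dz i)

/-- The standard basis vectors of `ℂⁿ`. -/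
def basisVec (i : Fin n) : Model n := EuclideanSpace.single i (1 : ℂ)

/-- Forms of type `(p,q)` at a point: the span of the products of `p` of the `dz_i` and `q` of the
`d\bar z_i`. -/
def lamPQ (n p q : ℕ) : Submodule ℂ (Lam n) :=
  (Submodule.span ℂ (Set.range fun i : Fin n => incl (dz i))) ^ p *
    (Submodule.span ℂ (Set.range fun i : Fin n => incl (dzbar i))) ^ q

/-- The tangent vector `∂/∂z_i = (∂/∂x_i - √-1 ∂/∂y_i)/2`, as a functional on covectors. -/
def tangentVec (i : Fin n) : Module.Dual ℂ (Cotangent n) where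
  toFun l := (1 / 2 : ℂ) * (l (basisVec i) - Complex.I * l (Complex.I • basisVec i))
  map_add' l l' := by simp; ring
  map_smul' c l := by simp; ring

/-- The interior product with a (complexified) tangent vector. -/
def contr (v : Module.Dual ℂ (Cotangent n)) : Lam n →ₗ[ℂ] Lam n :=
  CliffordAlgebra.contractLeft v

/-- The pullback of covectors along a real-linear map. -/
def pullCov (A : Model n →L[ℝ] Model n) : Cotangent n →ₗ[ℂ] Cotangent n where
  toFun l := l.comp A
  map_add' _ _ := rfl
  map_smul' _ _ := rfl

/-- The pullback of forms at a point along a real-linear map. -/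
def pull (A : Model n →L[ℝ] Model n) : Lam n →ₐ[ℂ] Lam n :=
  ExteriorAlgebra.map (pullCov A)

/-- `∂f/∂z_i`. -/
def pdz {F : Type*} [NormedAddCommGroup F] [NormedSpace ℂ F] (i : Fin n) (f : Model n → F)
    (z : Model n) : F :=
  (1 / 2 : ℂ) •
    (fderiv ℝ f z (basisVec i) - Complex.I • fderiv ℝ f z (Complex.I • basisVec i))

/-- `∂f/∂\bar z_i`. -/
def pdzbar {F : Type*} [NormedAddCommGroup F] [NormedSpace ℂ F] (i : Fin n) (f : Model n → F)
    (z : Model n) : F :=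
  (1 / 2 : ℂ) •
    (fderiv ℝ f z (basisVec i) + Complex.I • fderiv ℝ f z (Complex.I • basisVec i))

/-! ### Differential forms on a complex manifold

Tensor fields are given by their local expressions in the charts of the atlas, which have to agree
on overlaps. Local expressions are extended by zero outside the image of the chart, so that equality
of fields is equality of families. -/

section Manifold

variable (n) (M : Type*) [TopologicalSpace M] [ChartedSpace (Model n) M]

/-- The change of coordinates from the chart `e` to the chart `e'`. -/
abbrev change {n : ℕ} {M : Type*} [TopologicalSpace M]
    (e e' : OpenPartialHomeomorph M (Model n)) : Model n → Model n :=
  fun z => e' (e.symm z)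

/-- The holomorphic Jacobian matrix `(∂f_i/∂z_j)` of the change of coordinates `f`. -/
def jac {n : ℕ} {M : Type*} [TopologicalSpace M]
    (e e' : OpenPartialHomeomorph M (Model n)) (z : Model n) : Matrix (Fin n) (Fin n) ℂ :=
  Matrix.of fun i j => fderiv ℂ (change e e') z (basisVec j) i

/-- A family of local expressions of a complex-valued form, one for each chart of the atlas. -/
abbrev Fam : Type _ := atlas (Model n) M → Model n → Lam n

/-- The space `A_M = ⨁ A_M^{p,q}` of smooth complex-valued differential forms on `M`. -/
def forms : Submodule ℂ (Fam n M) where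
  carrier := {w |
    (∀ e, ContDiffOn ℝ ∞ (w e) e.1.target) ∧
    (∀ e, ∀ z ∉ e.1.target, w e z = 0) ∧
    (∀ e e', ∀ z ∈ (e.1.symm.trans e'.1).source,
      w e z = pull (fderiv ℝ (change e.1 e'.1) z) (w e' (change e.1 e'.1 z)))}
  zero_mem' := ⟨fun _ => contDiffOn_const, fun _ _ _ => rfl, fun _ _ _ _ => by simp⟩
  add_mem' := by
    rintro a b ⟨a1, a2, a3⟩ ⟨b1, b2, b3⟩
    refine ⟨fun e => (a1 e).add (b1 e), fun e z hz => ?_, fun e e' z hz => ?_⟩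
    · simp [a2 e z hz, b2 e z hz]
    · simp [a3 e e' z hz, b3 e e' z hz]
  smul_mem' := by
    rintro c a ⟨a1, a2, a3⟩
    refine ⟨fun e => (contDiffOn_const (c := c)).smul (a1 e), fun e z hz => ?_,
      fun e e' z hz => ?_⟩
    · simp [a2 e z hz]
    · simp [a3 e e' z hz]

/-- The space `A_M^{p,q}` of smooth forms of type `(p,q)`. -/
def formsPQ (p q : ℕ) : Submodule ℂ (Fam n M) where
  carrier := {w | w ∈ forms n M ∧ ∀ e z, w e z ∈ lamPQ n p q}
  zero_mem' := ⟨zero_mem _, fun _ _ => zero_mem _⟩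
  add_mem' ha hb := ⟨add_mem ha.1 hb.1, fun e z => add_mem (ha.2 e z) (hb.2 e z)⟩
  smul_mem' c _ ha :=
    ⟨Submodule.smul_mem _ c ha.1, fun e z => Submodule.smul_mem _ c (ha.2 e z)⟩

variable {n M}

/-- The operator `∂`, locally `∂w = ∑ dz_i ∧ ∂w/∂z_i`. -/
def del (w : Fam n M) : Fam n M := fun e =>
  e.1.target.indicator fun z => ∑ i, incl (dz i) * pdz i (w e) z

/-- The operator `\bar∂`, locally `\bar∂w = ∑ d\bar z_i ∧ ∂w/∂\bar z_i`. -/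
def delbar (w : Fam n M) : Fam n M := fun e =>
  e.1.target.indicator fun z => ∑ i, incl (dzbar i) * pdzbar i (w e) z

/-! ### Holomorphic Poisson structures -/

/-- The Schouten bracket of two bivector fields `P = ½ ∑ P^{ij} ∂_i ∧ ∂_j`, `Q` of type `(2,0)` on an
open set of `ℂⁿ`: the coefficients of a trivector field. -/
def schouten (P Q : Model n → Matrix (Fin n) (Fin n) ℂ) (z : Model n) (i j k : Fin n) : ℂ :=
  ∑ l, (P z l i * pdz l (fun y => Q y j k) z + Q z l i * pdz l (fun y => P y j k) z) +
  ∑ l, (P z l j * pdz l (fun y => Q y k i) z + Q z l j * pdz l (fun y => P y k i) z) +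
  ∑ l, (P z l k * pdz l (fun y => Q y i j) z + Q z l k * pdz l (fun y => P y i j) z)

variable (n M) in
/-- A holomorphic Poisson bivector field `π`, given in each chart by `½ ∑ π^{ij} ∂_i ∧ ∂_j` with
`(π^{ij})` skew-symmetric and holomorphic (complex-analytic), such that `[π, π] = 0` for the Schouten bracket. -/
structure PoissonBivector where
  coeff : atlas (Model n) M → Model n → Matrix (Fin n) (Fin n) ℂ
  skew : ∀ e, ∀ z ∈ e.1.target, ∀ i j, coeff e z i j = -coeff e z j i
  holomorphic : ∀ e i j, AnalyticOnNhd ℂ (fun z => coeff e z i j) e.1.target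
  compat : ∀ e e', ∀ z ∈ (e.1.symm.trans e'.1).source,
    coeff e' (change e.1 e'.1 z) = jac e.1 e'.1 z * coeff e z * (jac e.1 e'.1 z).transpose
  jacobi : ∀ e, ∀ z ∈ e.1.target, ∀ i j k, schouten (coeff e) (coeff e) z i j k = 0

variable (P : PoissonBivector n M)

/-- The contraction `ι_π`, normalized by `ι_π(df ∧ dg) = π(df, dg)`. -/
def iotaPi (w : Fam n M) : Fam n M := fun e z =>
  (1 / 2 : ℂ) • ∑ i, ∑ j, P.coeff e z i j • contr (tangentVec j) (contr (tangentVec i) (w e z))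

/-- The Koszul–Brylinski operator `∂_π = ι_π ∂ - ∂ ι_π`. -/
def delPi (w : Fam n M) : Fam n M := iotaPi P (del w) - del (iotaPi P w)

/-- The bracket `[a, b]_{∂_π}` of a form `a` of degree `k` with a form `b`. -/
def bracket (k : ℕ) (a b : Fam n M) : Fam n M :=
  (-1 : ℂ) ^ k • (delPi P (a * b) - delPi P a * b - (-1 : ℂ) ^ k • (a * delPi P b))

variable (n M) in
/-- The `∂\bar∂`-lemma: `ker ∂ ∩ ker \bar∂ ∩ im d = im ∂\bar∂` on `A_M`, where `d = ∂ + \bar∂`. -/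
def DelDelbarLemma : Prop :=
  {b : Fam n M | b ∈ forms n M ∧ del b = 0 ∧ delbar b = 0 ∧
      ∃ a ∈ forms n M, b = del a + delbar a} =
    {b : Fam n M | ∃ c ∈ forms n M, b = del (delbar c)}

/-- The `∂_π\bar∂`-lemma: `ker ∂_π ∩ ker \bar∂ ∩ im (∂_π + \bar∂) = im ∂_π\bar∂` on `A_M`. -/
def DelPiDelbarLemma : Prop :=
  {b : Fam n M | b ∈ forms n M ∧ delPi P b = 0 ∧ delbar b = 0 ∧
      ∃ a ∈ forms n M, b = delPi P a + delbar a} =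
    {b : Fam n M | ∃ c ∈ forms n M, b = delPi P (delbar c)}

/-- The formal power series `∑_{k ≥ 1} α_k t^k` (a sequence of coefficients) is a Maurer–Cartan
element of `(A_M[[t]], \bar∂, [-,-]_{∂_π})`: each `α_k` is a `(1,1)`-form and
`\bar∂ α_t + ½ [α_t, α_t] = 0`, where the bracket is extended `ℂ[[t]]`-bilinearly. -/
structure IsMaurerCartan (α : ℕ → Fam n M) : Prop where
  zero : α 0 = 0
  mem : ∀ k, α k ∈ formsPQ n M 1 1
  eqn : ∀ k, delbar (α k) +
    (1 / 2 : ℂ) • ∑ ij ∈ Finset.HasAntidiagonal.antidiagonal k, bracket P 2 (α ij.1) (α ij.2) = 0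

/-! ### Forms with values in the holomorphic tangent bundle -/

variable (n M) in
/-- Local expressions `φ = ∑ φ^i ⊗ ∂/∂z_i` of forms with values in the holomorphic tangent
bundle. -/
abbrev VFam : Type _ := atlas (Model n) M → Model n → Fin n → Lam n

/-- The `i`-th components of the local expressions. -/
abbrev VFam.comp (φ : VFam n M) (i : Fin n) : Fam n M := fun e z => φ e z i

variable (n M) in
/-- The space `A^{0,q}(M, T_M)` of smooth `(0,q)`-forms with values in the holomorphic tangent
bundle. -/
def vforms (q : ℕ) : Submodule ℂ (VFam n M) where
  carrier := {φ |
    (∀ e i, ContDiffOn ℝ ∞ (fun z => φ e z i) e.1.target) ∧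
    (∀ e, ∀ z ∉ e.1.target, φ e z = 0) ∧
    (∀ e e', ∀ z ∈ (e.1.symm.trans e'.1).source, ∀ i,
      pull (fderiv ℝ (change e.1 e'.1) z) (φ e' (change e.1 e'.1 z) i) =
        ∑ j, jac e.1 e'.1 z i j • φ e z j) ∧
    (∀ e z i, φ e z i ∈ lamPQ n 0 q)}
  zero_mem' := ⟨fun _ _ => contDiffOn_const, fun _ _ _ => rfl, fun _ _ _ _ _ => by simp,
    fun _ _ _ => zero_mem _⟩
  add_mem' := by
    rintro a b ⟨a1, a2, a3, a4⟩ ⟨b1, b2, b3, b4⟩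
    refine ⟨fun e i => (a1 e i).add (b1 e i), fun e z hz => ?_, fun e e' z hz i => ?_,
      fun e z i => add_mem (a4 e z i) (b4 e z i)⟩
    · simp [a2 e z hz, b2 e z hz]
    · simp [a3 e e' z hz i, b3 e e' z hz i, Finset.sum_add_distrib]
  smul_mem' := by
    rintro c a ⟨a1, a2, a3, a4⟩
    refine ⟨fun e i => (contDiffOn_const (c := c)).smul (a1 e i), fun e z hz => ?_,
      fun e e' z hz i => ?_, fun e z i => Submodule.smul_mem _ c (a4 e z i)⟩
    · simp [a2 e z hz]
    · simp [a3 e e' z hz i, Finset.smul_sum, smul_comm c]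

/-- The operator `\bar∂` on forms with values in the holomorphic tangent bundle. -/
def vdelbar (φ : VFam n M) : VFam n M := fun e z i => delbar (φ.comp i) e z

/-- The Kodaira–Spencer bracket of `φ` of type `(0,p)` with `ψ` of type `(0,q)`, locally
`[φ, ψ]^i = ∑_j (φ^j ∧ ∂ψ^i/∂z_j - (-1)^{pq} ψ^j ∧ ∂φ^i/∂z_j)`. -/
def ksBracket (p q : ℕ) (φ ψ : VFam n M) : VFam n M := fun e =>
  e.1.target.indicator fun z i =>
    ∑ j, (φ e z j * pdz j (fun y => ψ e y i) z -
      (-1 : ℂ) ^ (p * q) • (ψ e z j * pdz j (fun y => φ e y i) z))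

/-- A formal deformation `∑_{k ≥ 1} φ_k t^k` of the complex structure of `M`: a Maurer–Cartan
element of the Kodaira–Spencer algebra with coefficients in `ℂ[[t]]`, that is,
`φ_k ∈ A^{0,1}(M, T_M)` and `\bar∂ φ_t + ½ [φ_t, φ_t] = 0`. -/
structure IsFormalDeformation (φ : ℕ → VFam n M) : Prop where
  zero : φ 0 = 0
  mem : ∀ k, φ k ∈ vforms n M 1
  eqn : ∀ k, vdelbar (φ k) +
    (1 / 2 : ℂ) • ∑ ij ∈ Finset.HasAntidiagonal.antidiagonal k, ksBracket 1 1 (φ ij.1) (φ ij.2) = 0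

/-! ### Dolbeault cohomology -/

lemma pdzbar_add {F : Type*} [NormedAddCommGroup F] [NormedSpace ℂ F] {f g : Model n → F}
    {z : Model n} (hf : DifferentiableAt ℝ f z) (hg : DifferentiableAt ℝ g z) (i : Fin n) :
    pdzbar i (f + g) z = pdzbar i f z + pdzbar i g z := by
  simp only [pdzbar, fderiv_add hf hg, add_apply, ← smul_add]
  congr 1
  simp only [smul_add]
  abel

lemma pdzbar_smul {F : Type*} [NormedAddCommGroup F] [NormedSpace ℂ F] {f : Model n → F}
    {z : Model n} (hf : DifferentiableAt ℝ f z) (c : ℂ) (i : Fin n) :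
    pdzbar i (c • f) z = c • pdzbar i f z := by
  simp only [pdzbar, fderiv_const_smul hf, smul_apply]
  simp only [smul_add, smul_comm c]

/-- All local expressions are smooth. -/
def SmoothFam (w : Fam n M) : Prop := ∀ e, ContDiffOn ℝ ∞ (w e) e.1.target

lemma SmoothFam.differentiableAt {w : Fam n M} (hw : SmoothFam w) (e : atlas (Model n) M)
    {z : Model n} (hz : z ∈ e.1.target) : DifferentiableAt ℝ (w e) z :=
  ((hw e).differentiableOn (by simp)).differentiableAt (e.1.open_target.mem_nhds hz)

lemma delbar_add {a b : Fam n M} (ha : SmoothFam a) (hb : SmoothFam b) :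
    delbar (a + b) = delbar a + delbar b := by
  funext e z
  by_cases hz : z ∈ e.1.target
  · simp only [delbar, Pi.add_apply, Set.indicator_of_mem hz]
    rw [← Finset.sum_add_distrib]
    refine Finset.sum_congr rfl fun i _ => ?_
    rw [pdzbar_add (ha.differentiableAt e hz) (hb.differentiableAt e hz), mul_add]
  · simp [delbar, hz]

lemma delbar_smul {a : Fam n M} (ha : SmoothFam a) (c : ℂ) :
    delbar (c • a) = c • delbar a := by
  funext e z
  by_cases hz : z ∈ e.1.target
  · simp only [delbar, Pi.smul_apply, Set.indicator_of_mem hz, Finset.smul_sum]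
    refine Finset.sum_congr rfl fun i _ => ?_
    rw [pdzbar_smul (ha.differentiableAt e hz), mul_smul_comm]
  · simp [delbar, hz]

lemma delbar_zero : delbar (0 : Fam n M) = 0 := by
  have := delbar_smul (n := n) (M := M) (a := 0) (fun _ => contDiffOn_const) 0
  simpa using this

lemma vdelbar_add {q : ℕ} {a b : VFam n M} (ha : a ∈ vforms n M q) (hb : b ∈ vforms n M q) :
    vdelbar (a + b) = vdelbar a + vdelbar b := by
  funext e z i
  exact congrFun (congrFun (delbar_add (a := a.comp i) (b := b.comp i)
    (fun e => ha.1 e i) (fun e => hb.1 e i)) e) z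

lemma vdelbar_smul {q : ℕ} {a : VFam n M} (ha : a ∈ vforms n M q) (c : ℂ) :
    vdelbar (c • a) = c • vdelbar a := by
  funext e z i
  exact congrFun (congrFun (delbar_smul (a := a.comp i) (fun e => ha.1 e i) c) e) z

lemma vdelbar_zero : vdelbar (0 : VFam n M) = 0 := by
  funext e z i
  exact congrFun (congrFun (delbar_zero (n := n) (M := M)) e) z

variable (n M) in
/-- The `\bar∂`-closed `(p,q)`-forms. -/
def cocycles (p q : ℕ) : Submodule ℂ (Fam n M) where
  carrier := {a | a ∈ formsPQ n M p q ∧ delbar a = 0}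
  zero_mem' := ⟨zero_mem _, delbar_zero⟩
  add_mem' ha hb := ⟨add_mem ha.1 hb.1, by
    rw [delbar_add ha.1.1.1 hb.1.1.1, ha.2, hb.2, add_zero]⟩
  smul_mem' c _ ha := ⟨Submodule.smul_mem _ c ha.1, by
    rw [delbar_smul ha.1.1.1, ha.2, smul_zero]⟩

variable (n M) in
/-- The `\bar∂`-exact `(p,q)`-forms. -/
def coboundaries (p : ℕ) : ℕ → Submodule ℂ (Fam n M)
  | 0 => ⊥
  | q + 1 =>
    { carrier := {b | ∃ a ∈ formsPQ n M p q, delbar a = b}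
      zero_mem' := ⟨0, zero_mem _, delbar_zero⟩
      add_mem' := by
        rintro _ _ ⟨a, ha, rfl⟩ ⟨b, hb, rfl⟩
        exact ⟨a + b, add_mem ha hb, delbar_add ha.1.1 hb.1.1⟩
      smul_mem' := by
        rintro c _ ⟨a, ha, rfl⟩
        exact ⟨c • a, Submodule.smul_mem _ c ha, delbar_smul ha.1.1 c⟩ }

variable (n M) in
/-- The Dolbeault cohomology `H^{p,q}_{\bar∂}(M)`. -/
abbrev Dolbeault (p q : ℕ) : Type _ :=
  cocycles n M p q ⧸ (coboundaries n M p q).submoduleOf (cocycles n M p q)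

variable (n M) in
/-- The `\bar∂`-closed elements of `A^{0,q}(M, T_M)`. -/
def vcocycles (q : ℕ) : Submodule ℂ (VFam n M) where
  carrier := {a | a ∈ vforms n M q ∧ vdelbar a = 0}
  zero_mem' := ⟨zero_mem _, vdelbar_zero⟩
  add_mem' ha hb := ⟨add_mem ha.1 hb.1, by
    rw [vdelbar_add ha.1 hb.1, ha.2, hb.2, add_zero]⟩
  smul_mem' c _ ha := ⟨Submodule.smul_mem _ c ha.1, by
    rw [vdelbar_smul ha.1, ha.2, smul_zero]⟩

variable (n M) in
/-- The `\bar∂`-exact elements of `A^{0,q}(M, T_M)`. -/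
def vcoboundaries : ℕ → Submodule ℂ (VFam n M)
  | 0 => ⊥
  | q + 1 =>
    { carrier := {b | ∃ a ∈ vforms n M q, vdelbar a = b}
      zero_mem' := ⟨0, zero_mem _, vdelbar_zero⟩
      add_mem' := by
        rintro _ _ ⟨a, ha, rfl⟩ ⟨b, hb, rfl⟩
        exact ⟨a + b, add_mem ha hb, vdelbar_add ha hb⟩
      smul_mem' := by
        rintro c _ ⟨a, ha, rfl⟩
        exact ⟨c • a, Submodule.smul_mem _ c ha, vdelbar_smul ha c⟩ }

variable (n M) in
/-- The cohomology `H^q(M, T_M)` of the holomorphic tangent sheaf, as the cohomology of the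
Dolbeault complex `(A^{0,•}(M, T_M), \bar∂)`. -/
abbrev TangentCohomology (q : ℕ) : Type _ :=
  vcocycles n M q ⧸ (vcoboundaries n M q).submoduleOf (vcocycles n M q)

/-- A class in `H^1(M, T_M)` is tangent to a formal deformation of the complex structure: it is the
class of the first-order term `φ_1` of some formal deformation `∑ φ_k t^k`. -/
def IsTangentToFormalDeformation (c : TangentCohomology n M 1) : Prop :=
  ∃ φ : ℕ → VFam n M, IsFormalDeformation φ ∧
    ∃ h : φ 1 ∈ vcocycles n M 1, Submodule.Quotient.mk ⟨φ 1, h⟩ = c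

/-! ### The map `π^♯` -/

/-- The map `π^♯ : A_M^{1,q} → A^{0,q}(M, T_M)`, locally
`dz_i ∧ β ↦ -X_{z_i} ⊗ β` for `β` of type `(0,q)`, where `X_{z_i} = ∑_j π^{ij} ∂/∂z_j` is the
Hamiltonian vector field of `z_i`. -/
def sharp : Fam n M →ₗ[ℂ] VFam n M where
  toFun w := fun e z j => -∑ i, P.coeff e z i j • contr (tangentVec i) (w e z)
  map_add' a b := by
    funext e z j
    simp [Finset.sum_add_distrib, add_comm]
  map_smul' c a := by
    funext e z j
    simp [Finset.smul_sum, smul_comm c]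

/-! The following facts show that `π^♯` is well defined on cohomology. -/

lemma contr_incl_mul (v : Module.Dual ℂ (Cotangent n)) (l : Cotangent n) (x : Lam n) :
    contr v (incl l * x) = v l • x - incl l * contr v x :=
  CliffordAlgebra.contractLeft_ι_mul v l x

lemma contr_algebraMap (v : Module.Dual ℂ (Cotangent n)) (r : ℂ) :
    contr v (algebraMap ℂ (Lam n) r) = 0 :=
  CliffordAlgebra.contractLeft_algebraMap _ v r

lemma pull_incl (A : Model n →L[ℝ] Model n) (l : Cotangent n) :
    pull A (incl l) = incl (pullCov A l) :=
  ExteriorAlgebra.map_apply_ι _ _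

lemma lam_induction {C : Lam n → Prop} (h0 : ∀ r : ℂ, C (algebraMap ℂ (Lam n) r))
    (hadd : ∀ x y, C x → C y → C (x + y)) (hmul : ∀ x l, C x → C (incl l * x)) (x : Lam n) :
    C x :=
  CliffordAlgebra.left_induction (Q := (0 : QuadraticForm ℂ (Cotangent n))) (P := C) h0 hadd hmul x

/-- Naturality of the interior product. -/
lemma contr_pull (v : Module.Dual ℂ (Cotangent n)) (A : Model n →L[ℝ] Model n) (x : Lam n) :
    contr v (pull A x) = pull A (contr (v ∘ₗ pullCov A) x) := by
  induction x using lam_induction with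
  | h0 r => rw [AlgHom.commutes, contr_algebraMap, contr_algebraMap, map_zero]
  | hadd x y hx hy => simp only [map_add, hx, hy]
  | hmul x l hx =>
    rw [map_mul, pull_incl, contr_incl_mul, contr_incl_mul, map_sub, map_smul, map_mul, pull_incl,
      hx]
    rfl

lemma contr_sum_smul {ι : Type*} (s : Finset ι) (c : ι → ℂ)
    (v : ι → Module.Dual ℂ (Cotangent n)) (x : Lam n) :
    contr (∑ i ∈ s, c i • v i) x = ∑ i ∈ s, c i • contr (v i) x := by
  have h : ∀ w : Module.Dual ℂ (Cotangent n), contr w x =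
    (CliffordAlgebra.contractLeft (Q := (0 : QuadraticForm ℂ (Cotangent n)))).flip x w :=
    fun _ => rfl
  simp only [h]
  exact (map_sum _ _ _).trans (Finset.sum_congr rfl fun i _ => map_smul _ _ _)

lemma model_eq_sum (v : Model n) : v = ∑ k, v k • basisVec k := by
  ext i
  simp [basisVec, Finset.sum_apply, Pi.single_apply]

lemma tangentVec_comp_pullCov (A : Model n →L[ℂ] Model n) (a : Fin n) :
    tangentVec a ∘ₗ pullCov (A.restrictScalars ℝ) =
      ∑ k, A (basisVec a) k • tangentVec (n := n) k := by
  have key : ∀ (l : Cotangent n) (v : Model n), l v - Complex.I * l (Complex.I • v) =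
      ∑ k, v k * (l (basisVec k) - Complex.I * l (Complex.I • basisVec k)) := by
    intro l v
    have hc : ∀ (c : ℂ) (w : Model n), l (c • w) - Complex.I * l (Complex.I • c • w) =
        c * (l w - Complex.I * l (Complex.I • w)) := by
      intro c w
      have e1 : c • w = c.re • w + c.im • (Complex.I • w) := by
        nth_rewrite 1 [← Complex.re_add_im c]
        rw [add_smul, mul_smul]
        rfl
      have e2 : Complex.I • c • w = c.re • (Complex.I • w) - c.im • w := by
        rw [e1, smul_add, smul_comm Complex.I, smul_comm Complex.I, smul_smul Complex.I,
          Complex.I_mul_I, neg_one_smul, smul_neg, sub_eq_add_neg]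
      have e3 : ∀ (r : ℝ) (u : Model n), l (r • u) = (r : ℂ) * l u := fun r u => by
        rw [ContinuousLinearMap.map_smul, Complex.real_smul]
      rw [e2, e1, map_add, map_sub, e3, e3, e3, e3]
      conv_rhs => rw [← Complex.re_add_im c]
      linear_combination ((c.im : ℂ) * l (Complex.I • w)) * Complex.I_sq
    conv_lhs => rw [model_eq_sum v]
    simp only [Finset.smul_sum, map_sum, Finset.mul_sum]
    rw [← Finset.sum_sub_distrib]
    exact Finset.sum_congr rfl fun k _ => hc _ _
  refine LinearMap.ext fun l => ?_
  have h1 : (tangentVec a ∘ₗ pullCov (A.restrictScalars ℝ)) l =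
      (1 / 2 : ℂ) * (l (A (basisVec a)) - Complex.I * l (Complex.I • A (basisVec a))) := by
    rw [← map_smul A]
    rfl
  rw [h1, LinearMap.sum_apply, key l (A (basisVec a)), Finset.mul_sum]
  simp only [LinearMap.smul_apply, tangentVec, LinearMap.coe_mk, AddHom.coe_mk, smul_eq_mul]
  exact Finset.sum_congr rfl fun k _ => by ring

lemma tangentVec_dzbar (i j : Fin n) : tangentVec i (dzbar j) = 0 := by
  by_cases h : j = i <;> simp [tangentVec, dzbar, dz, basisVec, h]

lemma contr_lamPQ_zero {q : ℕ} (i : Fin n) {x : Lam n}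
    (hx : x ∈ (Submodule.span ℂ (Set.range fun i : Fin n => incl (dzbar i))) ^ q) :
    contr (tangentVec i) x = 0 := by
  induction hx using Submodule.pow_induction_on_left' with
  | algebraMap r => exact contr_algebraMap _ _
  | add x y k _ _ hx hy => rw [map_add, hx, hy, add_zero]
  | mem_mul m hm k x _ hx =>
    induction hm using Submodule.span_induction with
    | mem y hy =>
      obtain ⟨j, rfl⟩ := hy
      simp only
      rw [contr_incl_mul, hx, tangentVec_dzbar, zero_smul, mul_zero, sub_zero]
    | zero => simp
    | add y z _ _ hy hz => rw [add_mul, map_add, hy, hz, add_zero]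
    | smul c y _ hy => rw [smul_mul_assoc, map_smul, hy, smul_zero]

lemma contr_lamPQ {q : ℕ} (i : Fin n) {x : Lam n} (hx : x ∈ lamPQ n 1 q) :
    contr (tangentVec i) x ∈ lamPQ n 0 q := by
  rw [lamPQ, pow_one] at hx
  rw [lamPQ, pow_zero, one_mul]
  induction hx using Submodule.mul_induction_on' with
  | mem_mul_mem a ha b hb =>
    induction ha using Submodule.span_induction with
    | mem y hy =>
      obtain ⟨j, rfl⟩ := hy
      simp only
      rw [contr_incl_mul, contr_lamPQ_zero i hb, mul_zero, sub_zero]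
      exact Submodule.smul_mem _ _ hb
    | zero => simp
    | add y z _ _ hy hz => rw [add_mul, map_add]; exact add_mem hy hz
    | smul c y _ hy => rw [smul_mul_assoc, map_smul]; exact Submodule.smul_mem _ _ hy
  | add x _ y _ hx hy => rw [map_add]; exact add_mem hx hy

/-- The interior product as a real-linear continuous map. -/
def contrL (v : Module.Dual ℂ (Cotangent n)) : Lam n →L[ℝ] Lam n :=
  (LinearMap.toContinuousLinearMap (contr v)).restrictScalars ℝ

lemma contrL_apply (v : Module.Dual ℂ (Cotangent n)) (x : Lam n) : contrL v x = contr v x := rfl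

lemma pdzbar_smul_contr {f : Model n → Lam n} {c : Model n → ℂ} {z : Model n}
    (hf : DifferentiableAt ℝ f z) (hc : DifferentiableAt ℂ c z)
    (v : Module.Dual ℂ (Cotangent n)) (l : Fin n) :
    pdzbar l (fun y => c y • contr v (f y)) z = c z • contr v (pdzbar l f z) := by
  have h1 : HasFDerivAt (fun y => contr v (f y)) ((contrL v).comp (fderiv ℝ f z)) z :=
    (contrL v).hasFDerivAt.comp z hf.hasFDerivAt
  have h2 := hc.hasFDerivAt.restrictScalars ℝ
  have h3 := h2.smul h1
  unfold pdzbar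
  rw [show (fun y => c y • contr v (f y)) = c • (fun y => contr v (f y)) from rfl, h3.fderiv]
  simp only [add_apply, smul_apply, ContinuousLinearMap.smulRight_apply,
    ContinuousLinearMap.comp_apply, contrL_apply, ContinuousLinearMap.coe_restrictScalars',
    map_smul, map_add, smul_eq_mul, smul_add, smul_smul]
  rw [show Complex.I * (Complex.I * (fderiv ℂ c z) (basisVec l)) = -(fderiv ℂ c z) (basisVec l) by
    rw [← mul_assoc, Complex.I_mul_I, neg_one_mul]]
  module

lemma pdzbar_neg {F : Type*} [NormedAddCommGroup F] [NormedSpace ℂ F] {f : Model n → F}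
    {z : Model n} (i : Fin n) : pdzbar i (fun y => -f y) z = -pdzbar i f z := by
  simp only [pdzbar, fderiv_fun_neg, neg_apply]
  module

lemma pdzbar_sum {F : Type*} [NormedAddCommGroup F] [NormedSpace ℂ F] {ι : Type*} (s : Finset ι)
    {f : ι → Model n → F} {z : Model n} (hf : ∀ a ∈ s, DifferentiableAt ℝ (f a) z) (i : Fin n) :
    pdzbar i (fun y => ∑ a ∈ s, f a y) z = ∑ a ∈ s, pdzbar i (f a) z := by
  simp only [pdzbar, fderiv_fun_sum hf, sum_apply, Finset.smul_sum,
    ← Finset.sum_add_distrib]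

/-- `π^♯` anticommutes with `\bar∂`. -/
lemma vdelbar_sharp {w : Fam n M} (hw : SmoothFam w) :
    vdelbar (sharp P w) = -sharp P (delbar w) := by
  funext e z j
  by_cases hz : z ∈ e.1.target
  · have hd := hw.differentiableAt e hz
    have hc : ∀ i, DifferentiableAt ℂ (fun y => P.coeff e y i j) z := fun i =>
      (P.holomorphic e i j z hz).differentiableAt
    have hdd : ∀ i ∈ Finset.univ, DifferentiableAt ℝ
        (fun y => P.coeff e y i j • contr (tangentVec i) (w e y)) z := fun i _ =>
      ((hc i).restrictScalars ℝ).smul ((contrL _).differentiableAt.comp z hd)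
    simp only [vdelbar, delbar, Set.indicator_of_mem hz, sharp, LinearMap.coe_mk,
      AddHom.coe_mk, Pi.neg_apply, neg_neg]
    simp only [pdzbar_neg, pdzbar_sum _ hdd, pdzbar_smul_contr hd (hc _), map_sum, contr_incl_mul,
      tangentVec_dzbar, zero_smul, zero_sub, Finset.smul_sum, Finset.mul_sum, mul_neg, smul_neg,
      mul_smul_comm, Finset.sum_neg_distrib]
    rw [Finset.sum_comm]
  · simp [vdelbar, delbar, hz, sharp]

lemma change_differentiableAt [IsManifold (modelWithCornersSelf ℂ (Model n)) ω M]
    (e e' : atlas (Model n) M) {z : Model n} (hz : z ∈ (e.1.symm.trans e'.1).source) :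
    DifferentiableAt ℂ (change e.1 e'.1) z := by
  have h := ((contDiffGroupoid ω (modelWithCornersSelf ℂ (Model n))).compatible e.2 e'.2)
  rw [contDiffGroupoid, mem_groupoid_of_pregroupoid, contDiffPregroupoid] at h
  have h1 : ContDiffOn ℂ ω (change e.1 e'.1) (e.1.symm.trans e'.1).source := by
    have := h.1
    simpa [change, Function.comp_def] using this
  exact (h1.differentiableOn (by simp)).differentiableAt
    ((e.1.symm.trans e'.1).open_source.mem_nhds hz)

lemma sharp_mem [IsManifold (modelWithCornersSelf ℂ (Model n)) ω M] {q : ℕ} {w : Fam n M}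
    (hw : w ∈ formsPQ n M 1 q) : sharp P w ∈ vforms n M q := by
  obtain ⟨⟨h1, h2, h3⟩, h4⟩ := hw
  refine ⟨fun e j => ?_, fun e z hz => ?_, fun e e' z hz i => ?_, fun e z j => ?_⟩
  · refine ContDiffOn.neg (ContDiffOn.sum fun i _ => ContDiffOn.fun_smul ?_ ?_)
    · exact ((P.holomorphic e i j).contDiffOn e.1.open_target.uniqueDiffOn).restrict_scalars ℝ
    · exact (contrL (tangentVec i)).contDiff.comp_contDiffOn (h1 e)
  · funext j
    simp [sharp, h2 e z hz]
  · have hd := change_differentiableAt e e' hz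
    have hJ : fderiv ℝ (change e.1 e'.1) z = (fderiv ℂ (change e.1 e'.1) z).restrictScalars ℝ :=
      (hd.hasFDerivAt.restrictScalars ℝ).fderiv
    have hcomp := P.compat e e' z hz
    have hw := h3 e e' z hz
    simp only [sharp, LinearMap.coe_mk, AddHom.coe_mk, map_neg, map_sum, map_smul, smul_neg,
      Finset.sum_neg_distrib, neg_inj]
    rw [hcomp, hw, hJ]
    simp only [contr_pull, tangentVec_comp_pullCov, contr_sum_smul, map_sum, map_smul,
      Matrix.mul_apply, Matrix.transpose_apply, Finset.sum_smul, Finset.smul_sum, Finset.sum_mul,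
      smul_smul]
    have hjac : ∀ a b, (fderiv ℂ (change e.1 e'.1) z) (basisVec a) b = jac e.1 e'.1 z b a :=
      fun _ _ => rfl
    simp only [hjac]
    rw [Finset.sum_comm]
    refine Finset.sum_congr rfl fun j _ => ?_
    rw [Finset.sum_comm]
    refine Finset.sum_congr rfl fun a _ => Finset.sum_congr rfl fun k _ => ?_
    congr 1
    ring
  · exact neg_mem (sum_mem fun i _ => Submodule.smul_mem _ _ (contr_lamPQ i (h4 e z)))

lemma sharp_mem_vcocycles [IsManifold (modelWithCornersSelf ℂ (Model n)) ω M] {q : ℕ}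
    {w : Fam n M} (hw : w ∈ cocycles n M 1 q) : sharp P w ∈ vcocycles n M q :=
  ⟨sharp_mem P hw.1, by rw [vdelbar_sharp P hw.1.1.1, hw.2, map_zero, neg_zero]⟩

lemma sharp_mem_vcoboundaries [IsManifold (modelWithCornersSelf ℂ (Model n)) ω M] {q : ℕ}
    {w : Fam n M} (hw : w ∈ coboundaries n M 1 q) : sharp P w ∈ vcoboundaries n M q := by
  cases q with
  | zero =>
    have : w = 0 := hw
    rw [this, map_zero]
    exact zero_mem _
  | succ q =>
    obtain ⟨a, ha, rfl⟩ := hw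
    exact ⟨-sharp P a, neg_mem (sharp_mem P ha), by
      rw [← neg_one_smul ℂ (sharp P a), vdelbar_smul (sharp_mem P ha), vdelbar_sharp P ha.1.1]
      simp⟩

/-- The map `π^♯ : H^{1,q}_{\bar∂}(M) → H^q(M, T_M)`, sending the class of `α` to that of
`π^♯ α`. -/
def sharpCohomology [IsManifold (modelWithCornersSelf ℂ (Model n)) ω M] (q : ℕ) :
    Dolbeault n M 1 q →ₗ[ℂ] TangentCohomology n M q :=
  Submodule.mapQ _ _
    ((sharp P).restrict fun _ hw => sharp_mem_vcocycles P hw :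
      cocycles n M 1 q →ₗ[ℂ] vcocycles n M q)
    fun _ hw => sharp_mem_vcoboundaries P hw

end Manifold

end HolomorphicPoisson
end

/-!
Both conclusions come from one recursive construction on forms, carried to vector-valued forms
by `π^♯`.

In a holomorphic chart `∂_π = [ι_π, ∂]` is a second-order operator for the wedge product, since
`ι_π` is a contraction of order two and `∂` a derivation. Hence the bracket it generates is a
biderivation, given in coordinates by `bracket_apply`. The Jacobi identity for the coefficients
of `π` (`coeff_jacobi`) says exactly that `∂_π` commutes with `ι_π` (`iotaPi_delPi`), from which
`∂_π² = 0`; holomorphy of `π` gives `\bar∂ ∂_π = -∂_π \bar∂`. The operators act on compatible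
families of forms in charts, and they preserve compatibility because `d`, its two Dolbeault parts
and the contraction with `π` are natural under holomorphic changes of coordinates.

Let `D` be `∂` or `∂_π`, whichever satisfies its lemma. A `\bar∂`-closed form `Dy` of pure type is
of the form `D \bar∂ z` with `z` of the type that degrees prescribe
(`SatisfiesDelbarLemma.exists_eq`). Therefore every class in `H^{1,1}` has a representative `α₁`
with `D α₁ = 0`, and then `∂_π α₁ = 0`. On `∂_π`-closed even forms the bracket is
`[α, β] = ∂_π (α ∧ β)`, so the equation in order `k` reads `\bar∂ α_k = -½ ∑ ∂_π (α_i ∧ α_j)`, the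
sum being over `i + j = k`. The right-hand side is `D`-exact when all `α_i` are `D`-closed, and it
is `\bar∂`-closed by the equations of lower order: the terms `∂_π (∂_π (α_i ∧ α_j) ∧ α_l)` left
over add up, by the biderivation property and `∂_π² = 0`, to zero (`delbar_sum_delPi_mul`). The
lemma then solves the equation by a `D`-exact, hence `D`-closed, form `α_k`
(`exists_isMaurerCartan`).

For the second conclusion, `π^♯` anticommutes with `\bar∂` and takes the bracket of two forms of
type `(1,1)` to minus their Kodaira–Spencer bracket (`sharp_bracket`, again by the Jacobi
identity), so that `φ_k = π^♯ α_k` solves the Maurer–Cartan equation.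
-/

open scoped ContDiff Manifold

noncomputable section

namespace HolomorphicPoisson

variable {n : ℕ}

/-! ### The grade involution and the sign rules of the exterior algebra -/

/-- The grade involution of the exterior algebra, `(-1)^k` on forms of degree `k`. It carries the
signs of the Leibniz rules, so that these can be stated without homogeneity assumptions. -/
def gradeInv : Lam n →ₐ[ℂ] Lam n :=
  CliffordAlgebra.involute (Q := (0 : QuadraticForm ℂ (Cotangent n)))

lemma gradeInv_incl (l : Cotangent n) : gradeInv (incl l) = -incl l :=
  CliffordAlgebra.involute_ι l

lemma incl_sq (l : Cotangent n) : incl l * incl l = 0 := ExteriorAlgebra.ι_sq_zero l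

lemma incl_anticomm (l m : Cotangent n) : incl l * incl m = -(incl m * incl l) := by
  have h := incl_sq (l + m)
  rw [map_add, mul_add, add_mul, add_mul, incl_sq, incl_sq, zero_add, add_zero] at h
  exact eq_neg_of_add_eq_zero_right h

lemma incl_mul (l : Cotangent n) (x : Lam n) : incl l * x = gradeInv x * incl l := by
  induction x using lam_induction with
  | h0 r => rw [AlgHom.commutes, Algebra.commutes]
  | hadd x y hx hy => rw [mul_add, map_add, add_mul, hx, hy]
  | hmul x m hx =>
    rw [map_mul, gradeInv_incl, mul_assoc, ← hx, ← mul_assoc, incl_anticomm, neg_mul, neg_mul,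
      mul_assoc]

/-- Even elements of the exterior algebra are central. -/
lemma mul_comm_of_even {x : Lam n} (hx : gradeInv x = x) (y : Lam n) : x * y = y * x := by
  induction y using lam_induction with
  | h0 r => rw [Algebra.commutes]
  | hadd y z hy hz => rw [mul_add, add_mul, hy, hz]
  | hmul y m hy => rw [← mul_assoc, mul_assoc (incl m), ← hy, ← mul_assoc, incl_mul m x, hx]

lemma mul_comm_of_odd {x : Lam n} (hx : gradeInv x = -x) (y : Lam n) :
    x * y = gradeInv y * x := by
  induction y using lam_induction with
  | h0 r => rw [AlgHom.commutes, Algebra.commutes]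
  | hadd y z hy hz => rw [mul_add, map_add, add_mul, hy, hz]
  | hmul y m hy =>
    have h := incl_mul m x
    rw [hx, neg_mul] at h
    rw [map_mul, gradeInv_incl, mul_assoc, ← hy, ← mul_assoc, ← mul_assoc, neg_mul, h, neg_neg]

lemma contr_mul (v : Module.Dual ℂ (Cotangent n)) (x y : Lam n) :
    contr v (x * y) = contr v x * y + gradeInv x * contr v y := by
  induction x using lam_induction with
  | h0 r =>
    rw [contr_algebraMap, zero_mul, zero_add, AlgHom.commutes, ← Algebra.smul_def,
      ← Algebra.smul_def, map_smul]
  | hadd x z hx hz => simp only [add_mul, map_add, hx, hz]; abel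
  | hmul x m hx =>
    rw [mul_assoc, contr_incl_mul, hx, contr_incl_mul, map_mul, gradeInv_incl, sub_mul, mul_add,
      smul_mul_assoc, mul_assoc, neg_mul, neg_mul, mul_assoc]
    abel

lemma contr_contr (v w : Module.Dual ℂ (Cotangent n)) (x : Lam n) :
    contr v (contr w x) = -contr w (contr v x) :=
  CliffordAlgebra.contractLeft_comm v w x

lemma gradeInv_contr (v : Module.Dual ℂ (Cotangent n)) (x : Lam n) :
    gradeInv (contr v x) = -contr v (gradeInv x) := by
  induction x using lam_induction with
  | h0 r => rw [AlgHom.commutes, contr_algebraMap, map_zero, neg_zero]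
  | hadd x y hx hy => simp only [map_add, hx, hy]; abel
  | hmul x m hx =>
    rw [contr_incl_mul, map_sub, map_smul, map_mul, map_mul, gradeInv_incl, hx, neg_mul, neg_mul,
      map_neg, contr_incl_mul]
    simp

/-! ### Type decomposition at a point -/

lemma tangentVec_apply (i : Fin n) (l : Cotangent n) :
    tangentVec i l = (1 / 2 : ℂ) * (l (basisVec i) - Complex.I * l (Complex.I • basisVec i)) := rfl

lemma tangentVec_dz (i j : Fin n) : tangentVec i (dz j) = if i = j then (1 : ℂ) else 0 := by
  by_cases h : i = j
  · subst h
    simp [tangentVec_apply, dz, basisVec]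
    norm_num
  · simp [tangentVec_apply, dz, basisVec, h, Ne.symm h]

/-- The tangent vector `∂/∂\bar z_i`, as a functional on covectors. -/
def tangentVecBar (i : Fin n) : Module.Dual ℂ (Cotangent n) where
  toFun l := (1 / 2 : ℂ) * (l (basisVec i) + Complex.I * l (Complex.I • basisVec i))
  map_add' l l' := by simp; ring
  map_smul' c l := by simp; ring

lemma tangentVecBar_apply (i : Fin n) (l : Cotangent n) : tangentVecBar i l =
    (1 / 2 : ℂ) * (l (basisVec i) + Complex.I * l (Complex.I • basisVec i)) := rfl

lemma tangentVecBar_dz (i j : Fin n) : tangentVecBar i (dz j) = 0 := by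
  by_cases h : j = i <;> simp [tangentVecBar_apply, dz, basisVec, h]

lemma tangentVecBar_dzbar (i j : Fin n) :
    tangentVecBar i (dzbar j) = if i = j then (1 : ℂ) else 0 := by
  by_cases h : i = j
  · subst h
    simp [tangentVecBar_apply, dzbar, dz, basisVec]
    norm_num
  · simp [tangentVecBar_apply, dzbar, dz, basisVec, h, Ne.symm h]

lemma cotangent_zero_smul (l : Cotangent n) : (0 : ℂ) • l = 0 := zero_smul ℂ l

lemma cotangent_add_smul (a b : ℂ) (l : Cotangent n) : (a + b) • l = a • l + b • l :=
  add_smul a b l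

/-- The component of type `(1,0)` of a covector. -/
def holPart : Cotangent n →ₗ[ℂ] Cotangent n where
  toFun l := ∑ i, tangentVec i l • dz i
  map_add' l m := by simp only [map_add, cotangent_add_smul, Finset.sum_add_distrib]
  map_smul' c l := by simp only [map_smul, smul_assoc, Finset.smul_sum, RingHom.id_apply]

/-- The component of type `(0,1)` of a covector. -/
def antiPart : Cotangent n →ₗ[ℂ] Cotangent n where
  toFun l := ∑ i, tangentVecBar i l • dzbar i
  map_add' l m := by simp only [map_add, cotangent_add_smul, Finset.sum_add_distrib]
  map_smul' c l := by simp only [map_smul, smul_assoc, Finset.smul_sum, RingHom.id_apply]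

lemma holPart_apply (l : Cotangent n) : holPart l = ∑ i, tangentVec i l • dz i := rfl

lemma antiPart_apply (l : Cotangent n) : antiPart l = ∑ i, tangentVecBar i l • dzbar i := rfl

lemma cotangent_apply (l : Cotangent n) (v : Model n) : l v =
    ∑ k, ((v k).re * l (basisVec k) + (v k).im * l (Complex.I • basisVec k)) := by
  conv_lhs => rw [model_eq_sum v, map_sum]
  refine Finset.sum_congr rfl fun k _ => ?_
  have e : v k • basisVec k =
      (v k).re • basisVec (n := n) k + (v k).im • (Complex.I • basisVec k) := by
    nth_rewrite 1 [← Complex.re_add_im (v k)]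
    rw [add_smul, mul_smul]
    rfl
  rw [e, map_add, ContinuousLinearMap.map_smul, ContinuousLinearMap.map_smul, Complex.real_smul,
    Complex.real_smul]

lemma holPart_add_antiPart (l : Cotangent n) : holPart l + antiPart l = l := by
  ext v
  rw [cotangent_apply l v, holPart_apply, antiPart_apply, ← Finset.sum_add_distrib]
  simp only [sum_apply, add_apply, smul_apply]
  refine Finset.sum_congr rfl fun k _ => ?_
  have h1 : dz k v = v k := rfl
  have h2 : dzbar k v = (starRingEnd ℂ) (v k) := rfl
  rw [h1, h2, tangentVec_apply, tangentVecBar_apply, smul_eq_mul, smul_eq_mul]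
  conv_lhs => rw [← Complex.re_add_im (v k)]
  simp only [map_add, map_mul, Complex.conj_ofReal, Complex.conj_I]
  linear_combination (-((v k).im : ℂ) * l (Complex.I • basisVec k)) * Complex.I_sq

lemma holPart_dz (i : Fin n) : holPart (dz i) = dz i := by
  simp [cotangent_zero_smul, ite_smul, holPart_apply, tangentVec_dz]

lemma antiPart_dz (i : Fin n) : antiPart (dz i) = 0 := by
  simp [cotangent_zero_smul, antiPart_apply, tangentVecBar_dz]

lemma holPart_dzbar (i : Fin n) : holPart (dzbar i) = 0 := by
  simp [cotangent_zero_smul, holPart_apply, tangentVec_dzbar]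

lemma antiPart_dzbar (i : Fin n) : antiPart (dzbar i) = dzbar i := by
  simp [cotangent_zero_smul, ite_smul, antiPart_apply, tangentVecBar_dzbar]

lemma tangentVec_holPart (i : Fin n) (l : Cotangent n) :
    tangentVec i (holPart l) = tangentVec i l := by
  simp [holPart_apply, map_sum, tangentVec_dz]

lemma tangentVec_antiPart (i : Fin n) (l : Cotangent n) : tangentVec i (antiPart l) = 0 := by
  simp [antiPart_apply, map_sum, tangentVec_dzbar]

lemma holPart_apply_vec (l : Cotangent n) (v : Model n) :
    holPart l v = (1 / 2 : ℂ) * (l v - Complex.I * l (Complex.I • v)) := by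
  have h1 : ∀ i, dz i (Complex.I • v) = Complex.I * dz i v := fun _ => rfl
  have h2 : ∀ i, dzbar i (Complex.I • v) = -Complex.I * dzbar i v := fun i => by
    have : dzbar i (Complex.I • v) = (starRingEnd ℂ) (Complex.I * v i) := rfl
    rw [this, map_mul, Complex.conj_I]
    rfl
  have a1 : holPart l (Complex.I • v) = Complex.I * holPart l v := by
    simp only [holPart_apply, sum_apply, smul_apply, h1, smul_eq_mul, Finset.mul_sum]
    exact Finset.sum_congr rfl fun i _ => by ring
  have a2 : antiPart l (Complex.I • v) = -Complex.I * antiPart l v := by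
    simp only [antiPart_apply, sum_apply, smul_apply, h2, smul_eq_mul, Finset.mul_sum]
    exact Finset.sum_congr rfl fun i _ => by ring
  conv_rhs => rw [← holPart_add_antiPart l]
  simp only [add_apply, a1, a2]
  linear_combination (-(1 / 2) * antiPart l v + 1 / 2 * holPart l v) * Complex.I_sq

lemma holPart_pullCov (A : Model n →L[ℂ] Model n) (l : Cotangent n) :
    holPart (pullCov (A.restrictScalars ℝ) l) = pullCov (A.restrictScalars ℝ) (holPart l) := by
  ext v
  have : ∀ (m : Cotangent n) (w : Model n), pullCov (A.restrictScalars ℝ) m w = m (A w) :=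
    fun _ _ => rfl
  rw [holPart_apply_vec, this, this, this, map_smul, holPart_apply_vec]

lemma antiPart_pullCov (A : Model n →L[ℂ] Model n) (l : Cotangent n) :
    antiPart (pullCov (A.restrictScalars ℝ) l) = pullCov (A.restrictScalars ℝ) (antiPart l) := by
  have h1 : antiPart l = l - holPart l := eq_sub_of_add_eq' (holPart_add_antiPart l)
  have h2 := holPart_add_antiPart (pullCov (A.restrictScalars ℝ) l)
  rw [h1, map_sub, ← holPart_pullCov]
  exact eq_sub_of_add_eq' h2

/-- The covector `X l^{1,0} + Y l^{0,1}` with coefficients in `ℂ[Y][X]`. -/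
def bigradingCov : Cotangent n →ₗ[ℂ] Polynomial (Polynomial (Lam n)) where
  toFun l := Polynomial.monomial 1 (Polynomial.monomial 0 (incl (holPart l))) +
    Polynomial.monomial 0 (Polynomial.monomial 1 (incl (antiPart l)))
  map_add' l m := by simp only [map_add]; abel
  map_smul' c l := by
    simp only [map_smul, RingHom.id_apply, smul_add, Polynomial.smul_monomial]

lemma bigradingCov_apply (l : Cotangent n) : bigradingCov l =
    Polynomial.monomial 1 (Polynomial.monomial 0 (incl (holPart l))) +
    Polynomial.monomial 0 (Polynomial.monomial 1 (incl (antiPart l))) := rfl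

lemma bigradingCov_sq (l : Cotangent n) : bigradingCov l * bigradingCov l = 0 := by
  simp only [bigradingCov_apply, mul_add, add_mul, Polynomial.monomial_mul_monomial, incl_sq,
    incl_anticomm (holPart l) (antiPart l)]
  simp

/-- The algebra homomorphism multiplying forms of type `(p,q)` by `X^p Y^q`. Its coefficients are
the projections of the type decomposition. -/
def bigrading : Lam n →ₐ[ℂ] Polynomial (Polynomial (Lam n)) :=
  ExteriorAlgebra.lift ℂ ⟨bigradingCov, bigradingCov_sq⟩

lemma bigrading_incl (l : Cotangent n) : bigrading (incl l) = bigradingCov l :=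
  ExteriorAlgebra.lift_ι_apply ℂ bigradingCov bigradingCov_sq l

/-- The component of type `(p,q)` of a form at a point. -/
def typeProj (p q : ℕ) : Lam n →ₗ[ℂ] Lam n where
  toFun x := ((bigrading x).coeff p).coeff q
  map_add' x y := by simp
  map_smul' c x := by simp

lemma typeProj_apply (p q : ℕ) (x : Lam n) :
    typeProj p q x = ((bigrading x).coeff p).coeff q := rfl

lemma typeProj_algebraMap (p q : ℕ) (r : ℂ) : typeProj p q (algebraMap ℂ (Lam n) r) =
    if p = 0 ∧ q = 0 then algebraMap ℂ (Lam n) r else 0 := by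
  rw [typeProj_apply, AlgHom.commutes, Polynomial.algebraMap_apply, Polynomial.coeff_C]
  by_cases hp : p = 0
  · rw [if_pos hp, Polynomial.algebraMap_apply, Polynomial.coeff_C]
    simp [hp]
  · simp [hp]

lemma typeProj_incl_mul_succ_succ (p q : ℕ) (l : Cotangent n) (x : Lam n) :
    typeProj (p + 1) (q + 1) (incl l * x) =
      incl (holPart l) * typeProj p (q + 1) x + incl (antiPart l) * typeProj (p + 1) q x := by
  simp only [typeProj_apply, map_mul, bigrading_incl, bigradingCov_apply, add_mul,
    Polynomial.coeff_add, Polynomial.coeff_monomial_mul]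

lemma typeProj_incl_mul_zero_succ (q : ℕ) (l : Cotangent n) (x : Lam n) :
    typeProj 0 (q + 1) (incl l * x) = incl (antiPart l) * typeProj 0 q x := by
  simp only [typeProj_apply, map_mul, bigrading_incl, bigradingCov_apply, add_mul,
    Polynomial.coeff_add, Polynomial.coeff_monomial_mul, Polynomial.coeff_monomial_zero_mul]
  simp [Polynomial.mul_coeff_zero, Polynomial.coeff_monomial]

lemma typeProj_incl_mul_succ_zero (p : ℕ) (l : Cotangent n) (x : Lam n) :
    typeProj (p + 1) 0 (incl l * x) = incl (holPart l) * typeProj p 0 x := by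
  simp only [typeProj_apply, map_mul, bigrading_incl, bigradingCov_apply, add_mul,
    Polynomial.coeff_add, Polynomial.coeff_monomial_mul]
  simp [Polynomial.mul_coeff_zero, Polynomial.coeff_monomial]

lemma typeProj_incl_mul_zero_zero (l : Cotangent n) (x : Lam n) :
    typeProj 0 0 (incl l * x) = 0 := by
  simp [typeProj_apply, map_mul, bigrading_incl, bigradingCov_apply, Polynomial.mul_coeff_zero,
    Polynomial.coeff_monomial]

lemma typeProj_dz_mul (p q : ℕ) (i : Fin n) (x : Lam n) :
    typeProj (p + 1) q (incl (dz i) * x) = incl (dz i) * typeProj p q x := by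
  cases q <;> simp [typeProj_incl_mul_succ_succ, typeProj_incl_mul_succ_zero, holPart_dz,
    antiPart_dz]

lemma typeProj_zero_dz_mul (q : ℕ) (i : Fin n) (x : Lam n) :
    typeProj 0 q (incl (dz i) * x) = 0 := by
  cases q <;> simp [typeProj_incl_mul_zero_succ, typeProj_incl_mul_zero_zero, antiPart_dz]

lemma typeProj_dzbar_mul (p q : ℕ) (i : Fin n) (x : Lam n) :
    typeProj p (q + 1) (incl (dzbar i) * x) = incl (dzbar i) * typeProj p q x := by
  cases p <;> simp [typeProj_incl_mul_succ_succ, typeProj_incl_mul_zero_succ, holPart_dzbar,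
    antiPart_dzbar]

/-- The type decomposition is preserved by pullback along complex-linear maps. -/
lemma typeProj_pull (A : Model n →L[ℂ] Model n) (p q : ℕ) (x : Lam n) :
    typeProj p q (pull (A.restrictScalars ℝ) x) = pull (A.restrictScalars ℝ) (typeProj p q x) := by
  induction x using lam_induction generalizing p q with
  | h0 r =>
    rw [AlgHom.commutes, typeProj_algebraMap]
    split_ifs
    · rw [AlgHom.commutes]
    · rw [map_zero]
  | hadd x y hx hy => simp only [map_add, hx, hy]
  | hmul x m hx =>
    rw [map_mul, pull_incl]
    rcases p with _ | p <;> rcases q with _ | q <;>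
      simp [typeProj_incl_mul_zero_zero, typeProj_incl_mul_zero_succ, typeProj_incl_mul_succ_zero,
        typeProj_incl_mul_succ_succ, hx, pull_incl, holPart_pullCov, antiPart_pullCov]

/-- Contraction with `∂/∂z_i` lowers the holomorphic degree by one. The two statements are proved
together, since each enters the induction step of the first. -/
lemma typeProj_contr_aux (i : Fin n) (x : Lam n) :
    (∀ p q, typeProj p q (contr (tangentVec i) x) = contr (tangentVec i) (typeProj (p + 1) q x)) ∧
      ∀ q, contr (tangentVec i) (typeProj 0 q x) = 0 := by
  induction x using lam_induction with
  | h0 r =>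
    refine ⟨fun p q => ?_, fun q => ?_⟩
    · simp [contr_algebraMap, typeProj_algebraMap]
    · rw [typeProj_algebraMap]
      split_ifs <;> simp [contr_algebraMap]
  | hadd x y hx hy =>
    exact ⟨fun p q => by simp only [map_add, hx.1, hy.1],
      fun q => by simp only [map_add, hx.2, hy.2, add_zero]⟩
  | hmul x m hx =>
    obtain ⟨h1, h2⟩ := hx
    refine ⟨fun p q => ?_, fun q => ?_⟩
    · rcases p with _ | p <;> rcases q with _ | q <;>
        simp [contr_incl_mul, typeProj_incl_mul_zero_zero, typeProj_incl_mul_zero_succ,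
          typeProj_incl_mul_succ_zero, typeProj_incl_mul_succ_succ, h1, h2, tangentVec_holPart,
          tangentVec_antiPart] <;> abel
    · rcases q with _ | q <;> simp [contr_incl_mul, typeProj_incl_mul_zero_zero,
        typeProj_incl_mul_zero_succ, h2, tangentVec_antiPart]

lemma typeProj_contr (i : Fin n) (p q : ℕ) (x : Lam n) :
    typeProj p q (contr (tangentVec i) x) = contr (tangentVec i) (typeProj (p + 1) q x) :=
  (typeProj_contr_aux i x).1 p q

lemma contr_typeProj_zero (i : Fin n) (q : ℕ) (x : Lam n) :
    contr (tangentVec i) (typeProj 0 q x) = 0 :=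
  (typeProj_contr_aux i x).2 q

lemma dz_mul_mem_lamPQ {p q : ℕ} (i : Fin n) {x : Lam n} (hx : x ∈ lamPQ n p q) :
    incl (dz i) * x ∈ lamPQ n (p + 1) q := by
  rw [lamPQ, pow_succ', mul_assoc]
  exact Submodule.mul_mem_mul (Submodule.subset_span ⟨i, rfl⟩) hx

lemma gradeInv_of_mem_pow {c : Fin n → Cotangent n} {p : ℕ} {x : Lam n}
    (hx : x ∈ (Submodule.span ℂ (Set.range fun i : Fin n => incl (c i))) ^ p) :
    gradeInv x = (-1 : ℂ) ^ p • x := by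
  induction hx using Submodule.pow_induction_on_left' with
  | algebraMap r => simp [AlgHom.commutes]
  | add x y k _ _ hx hy => rw [map_add, hx, hy, smul_add]
  | mem_mul m hm k x _ hx =>
    have : gradeInv m = -m := by
      induction hm using Submodule.span_induction with
      | mem y hy => obtain ⟨j, rfl⟩ := hy; exact gradeInv_incl _
      | zero => simp
      | add y z _ _ hy hz => rw [map_add, hy, hz, neg_add]
      | smul c y _ hy => rw [map_smul, hy, smul_neg]
    rw [map_mul, this, hx, pow_succ]
    simp

lemma dzbar_mul_mem_lamPQ {p q : ℕ} (i : Fin n) {x : Lam n} (hx : x ∈ lamPQ n p q) :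
    incl (dzbar i) * x ∈ lamPQ n p (q + 1) := by
  rw [lamPQ] at hx
  induction hx using Submodule.mul_induction_on' with
  | mem_mul_mem a ha b hb =>
    rw [← mul_assoc, incl_mul, gradeInv_of_mem_pow ha, smul_mul_assoc, smul_mul_assoc, mul_assoc]
    refine Submodule.smul_mem _ _ (Submodule.mul_mem_mul ha ?_)
    rw [pow_succ']
    exact Submodule.mul_mem_mul (Submodule.subset_span ⟨i, rfl⟩) hb
  | add x _ y _ hx hy => rw [mul_add]; exact add_mem hx hy

lemma typeProj_mem (p q : ℕ) (x : Lam n) : typeProj p q x ∈ lamPQ n p q := by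
  have hz : ∀ (l : Cotangent n) {p q : ℕ} {y : Lam n}, y ∈ lamPQ n p q →
      incl (holPart l) * y ∈ lamPQ n (p + 1) q := fun l p q y hy => by
    rw [holPart_apply, map_sum, Finset.sum_mul]
    refine sum_mem fun i _ => ?_
    rw [map_smul, smul_mul_assoc]
    exact Submodule.smul_mem _ _ (dz_mul_mem_lamPQ i hy)
  have hzb : ∀ (l : Cotangent n) {p q : ℕ} {y : Lam n}, y ∈ lamPQ n p q →
      incl (antiPart l) * y ∈ lamPQ n p (q + 1) := fun l p q y hy => by
    rw [antiPart_apply, map_sum, Finset.sum_mul]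
    refine sum_mem fun i _ => ?_
    rw [map_smul, smul_mul_assoc]
    exact Submodule.smul_mem _ _ (dzbar_mul_mem_lamPQ i hy)
  induction x using lam_induction generalizing p q with
  | h0 r =>
    rw [typeProj_algebraMap]
    split_ifs with h
    · obtain ⟨rfl, rfl⟩ := h
      rw [lamPQ, pow_zero, pow_zero, one_mul]
      exact Submodule.algebraMap_mem r
    · exact zero_mem _
  | hadd x y hx hy => rw [map_add]; exact add_mem (hx p q) (hy p q)
  | hmul x m hx =>
    rcases p with _ | p <;> rcases q with _ | q
    · rw [typeProj_incl_mul_zero_zero]; exact zero_mem _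
    · rw [typeProj_incl_mul_zero_succ]; exact hzb _ (hx _ _)
    · rw [typeProj_incl_mul_succ_zero]; exact hz _ (hx _ _)
    · rw [typeProj_incl_mul_succ_succ]; exact add_mem (hz _ (hx _ _)) (hzb _ (hx _ _))

/-- On forms of type `(p,q)` the homomorphism `bigrading` is multiplication by `X^p Y^q`; so
`typeProj` is the projection onto `lamPQ`. -/
lemma bigrading_of_mem {p q : ℕ} {x : Lam n} (hx : x ∈ lamPQ n p q) :
    bigrading x = Polynomial.monomial p (Polynomial.monomial q x) := by
  have h1 : ∀ {p : ℕ} {a : Lam n},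
      a ∈ (Submodule.span ℂ (Set.range fun i : Fin n => incl (dz i))) ^ p →
      bigrading a = Polynomial.monomial p (Polynomial.monomial 0 a) := by
    intro p a ha
    induction ha using Submodule.pow_induction_on_left' with
    | algebraMap r => rw [AlgHom.commutes]; rfl
    | add x y k _ _ hx hy => simp only [map_add, hx, hy]
    | mem_mul m hm k x _ hx =>
      have : bigrading m = Polynomial.monomial 1 (Polynomial.monomial 0 m) := by
        induction hm using Submodule.span_induction with
        | mem y hy =>
          obtain ⟨j, rfl⟩ := hy
          simp [bigrading_incl, bigradingCov_apply, holPart_dz, antiPart_dz]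
        | zero => simp
        | add y z _ _ hy hz => simp only [map_add, hy, hz]
        | smul c y _ hy => rw [map_smul, hy, Polynomial.smul_monomial, Polynomial.smul_monomial]
      rw [map_mul, hx, this, Polynomial.monomial_mul_monomial, Polynomial.monomial_mul_monomial,
        add_comm 1 k]
  have h2 : ∀ {q : ℕ} {a : Lam n},
      a ∈ (Submodule.span ℂ (Set.range fun i : Fin n => incl (dzbar i))) ^ q →
      bigrading a = Polynomial.monomial 0 (Polynomial.monomial q a) := by
    intro q a ha
    induction ha using Submodule.pow_induction_on_left' with
    | algebraMap r => rw [AlgHom.commutes]; rfl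
    | add x y k _ _ hx hy => simp only [map_add, hx, hy]
    | mem_mul m hm k x _ hx =>
      have : bigrading m = Polynomial.monomial 0 (Polynomial.monomial 1 m) := by
        induction hm using Submodule.span_induction with
        | mem y hy =>
          obtain ⟨j, rfl⟩ := hy
          simp [bigrading_incl, bigradingCov_apply, holPart_dzbar, antiPart_dzbar]
        | zero => simp
        | add y z _ _ hy hz => simp only [map_add, hy, hz]
        | smul c y _ hy => rw [map_smul, hy, Polynomial.smul_monomial, Polynomial.smul_monomial]
      rw [map_mul, hx, this, Polynomial.monomial_mul_monomial, Polynomial.monomial_mul_monomial,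
        add_comm 1 k]
  rw [lamPQ] at hx
  induction hx using Submodule.mul_induction_on' with
  | mem_mul_mem a ha b hb =>
    rw [map_mul, h1 ha, h2 hb, Polynomial.monomial_mul_monomial, Polynomial.monomial_mul_monomial,
      add_zero, zero_add]
  | add x _ y _ hx hy => simp only [map_add, hx, hy]

lemma typeProj_of_mem {p q : ℕ} {x : Lam n} (hx : x ∈ lamPQ n p q) : typeProj p q x = x := by
  simp [typeProj_apply, bigrading_of_mem hx]

lemma typeProj_of_mem_of_ne {p q p' q' : ℕ} {x : Lam n} (hx : x ∈ lamPQ n p q)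
    (h : p ≠ p' ∨ q ≠ q') : typeProj p' q' x = 0 := by
  rw [typeProj_apply, bigrading_of_mem hx, Polynomial.coeff_monomial]
  rcases h with h | h
  · rw [if_neg h, Polynomial.coeff_zero]
  · split_ifs
    · rw [Polynomial.coeff_monomial, if_neg h]
    · rw [Polynomial.coeff_zero]

lemma mul_mem_lamPQ {p q p' q' : ℕ} {x y : Lam n} (hx : x ∈ lamPQ n p q)
    (hy : y ∈ lamPQ n p' q') : x * y ∈ lamPQ n (p + p') (q + q') := by
  have h : typeProj (p + p') (q + q') (x * y) = x * y := by
    simp [typeProj_apply, map_mul, bigrading_of_mem hx, bigrading_of_mem hy,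
      Polynomial.monomial_mul_monomial]
  rw [← h]
  exact typeProj_mem _ _ _

lemma gradeInv_of_mem_lamPQ {p q : ℕ} {x : Lam n} (hx : x ∈ lamPQ n p q) :
    gradeInv x = (-1 : ℂ) ^ (p + q) • x := by
  rw [lamPQ] at hx
  induction hx using Submodule.mul_induction_on' with
  | mem_mul_mem a ha b hb =>
    rw [map_mul, gradeInv_of_mem_pow ha, gradeInv_of_mem_pow hb, smul_mul_smul_comm, pow_add]
  | add x _ y _ hx hy => rw [map_add, hx, hy, smul_add]

/-! ### Wirtinger derivatives -/

/-- The operator `½ (∂/∂x_i + s ∂/∂y_i)`: it is `∂/∂z_i` for `s = -√-1` and `∂/∂\bar z_i` for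
`s = √-1`. The parameter allows the two cases to be treated together. -/
def wirt {F : Type*} [NormedAddCommGroup F] [NormedSpace ℂ F] (s : ℂ) (i : Fin n)
    (f : Model n → F) (z : Model n) : F :=
  (1 / 2 : ℂ) •
    (fderiv ℝ f z (basisVec i) + s • fderiv ℝ f z (Complex.I • basisVec i))

section Wirtinger

variable {F G : Type*} [NormedAddCommGroup F] [NormedSpace ℂ F] [NormedAddCommGroup G]
  [NormedSpace ℂ G] {s t : ℂ} {i j : Fin n} {f g : Model n → F} {z : Model n}

lemma pdz_eq_wirt : pdz i f z = wirt (-Complex.I) i f z := by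
  rw [pdz, wirt, neg_smul, sub_eq_add_neg]

lemma wirt_congr (h : f =ᶠ[nhds z] g) : wirt s i f z = wirt s i g z := by
  rw [wirt, wirt, h.fderiv_eq]

lemma wirt_const (c : F) : wirt s i (fun _ : Model n => c) z = 0 := by
  simp [wirt]

lemma wirt_add (hf : DifferentiableAt ℝ f z) (hg : DifferentiableAt ℝ g z) :
    wirt s i (fun y => f y + g y) z = wirt s i f z + wirt s i g z := by
  simp only [wirt, fderiv_fun_add hf hg, add_apply]
  module

lemma wirt_neg : wirt s i (fun y => -f y) z = -wirt s i f z := by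
  simp only [wirt, fderiv_fun_neg, neg_apply]
  module

lemma wirt_sum {κ : Type*} (S : Finset κ) {f : κ → Model n → F}
    (hf : ∀ a ∈ S, DifferentiableAt ℝ (f a) z) :
    wirt s i (fun y => ∑ a ∈ S, f a y) z = ∑ a ∈ S, wirt s i (f a) z := by
  simp only [wirt, fderiv_fun_sum hf, sum_apply, Finset.smul_sum, ← Finset.sum_add_distrib]

lemma wirt_clm (T : F →L[ℂ] G) (hf : DifferentiableAt ℝ f z) :
    wirt s i (fun y => T (f y)) z = T (wirt s i f z) := by
  have h : HasFDerivAt (fun y => T (f y)) ((T.restrictScalars ℝ).comp (fderiv ℝ f z)) z :=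
    (T.restrictScalars ℝ).hasFDerivAt.comp z hf.hasFDerivAt
  simp only [wirt, h.fderiv, ContinuousLinearMap.comp_apply,
    ContinuousLinearMap.coe_restrictScalars', map_smul, map_add]

lemma wirt_const_smul (c : ℂ) (hf : DifferentiableAt ℝ f z) :
    wirt s i (fun y => c • f y) z = c • wirt s i f z :=
  wirt_clm (c • ContinuousLinearMap.id ℂ F) hf

lemma wirt_smul {c : Model n → ℂ} (hc : DifferentiableAt ℝ c z) (hf : DifferentiableAt ℝ f z) :
    wirt s i (fun y => c y • f y) z = wirt s i c z • f z + c z • wirt s i f z := by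
  have h := hc.hasFDerivAt.smul hf.hasFDerivAt
  rw [wirt, show (fun y => c y • f y) = c • f from rfl, h.fderiv]
  simp only [wirt, add_apply, smul_apply, ContinuousLinearMap.smulRight_apply, smul_eq_mul]
  module

lemma contDiffAt_wirt (hf : ContDiffAt ℝ ∞ f z) : ContDiffAt ℝ ∞ (wirt s i f) z := by
  have h1 : ContDiffAt ℝ ∞ (fderiv ℝ f) z := hf.fderiv_right (m := ∞) (mod_cast le_top)
  have h2 : ∀ v : Model n, ContDiffAt ℝ ∞ (fun y => fderiv ℝ f y v) z := fun v =>
    h1.clm_apply contDiffAt_const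
  exact ((h2 _).add ((h2 _).const_smul s)).const_smul (1 / 2 : ℂ)

/-- Wirtinger derivatives of smooth functions commute. -/
lemma wirt_comm (hf : ContDiffAt ℝ ∞ f z) :
    wirt s i (wirt t j f) z = wirt t j (wirt s i f) z := by
  have h1 : DifferentiableAt ℝ (fderiv ℝ f) z :=
    (hf.fderiv_right (m := ∞) (mod_cast le_top)).differentiableAt (by simp)
  have hsym : ∀ v w, fderiv ℝ (fderiv ℝ f) z v w = fderiv ℝ (fderiv ℝ f) z w v :=
    fun v w => hf.isSymmSndFDerivAt
      (by rw [minSmoothness_of_isRCLikeNormedField]; exact ENat.LEInfty.out) v w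
  have h2 : ∀ v w : Model n, fderiv ℝ (fun y => fderiv ℝ f y v) z w =
      fderiv ℝ (fderiv ℝ f) z w v := fun v w => by
    rw [fderiv_clm_apply h1 (differentiableAt_const v)]
    simp
  have h3 : ∀ v : Model n, DifferentiableAt ℝ (fun y => fderiv ℝ f y v) z := fun v =>
    h1.clm_apply (differentiableAt_const v)
  have key : ∀ (s t : ℂ) (i j : Fin n), wirt s i (wirt t j f) z = (1 / 4 : ℂ) •
      (fderiv ℝ (fderiv ℝ f) z (basisVec i) (basisVec j) +
        t • fderiv ℝ (fderiv ℝ f) z (basisVec i) (Complex.I • basisVec j) +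
        s • fderiv ℝ (fderiv ℝ f) z (Complex.I • basisVec i) (basisVec j) +
        (s * t) • fderiv ℝ (fderiv ℝ f) z (Complex.I • basisVec i) (Complex.I • basisVec j)) := by
    intro s t i j
    have : wirt t j f = fun y => (1 / 2 : ℂ) •
      (fderiv ℝ f y (basisVec j) + t • fderiv ℝ f y (Complex.I • basisVec j)) := rfl
    rw [this, wirt_const_smul _ ((h3 _).fun_add ((h3 _).fun_const_smul t)),
      wirt_add (h3 _) ((h3 _).fun_const_smul t), wirt_const_smul t (h3 _)]
    simp only [wirt, h2]
    module
  rw [key, key, hsym (basisVec j) (basisVec i), hsym (basisVec j) (Complex.I • basisVec i),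
    hsym (Complex.I • basisVec j) (basisVec i), hsym (Complex.I • basisVec j)]
  module

lemma wirt_of_holomorphic (hf : DifferentiableAt ℂ f z) : wirt Complex.I i f z = 0 := by
  have h : fderiv ℝ f z = (fderiv ℂ f z).restrictScalars ℝ :=
    (hf.hasFDerivAt.restrictScalars ℝ).fderiv
  rw [wirt, h]
  simp [smul_smul, Complex.I_mul_I]

end Wirtinger

/-! ### Calculus of `Lam n`-valued functions -/

/-- The wedge product as a continuous bilinear map. -/
def mulL : Lam n →L[ℝ] Lam n →L[ℝ] Lam n :=
  ((LinearMap.mul ℂ (Lam n)).toContinuousBilinearMap).bilinearRestrictScalars ℝ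

section LamValued

variable {s t : ℂ} {i : Fin n} {f g : Model n → Lam n} {z : Model n} {U : Set (Model n)}

lemma contDiffOn_mul (hf : ContDiffOn ℝ ∞ f U) (hg : ContDiffOn ℝ ∞ g U) :
    ContDiffOn ℝ ∞ (fun y => f y * g y) U :=
  ((mulL (n := n)).contDiff.comp_contDiffOn hf).clm_apply hg

lemma differentiableAt_mul (hf : DifferentiableAt ℝ f z) (hg : DifferentiableAt ℝ g z) :
    DifferentiableAt ℝ (fun y => f y * g y) z :=
  ((mulL (n := n)).hasFDerivAt_of_bilinear hf.hasFDerivAt hg.hasFDerivAt).differentiableAt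

lemma wirt_mul (hf : DifferentiableAt ℝ f z) (hg : DifferentiableAt ℝ g z) :
    wirt s i (fun y => f y * g y) z = wirt s i f z * g z + f z * wirt s i g z := by
  have h := (mulL (n := n)).hasFDerivAt_of_bilinear hf.hasFDerivAt hg.hasFDerivAt
  have e : fderiv ℝ (fun y => f y * g y) z = _ := h.fderiv
  have e' : ∀ v, fderiv ℝ (fun y => f y * g y) z v =
      f z * fderiv ℝ g z v + fderiv ℝ f z v * g z := fun v => by rw [e]; rfl
  simp only [wirt, e', smul_mul_assoc, mul_smul_comm, add_mul, mul_add, smul_add]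
  abel

lemma contDiffOn_linear (T : Lam n →ₗ[ℂ] Lam n) (hf : ContDiffOn ℝ ∞ f U) :
    ContDiffOn ℝ ∞ (fun y => T (f y)) U :=
  (T.toContinuousLinearMap.restrictScalars ℝ).contDiff.comp_contDiffOn hf

lemma differentiableAt_linear (T : Lam n →ₗ[ℂ] Lam n) (hf : DifferentiableAt ℝ f z) :
    DifferentiableAt ℝ (fun y => T (f y)) z :=
  (T.toContinuousLinearMap.restrictScalars ℝ).differentiableAt.comp z hf

lemma wirt_linear (T : Lam n →ₗ[ℂ] Lam n) (hf : DifferentiableAt ℝ f z) :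
    wirt s i (fun y => T (f y)) z = T (wirt s i f z) :=
  wirt_clm T.toContinuousLinearMap hf

lemma contDiffOn_wirt (hU : IsOpen U) (hf : ContDiffOn ℝ ∞ f U) :
    ContDiffOn ℝ ∞ (wirt s i f) U := fun _ hy =>
  (contDiffAt_wirt (hf.contDiffAt (hU.mem_nhds hy))).contDiffWithinAt

/-- The operator `∑ c_i ∧ ∂_i` for covectors `c_i` and Wirtinger derivatives `∂_i`: it is `∂` for
`s = -√-1`, `c_i = dz_i` and `\bar∂` for `s = √-1`, `c_i = d\bar z_i`. -/
def extDer (s : ℂ) (c : Fin n → Cotangent n) (f : Model n → Lam n) (z : Model n) : Lam n :=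
  ∑ i, incl (c i) * wirt s i f z

variable {c d : Fin n → Cotangent n}

lemma extDer_congr (h : f =ᶠ[nhds z] g) : extDer s c f z = extDer s c g z := by
  simp only [extDer, wirt_congr h]

lemma extDer_const (x : Lam n) : extDer s c (fun _ => x) z = 0 := by
  simp [extDer, wirt_const]

lemma extDer_add (hf : DifferentiableAt ℝ f z) (hg : DifferentiableAt ℝ g z) :
    extDer s c (fun y => f y + g y) z = extDer s c f z + extDer s c g z := by
  simp only [extDer, wirt_add hf hg, mul_add, Finset.sum_add_distrib]

lemma extDer_smul (r : ℂ) (hf : DifferentiableAt ℝ f z) :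
    extDer s c (fun y => r • f y) z = r • extDer s c f z := by
  simp only [extDer, wirt_const_smul r hf, mul_smul_comm, Finset.smul_sum]

lemma extDer_mul (hf : DifferentiableAt ℝ f z) (hg : DifferentiableAt ℝ g z) :
    extDer s c (fun y => f y * g y) z =
      extDer s c f z * g z + gradeInv (f z) * extDer s c g z := by
  simp only [extDer, wirt_mul hf hg, mul_add, Finset.sum_add_distrib, Finset.sum_mul,
    Finset.mul_sum, ← mul_assoc]
  congr 1
  refine Finset.sum_congr rfl fun i _ => ?_
  rw [incl_mul]

lemma contDiffOn_extDer (hU : IsOpen U) (hf : ContDiffOn ℝ ∞ f U) :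
    ContDiffOn ℝ ∞ (extDer s c f) U :=
  ContDiffOn.sum fun i _ =>
    contDiffOn_linear (LinearMap.mulLeft ℂ (incl (c i))) (contDiffOn_wirt hU hf)

/-- `∂² = \bar∂² = ∂\bar∂ + \bar∂∂ = 0`, as Wirtinger derivatives commute and covectors
anticommute. -/
lemma extDer_anticomm (hf : ContDiffAt ℝ ∞ f z) :
    extDer s c (extDer t d f) z + extDer t d (extDer s c f) z = 0 := by
  have key : ∀ (s t : ℂ) (c d : Fin n → Cotangent n), extDer s c (extDer t d f) z =
      ∑ i, ∑ j, incl (c i) * (incl (d j) * wirt s i (wirt t j f) z) := by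
    intro s t c d
    refine Finset.sum_congr rfl fun i _ => ?_
    have h : ∀ j, DifferentiableAt ℝ (wirt t j f) z := fun j =>
      (contDiffAt_wirt hf).differentiableAt (by simp)
    have e : extDer t d f = fun y => ∑ j, LinearMap.mulLeft ℂ (incl (d j)) (wirt t j f y) := rfl
    rw [e, wirt_sum _ fun j _ => differentiableAt_linear _ (h j), Finset.mul_sum]
    refine Finset.sum_congr rfl fun j _ => ?_
    rw [wirt_linear _ (h j), LinearMap.mulLeft_apply]
  rw [key, key, Finset.sum_comm (γ := Fin n), ← Finset.sum_add_distrib]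
  refine Finset.sum_eq_zero fun i _ => ?_
  rw [← Finset.sum_add_distrib]
  refine Finset.sum_eq_zero fun j _ => ?_
  rw [wirt_comm hf, ← mul_assoc, ← mul_assoc, incl_anticomm, neg_mul, neg_add_cancel]

end LamValued

/-! ### Naturality of `∂` and `\bar∂` under holomorphic maps -/

/-- The Wirtinger derivative along an arbitrary vector (up to the factor `½`), as an expression in
the real differential. -/
def wirtSymbol {F : Type*} [NormedAddCommGroup F] [NormedSpace ℂ F] (s : ℂ) (T : Model n →L[ℝ] F)
    (v : Model n) : F :=
  T v + s • T (Complex.I • v)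

section Symbol

variable {F : Type*} [NormedAddCommGroup F] [NormedSpace ℂ F]

lemma model_smul_eq (c : ℂ) (v : Model n) : c • v = c.re • v + c.im • (Complex.I • v) := by
  nth_rewrite 1 [← Complex.re_add_im c]
  rw [add_smul, mul_smul]
  rfl

lemma map_complex_smul (T : Model n →L[ℝ] F) (c : ℂ) (v : Model n) :
    T (c • v) = (c.re : ℂ) • T v + (c.im : ℂ) • T (Complex.I • v) := by
  rw [model_smul_eq, map_add, ContinuousLinearMap.map_smul, ContinuousLinearMap.map_smul]
  rfl

lemma map_I_smul_complex_smul (T : Model n →L[ℝ] F) (c : ℂ) (v : Model n) :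
    T (Complex.I • c • v) = (c.re : ℂ) • T (Complex.I • v) - (c.im : ℂ) • T v := by
  rw [smul_smul, mul_comm, mul_smul, map_complex_smul, smul_smul Complex.I, Complex.I_mul_I,
    neg_one_smul, map_neg, smul_neg, sub_eq_add_neg]

lemma wirtSymbol_neg_I_smul (T : Model n →L[ℝ] F) (c : ℂ) (v : Model n) :
    wirtSymbol (-Complex.I) T (c • v) = c • wirtSymbol (-Complex.I) T v := by
  rw [wirtSymbol, map_complex_smul, map_I_smul_complex_smul, wirtSymbol]
  conv_rhs => rw [← Complex.re_add_im c]
  match_scalars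
  · ring
  · linear_combination (c.im : ℂ) * Complex.I_sq

lemma wirtSymbol_I_smul (T : Model n →L[ℝ] F) (c : ℂ) (v : Model n) :
    wirtSymbol Complex.I T (c • v) = (starRingEnd ℂ) c • wirtSymbol Complex.I T v := by
  rw [wirtSymbol, map_complex_smul, map_I_smul_complex_smul, wirtSymbol]
  conv_rhs => rw [← Complex.re_add_im c]
  simp only [map_add, map_mul, Complex.conj_ofReal, Complex.conj_I]
  match_scalars
  · ring
  · linear_combination (c.im : ℂ) * Complex.I_sq

lemma wirtSymbol_sum {κ : Type*} (S : Finset κ) (s : ℂ) (T : Model n →L[ℝ] F) (v : κ → Model n) :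
    wirtSymbol s T (∑ k ∈ S, v k) = ∑ k ∈ S, wirtSymbol s T (v k) := by
  simp only [wirtSymbol, map_sum, Finset.smul_sum, Finset.sum_add_distrib]

end Symbol

/-- The pair of a Wirtinger parameter `s` and a coframe `c` transforms like `∂` or like `\bar∂`
under complex-linear maps: derivatives and coframe by contragredient matrices. -/
def IsNaturalFrame (s : ℂ) (c : Fin n → Cotangent n) : Prop :=
  ∀ A : Model n →L[ℂ] Model n, ∃ K : Fin n → Fin n → ℂ,
    (∀ (T : Model n →L[ℝ] Lam n) i,
      wirtSymbol s T (A (basisVec i)) = ∑ k, K k i • wirtSymbol s T (basisVec k)) ∧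
    ∀ k, pullCov (A.restrictScalars ℝ) (c k) = ∑ i, K k i • c i

lemma dz_apply (i : Fin n) (v : Model n) : dz i v = v i := rfl

lemma dzbar_apply (i : Fin n) (v : Model n) : dzbar i v = (starRingEnd ℂ) (v i) := rfl

lemma pullCov_apply (A : Model n →L[ℝ] Model n) (l : Cotangent n) (v : Model n) :
    pullCov A l v = l (A v) := rfl

lemma coord_map_eq_sum (A : Model n →L[ℂ] Model n) (v : Model n) (k : Fin n) :
    A v k = ∑ i, A (basisVec i) k * v i := by
  conv_lhs => rw [model_eq_sum v, map_sum]
  have h := map_sum (EuclideanSpace.proj k : Model n →L[ℂ] ℂ) (fun i => A (v i • basisVec i))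
    Finset.univ
  refine h.trans (Finset.sum_congr rfl fun i _ => ?_)
  rw [map_smul, map_smul, smul_eq_mul, mul_comm]
  rfl

lemma isNaturalFrame_dz : IsNaturalFrame (n := n) (-Complex.I) dz := by
  intro A
  refine ⟨fun k i => A (basisVec i) k, fun T i => ?_, fun k => ?_⟩
  · conv_lhs => rw [model_eq_sum (A (basisVec i)), wirtSymbol_sum]
    simp only [wirtSymbol_neg_I_smul]
  · ext v
    simp only [sum_apply, smul_apply, dz_apply, pullCov_apply, smul_eq_mul,
      ContinuousLinearMap.coe_restrictScalars']
    exact coord_map_eq_sum A v k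

lemma isNaturalFrame_dzbar : IsNaturalFrame (n := n) Complex.I dzbar := by
  intro A
  refine ⟨fun k i => (starRingEnd ℂ) (A (basisVec i) k), fun T i => ?_, fun k => ?_⟩
  · conv_lhs => rw [model_eq_sum (A (basisVec i)), wirtSymbol_sum]
    simp only [wirtSymbol_I_smul]
  · ext v
    simp only [sum_apply, smul_apply, dzbar_apply, pullCov_apply, smul_eq_mul,
      ContinuousLinearMap.coe_restrictScalars']
    rw [coord_map_eq_sum A v k, map_sum]
    simp only [map_mul]

section Pullback

variable {f : Model n → Model n} {z : Model n}

lemma fderiv_real_eq (hf : DifferentiableAt ℂ f z) :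
    fderiv ℝ f z = (fderiv ℂ f z).restrictScalars ℝ :=
  (hf.hasFDerivAt.restrictScalars ℝ).fderiv

lemma eventually_differentiableAt (hf : ContDiffAt ℂ ω f z) :
    ∀ᶠ y in nhds z, DifferentiableAt ℂ f y :=
  (hf.eventually (by simp)).mono fun _ hy => hy.differentiableAt (by simp)

lemma fderiv_comp_cotangent (l : Cotangent n) {y : Model n} (hf : DifferentiableAt ℝ f y) :
    fderiv ℝ (fun x => l (f x)) y = pullCov (fderiv ℝ f y) l :=
  (l.hasFDerivAt.comp y hf.hasFDerivAt).fderiv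

lemma tangentVec_pullCov_eq_wirt (l : Cotangent n) {y : Model n} (hf : DifferentiableAt ℝ f y)
    (i : Fin n) :
    tangentVec i (pullCov (fderiv ℝ f y) l) = wirt (-Complex.I) i (fun x => l (f x)) y := by
  rw [wirt, fderiv_comp_cotangent l hf, tangentVec_apply, smul_eq_mul, smul_eq_mul, neg_mul,
    sub_eq_add_neg]

lemma tangentVecBar_pullCov_eq_wirt (l : Cotangent n) {y : Model n} (hf : DifferentiableAt ℝ f y)
    (i : Fin n) :
    tangentVecBar i (pullCov (fderiv ℝ f y) l) = wirt Complex.I i (fun x => l (f x)) y := by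
  rw [wirt, fderiv_comp_cotangent l hf, tangentVecBar_apply, smul_eq_mul, smul_eq_mul]

/-- The composition of a real-linear functional with a holomorphic map is pluriharmonic. -/
lemma wirt_wirt_comp_holomorphic (hf : ContDiffAt ℂ ω f z) (l : Cotangent n) (i k : Fin n) :
    wirt Complex.I k (wirt (-Complex.I) i fun x => l (f x)) z = 0 := by
  have h1 : wirt (-Complex.I) i (fun x => l (f x)) =ᶠ[nhds z]
      fun y => ∑ k, tangentVec k l * (fderiv ℂ f y (basisVec i)) k := by
    filter_upwards [eventually_differentiableAt hf] with y hy
    rw [← tangentVec_pullCov_eq_wirt l (hy.restrictScalars ℝ), fderiv_real_eq hy,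
      ← LinearMap.comp_apply, tangentVec_comp_pullCov, LinearMap.sum_apply]
    simp only [LinearMap.smul_apply, smul_eq_mul]
    exact Finset.sum_congr rfl fun _ _ => mul_comm _ _
  rw [wirt_congr h1]
  refine wirt_of_holomorphic (DifferentiableAt.fun_sum fun k _ => DifferentiableAt.const_mul ?_ _)
  have h2 : DifferentiableAt ℂ (fderiv ℂ f) z :=
    (hf.fderiv_right (m := ω) (by simp)).differentiableAt (by simp)
  have h3 := h2.clm_apply (differentiableAt_const (basisVec i))
  exact (EuclideanSpace.proj k : Model n →L[ℂ] ℂ).differentiableAt.comp z h3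

/-- `algebraMap` as a continuous linear map. -/
def scalarL : ℂ →L[ℂ] Lam n := LinearMap.toContinuousLinearMap (Algebra.linearMap ℂ (Lam n))

lemma scalarL_apply (r : ℂ) : scalarL r = algebraMap ℂ (Lam n) r := rfl

lemma extDer_scalar {s : ℂ} {c : Fin n → Cotangent n} {g : Model n → ℂ} {y : Model n}
    (hg : DifferentiableAt ℝ g y) :
    extDer s c (fun x => scalarL (g x)) y = incl (∑ i, wirt s i g y • c i) := by
  rw [extDer, map_sum]
  refine Finset.sum_congr rfl fun i _ => ?_
  rw [wirt_clm _ hg, scalarL_apply, map_smul, Algebra.smul_def, Algebra.commutes]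

/-- The pullback of a covector is the differential of a pluriharmonic function, hence it is `∂`- and
`\bar∂`-closed. -/
lemma extDer_incl_pullCov (hf : ContDiffAt ℂ ω f z) (l : Cotangent n) :
    DifferentiableAt ℝ (fun y => incl (pullCov (fderiv ℝ f y) l)) z ∧
    extDer (-Complex.I) dz (fun y => incl (pullCov (fderiv ℝ f y) l)) z = 0 ∧
    extDer Complex.I dzbar (fun y => incl (pullCov (fderiv ℝ f y) l)) z = 0 := by
  have hfr : ContDiffAt ℝ ∞ f z := (hf.restrict_scalars ℝ).of_le (by simp)
  set g : Model n → ℂ := fun x => l (f x) with hg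
  have hgs : ContDiffAt ℝ ∞ g z := l.contDiff.contDiffAt.comp z hfr
  set G : Model n → Lam n := fun x => scalarL (g x) with hG
  have hGs : ContDiffAt ℝ ∞ G z :=
    ((scalarL (n := n)).restrictScalars ℝ).contDiff.contDiffAt.comp z hgs
  have hd : ∀ {s : ℂ} {c : Fin n → Cotangent n}, DifferentiableAt ℝ (extDer s c G) z := by
    intro s c
    exact DifferentiableAt.fun_sum fun i _ => differentiableAt_linear
      (LinearMap.mulLeft ℂ (incl (c i))) ((contDiffAt_wirt hGs).differentiableAt (by simp))
  have e : (fun y => incl (pullCov (fderiv ℝ f y) l)) =ᶠ[nhds z]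
      fun y => extDer (-Complex.I) dz G y + extDer Complex.I dzbar G y := by
    filter_upwards [eventually_differentiableAt hf] with y hy
    have hy' := hy.restrictScalars ℝ
    have hgy : DifferentiableAt ℝ g y := l.differentiableAt.comp y hy'
    rw [hG, extDer_scalar hgy, extDer_scalar hgy, ← map_add]
    conv_lhs => rw [← holPart_add_antiPart (pullCov (fderiv ℝ f y) l), holPart_apply,
      antiPart_apply]
    simp only [tangentVec_pullCov_eq_wirt l hy', tangentVecBar_pullCov_eq_wirt l hy', hg]
  have hpl : extDer Complex.I dzbar (extDer (-Complex.I) dz G) z = 0 := by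
    refine Finset.sum_eq_zero fun k _ => ?_
    have e1 : extDer (-Complex.I) dz G =ᶠ[nhds z] fun y => ∑ i, LinearMap.mulLeft ℂ (incl (dz i))
        (wirt (-Complex.I) i G y) := Filter.EventuallyEq.rfl
    have hw : ∀ i, DifferentiableAt ℝ (wirt (-Complex.I) i G) z := fun i =>
      (contDiffAt_wirt hGs).differentiableAt (by simp)
    rw [wirt_congr e1, wirt_sum _ fun i _ => differentiableAt_linear _ (hw i), Finset.sum_eq_zero,
      mul_zero]
    intro i _
    have e2 : wirt (-Complex.I) i G =ᶠ[nhds z] fun y => scalarL (wirt (-Complex.I) i g y) := by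
      filter_upwards [eventually_differentiableAt hf] with y hy
      exact wirt_clm _ (l.differentiableAt.comp y (hy.restrictScalars ℝ))
    rw [wirt_linear _ (hw i), wirt_congr e2,
      wirt_clm _ ((contDiffAt_wirt hgs).differentiableAt (by simp)),
      wirt_wirt_comp_holomorphic hf, map_zero, map_zero]
  have hsq : ∀ {s : ℂ} {c : Fin n → Cotangent n}, extDer s c (extDer s c G) z = 0 :=
    fun {s c} => by
      have h := extDer_anticomm (s := s) (t := s) (c := c) (d := c) hGs
      rw [← two_smul ℂ] at h
      exact (smul_eq_zero.mp h).resolve_left two_ne_zero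
  have hpl' : extDer (-Complex.I) dz (extDer Complex.I dzbar G) z = 0 := by
    have h := extDer_anticomm (s := -Complex.I) (t := Complex.I) (c := dz) (d := dzbar) hGs
    rwa [hpl, add_zero] at h
  refine ⟨(hd.fun_add hd).congr_of_eventuallyEq e, ?_, ?_⟩
  · rw [extDer_congr e, extDer_add hd hd, hsq, hpl', add_zero]
  · rw [extDer_congr e, extDer_add hd hd, hsq, hpl, add_zero]

/-- The pullback of a form with constant coefficients along a holomorphic map is `∂`- and
`\bar∂`-closed. -/
lemma extDer_pull_const (hf : ContDiffAt ℂ ω f z) (x : Lam n) :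
    DifferentiableAt ℝ (fun y => pull (fderiv ℝ f y) x) z ∧
    extDer (-Complex.I) dz (fun y => pull (fderiv ℝ f y) x) z = 0 ∧
    extDer Complex.I dzbar (fun y => pull (fderiv ℝ f y) x) z = 0 := by
  induction x using lam_induction with
  | h0 r =>
    simp only [AlgHom.commutes]
    exact ⟨differentiableAt_const _, extDer_const _, extDer_const _⟩
  | hadd x y hx hy =>
    simp only [map_add]
    refine ⟨hx.1.fun_add hy.1, ?_, ?_⟩
    · rw [extDer_add hx.1 hy.1, hx.2.1, hy.2.1, add_zero]
    · rw [extDer_add hx.1 hy.1, hx.2.2, hy.2.2, add_zero]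
  | hmul x l hx =>
    have hl := extDer_incl_pullCov hf l
    simp only [map_mul, pull_incl]
    refine ⟨differentiableAt_mul hl.1 hx.1, ?_, ?_⟩
    · rw [extDer_mul hl.1 hx.1, hx.2.1, hl.2.1, zero_mul, mul_zero, add_zero]
    · rw [extDer_mul hl.1 hx.1, hx.2.2, hl.2.2, zero_mul, mul_zero, add_zero]

/-- Naturality of `∂` and `\bar∂` under a holomorphic map, once it is known for forms with constant
coefficients: a basis of `Lam n` reduces to that case by the product rule, and the chain rule for
Wirtinger derivatives does the rest. -/
lemma extDer_pull_comp {s : ℂ} {c : Fin n → Cotangent n} (hc : IsNaturalFrame s c)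
    (hf : ContDiffAt ℂ ω f z)
    (hconst : ∀ x, extDer s c (fun y => pull (fderiv ℝ f y) x) z = 0)
    {g : Model n → Lam n} (hg : DifferentiableAt ℝ g (f z)) :
    extDer s c (fun y => pull (fderiv ℝ f y) (g (f y))) z =
      pull (fderiv ℝ f z) (extDer s c g (f z)) := by
  have hfz : DifferentiableAt ℂ f z := hf.differentiableAt (by simp)
  have hgf : DifferentiableAt ℝ (fun y => g (f y)) z := hg.comp z (hfz.restrictScalars ℝ)
  set b := Module.finBasis ℂ (Lam n)
  set p : Fin (Module.finrank ℂ (Lam n)) → Lam n →L[ℂ] ℂ :=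
    fun k => LinearMap.toContinuousLinearMap (b.coord k)
  have hp : ∀ x : Lam n, x = ∑ k, p k x • b k := fun x => (b.sum_repr x).symm
  have hpd : ∀ k, DifferentiableAt ℝ (fun y => p k (g (f y))) z := fun k =>
    ((p k).restrictScalars ℝ).differentiableAt.comp z hgf
  have hbd := fun k => (extDer_pull_const hf (b k)).1
  have e : (fun y => pull (fderiv ℝ f y) (g (f y))) =
      fun y => ∑ k, p k (g (f y)) • pull (fderiv ℝ f y) (b k) := by
    funext y
    conv_lhs => rw [hp (g (f y)), map_sum]
    simp only [map_smul]
  -- the product rule, in a basis of `Lam n`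
  have hw : ∀ i, wirt s i (fun y => pull (fderiv ℝ f y) (g (f y))) z =
      pull (fderiv ℝ f z) (wirt s i (fun y => g (f y)) z) +
        ∑ k, p k (g (f z)) • wirt s i (fun y => pull (fderiv ℝ f y) (b k)) z := fun i => by
    rw [e, wirt_sum _ fun k _ => (hpd k).fun_smul (hbd k)]
    simp only [wirt_smul (hpd _) (hbd _), Finset.sum_add_distrib]
    congr 1
    conv_rhs => rw [hp (wirt s i (fun y => g (f y)) z), map_sum]
    simp only [map_smul, wirt_clm _ hgf]
  -- the chain rule: `K` is the matrix of the derivative of `f`, or its conjugate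
  obtain ⟨K, hK1, hK2⟩ := hc (fderiv ℂ f z)
  have hchain : ∀ i, wirt s i (fun y => g (f y)) z = ∑ k, K k i • wirt s k g (f z) := fun i => by
    have hcomp : fderiv ℝ (fun y => g (f y)) z =
        (fderiv ℝ g (f z)).comp ((fderiv ℂ f z).restrictScalars ℝ) := by
      rw [← fderiv_real_eq hfz]
      exact (hg.hasFDerivAt.comp z (hfz.restrictScalars ℝ).hasFDerivAt).fderiv
    have : wirt s i (fun y => g (f y)) z =
        (1 / 2 : ℂ) • wirtSymbol s (fderiv ℝ g (f z)) (fderiv ℂ f z (basisVec i)) := by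
      rw [wirt, hcomp, wirtSymbol, ← map_smul (fderiv ℂ f z)]
      rfl
    rw [this, hK1, Finset.smul_sum]
    exact Finset.sum_congr rfl fun k _ => smul_comm _ _ _
  have h1 : extDer s c (fun y => pull (fderiv ℝ f y) (g (f y))) z =
      ∑ i, incl (c i) * pull (fderiv ℝ f z) (wirt s i (fun y => g (f y)) z) +
        ∑ k, p k (g (f z)) • extDer s c (fun y => pull (fderiv ℝ f y) (b k)) z := by
    simp only [extDer, hw, mul_add, Finset.sum_add_distrib, Finset.mul_sum, Finset.smul_sum,
      mul_smul_comm]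
    rw [Finset.sum_comm (γ := Fin n)]
  rw [h1]
  simp only [hconst, smul_zero, Finset.sum_const_zero, add_zero]
  simp only [hchain, map_sum, map_smul, Finset.mul_sum, extDer, map_mul, pull_incl]
  rw [Finset.sum_comm]
  refine Finset.sum_congr rfl fun k _ => ?_
  rw [fderiv_real_eq hfz, hK2, map_sum, Finset.sum_mul]
  refine Finset.sum_congr rfl fun i _ => ?_
  rw [map_smul, smul_mul_assoc, mul_smul_comm]

end Pullback

/-! ### Operators on the space of forms -/

section Operators

variable {M : Type*} [TopologicalSpace M] [ChartedSpace (Model n) M]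

/-- The operator on families of local expressions given by `extDer s c` in each chart; `∂` and
`\bar∂` are special cases. -/
def famExtDer (s : ℂ) (c : Fin n → Cotangent n) (w : Fam n M) : Fam n M := fun e =>
  e.1.target.indicator (extDer s c (w e))

lemma del_eq_famExtDer (w : Fam n M) : del w = famExtDer (-Complex.I) dz w := by
  funext e
  simp only [del, famExtDer, pdz_eq_wirt]
  rfl

lemma delbar_eq_famExtDer (w : Fam n M) : delbar w = famExtDer Complex.I dzbar w := rfl

variable {s t : ℂ} {c d : Fin n → Cotangent n}

lemma famExtDer_apply (w : Fam n M) {e : atlas (Model n) M} {z : Model n} (hz : z ∈ e.1.target) :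
    famExtDer s c w e z = extDer s c (w e) z := Set.indicator_of_mem hz _

lemma famExtDer_of_notMem (w : Fam n M) {e : atlas (Model n) M} {z : Model n}
    (hz : z ∉ e.1.target) : famExtDer s c w e z = 0 := Set.indicator_of_notMem hz _

lemma famExtDer_eventuallyEq (w : Fam n M) {e : atlas (Model n) M} {z : Model n}
    (hz : z ∈ e.1.target) : famExtDer s c w e =ᶠ[nhds z] extDer s c (w e) :=
  Filter.eventuallyEq_of_mem (e.1.open_target.mem_nhds hz) fun _ hy => famExtDer_apply w hy

lemma SmoothFam.contDiffAt {w : Fam n M} (hw : SmoothFam w) {e : atlas (Model n) M} {z : Model n}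
    (hz : z ∈ e.1.target) : ContDiffAt ℝ ∞ (w e) z :=
  (hw e).contDiffAt (e.1.open_target.mem_nhds hz)

lemma smoothFam_famExtDer {w : Fam n M} (hw : SmoothFam w) : SmoothFam (famExtDer s c w) :=
  fun e => (contDiffOn_extDer e.1.open_target (hw e)).congr fun _ hz => famExtDer_apply w hz

lemma famExtDer_add {a b : Fam n M} (ha : SmoothFam a) (hb : SmoothFam b) :
    famExtDer s c (a + b) = famExtDer s c a + famExtDer s c b := by
  funext e z
  by_cases hz : z ∈ e.1.target
  · simp only [Pi.add_apply, famExtDer_apply _ hz]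
    exact extDer_add (ha.differentiableAt e hz) (hb.differentiableAt e hz)
  · simp [famExtDer_of_notMem _ hz]

lemma famExtDer_smul {a : Fam n M} (ha : SmoothFam a) (r : ℂ) :
    famExtDer s c (r • a) = r • famExtDer s c a := by
  funext e z
  by_cases hz : z ∈ e.1.target
  · simp only [Pi.smul_apply, famExtDer_apply _ hz]
    exact extDer_smul r (ha.differentiableAt e hz)
  · simp [famExtDer_of_notMem _ hz]

lemma famExtDer_anticomm {w : Fam n M} (hw : SmoothFam w) :
    famExtDer s c (famExtDer t d w) + famExtDer t d (famExtDer s c w) = 0 := by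
  funext e z
  by_cases hz : z ∈ e.1.target
  · simp only [Pi.add_apply, famExtDer_apply _ hz, extDer_congr (famExtDer_eventuallyEq w hz)]
    exact extDer_anticomm (hw.contDiffAt hz)
  · simp [famExtDer_of_notMem _ hz]

/-- The grade involution, chart by chart. -/
def famGradeInv (w : Fam n M) : Fam n M := fun e z => gradeInv (w e z)

lemma famExtDer_mul {a b : Fam n M} (ha : SmoothFam a) (hb : SmoothFam b) :
    famExtDer s c (a * b) = famExtDer s c a * b + famGradeInv a * famExtDer s c b := by
  funext e z
  by_cases hz : z ∈ e.1.target
  · simp only [Pi.add_apply, Pi.mul_apply, famExtDer_apply _ hz]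
    exact extDer_mul (ha.differentiableAt e hz) (hb.differentiableAt e hz)
  · simp [famExtDer_of_notMem _ hz]

lemma change_contDiffAt [IsManifold (modelWithCornersSelf ℂ (Model n)) ω M]
    (e e' : atlas (Model n) M) {z : Model n} (hz : z ∈ (e.1.symm.trans e'.1).source) :
    ContDiffAt ℂ ω (change e.1 e'.1) z := by
  have h := ((contDiffGroupoid ω (modelWithCornersSelf ℂ (Model n))).compatible e.2 e'.2)
  rw [contDiffGroupoid, mem_groupoid_of_pregroupoid, contDiffPregroupoid] at h
  have h1 : ContDiffOn ℂ ω (change e.1 e'.1) (e.1.symm.trans e'.1).source := by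
    simpa [change, Function.comp_def] using h.1
  exact h1.contDiffAt ((e.1.symm.trans e'.1).open_source.mem_nhds hz)

lemma mem_target_of_mem_trans {e e' : atlas (Model n) M} {z : Model n}
    (hz : z ∈ (e.1.symm.trans e'.1).source) :
    z ∈ e.1.target ∧ change e.1 e'.1 z ∈ e'.1.target := by
  rw [OpenPartialHomeomorph.trans_source] at hz
  exact ⟨hz.1, e'.1.map_source hz.2⟩

lemma fderiv_change_eq [IsManifold (modelWithCornersSelf ℂ (Model n)) ω M]
    {e e' : atlas (Model n) M} {z : Model n} (hz : z ∈ (e.1.symm.trans e'.1).source) :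
    fderiv ℝ (change e.1 e'.1) z = (fderiv ℂ (change e.1 e'.1) z).restrictScalars ℝ :=
  fderiv_real_eq (change_differentiableAt e e' hz)

lemma famExtDer_mem_forms [IsManifold (modelWithCornersSelf ℂ (Model n)) ω M]
    (hc : IsNaturalFrame s c)
    (hconst : ∀ {f : Model n → Model n} {z : Model n}, ContDiffAt ℂ ω f z → ∀ x,
      extDer s c (fun y => pull (fderiv ℝ f y) x) z = 0)
    {w : Fam n M} (hw : w ∈ forms n M) : famExtDer s c w ∈ forms n M := by
  refine ⟨smoothFam_famExtDer hw.1, fun e z hz => famExtDer_of_notMem w hz,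
    fun e e' z hz => ?_⟩
  obtain ⟨h1, h2⟩ := mem_target_of_mem_trans hz
  have hch := change_contDiffAt e e' hz
  rw [famExtDer_apply w h1, famExtDer_apply w h2,
    ← extDer_pull_comp hc hch (hconst hch) (SmoothFam.differentiableAt hw.1 e' h2)]
  refine extDer_congr (Filter.eventuallyEq_of_mem
    ((e.1.symm.trans e'.1).open_source.mem_nhds hz) fun y hy => hw.2.2 e e' y hy)

lemma del_mem_forms [IsManifold (modelWithCornersSelf ℂ (Model n)) ω M] {w : Fam n M}
    (hw : w ∈ forms n M) : del w ∈ forms n M := by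
  rw [del_eq_famExtDer]
  exact famExtDer_mem_forms isNaturalFrame_dz (fun hf x => (extDer_pull_const hf x).2.1) hw

lemma delbar_mem_forms [IsManifold (modelWithCornersSelf ℂ (Model n)) ω M] {w : Fam n M}
    (hw : w ∈ forms n M) : delbar w ∈ forms n M :=
  famExtDer_mem_forms isNaturalFrame_dzbar (fun hf x => (extDer_pull_const hf x).2.2) hw

lemma mul_mem_forms {a b : Fam n M} (ha : a ∈ forms n M) (hb : b ∈ forms n M) :
    a * b ∈ forms n M := by
  refine ⟨fun e => contDiffOn_mul (ha.1 e) (hb.1 e), fun e z hz => ?_, fun e e' z hz => ?_⟩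
  · rw [Pi.mul_apply, Pi.mul_apply, ha.2.1 e z hz, zero_mul]
  · rw [Pi.mul_apply, Pi.mul_apply, ha.2.2 e e' z hz, hb.2.2 e e' z hz, ← map_mul]
    rfl

variable (P : PoissonBivector n M)

lemma contDiffOn_coeff (e : atlas (Model n) M) (i j : Fin n) :
    ContDiffOn ℝ ∞ (fun z => P.coeff e z i j) e.1.target :=
  (((P.holomorphic e i j).contDiffOn e.1.open_target.uniqueDiffOn).restrict_scalars ℝ)

lemma differentiableAt_coeff {e : atlas (Model n) M} {z : Model n} (hz : z ∈ e.1.target)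
    (i j : Fin n) : DifferentiableAt ℝ (fun y => P.coeff e y i j) z :=
  ((P.holomorphic e i j z hz).differentiableAt).restrictScalars ℝ

lemma contr_contr_pull (A : Model n →L[ℂ] Model n) (i j : Fin n) (x : Lam n) :
    contr (tangentVec j) (contr (tangentVec i) (pull (A.restrictScalars ℝ) x)) =
      ∑ l, ∑ k, (A (basisVec j) l * A (basisVec i) k) •
        pull (A.restrictScalars ℝ) (contr (tangentVec l) (contr (tangentVec k) x)) := by
  simp only [contr_pull, tangentVec_comp_pullCov, contr_sum_smul, map_sum, map_smul,
    Finset.smul_sum, smul_smul]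
  rw [Finset.sum_comm]
  exact Finset.sum_congr rfl fun l _ => Finset.sum_congr rfl fun k _ => by rw [mul_comm]

lemma iotaPi_mem_forms [IsManifold (modelWithCornersSelf ℂ (Model n)) ω M] {w : Fam n M}
    (hw : w ∈ forms n M) : iotaPi P w ∈ forms n M := by
  refine ⟨fun e => ?_, fun e z hz => ?_, fun e e' z hz => ?_⟩
  · refine ContDiffOn.const_smul (1 / 2 : ℂ) (ContDiffOn.sum fun i _ => ContDiffOn.sum fun j _ => ?_)
    exact (contDiffOn_coeff P e i j).fun_smul
      (contDiffOn_linear _ (contDiffOn_linear _ (hw.1 e)))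
  · simp [iotaPi, hw.2.1 e z hz]
  · have hJ := fderiv_change_eq hz
    simp only [iotaPi, map_sum, map_smul]
    rw [P.compat e e' z hz, hw.2.2 e e' z hz, hJ]
    congr 1
    have hjac : ∀ a b, (fderiv ℂ (change e.1 e'.1) z) (basisVec a) b = jac e.1 e'.1 z b a :=
      fun _ _ => rfl
    simp only [contr_contr_pull, hjac, Matrix.mul_apply, Matrix.transpose_apply, Finset.sum_smul,
      Finset.smul_sum, Finset.sum_mul, smul_smul]
    -- move the sum over the indices of `e'` outside
    have hL : ∀ F : Fin n → Fin n → Fin n → Fin n → Lam n,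
        ∑ i, ∑ j, ∑ l, ∑ k, F i j l k = ∑ k, ∑ l, ∑ j, ∑ i, F i j l k := by
      intro F
      calc ∑ i, ∑ j, ∑ l, ∑ k, F i j l k = ∑ j, ∑ l, ∑ i, ∑ k, F i j l k := by
            rw [Finset.sum_comm]
            exact Finset.sum_congr rfl fun _ _ => Finset.sum_comm
        _ = ∑ j, ∑ l, ∑ k, ∑ i, F i j l k := by
            simp_rw [Finset.sum_comm (γ := Fin n) (f := fun i k => F i _ _ k)]
        _ = ∑ l, ∑ k, ∑ j, ∑ i, F i j l k := by
            rw [Finset.sum_comm]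
            exact Finset.sum_congr rfl fun _ _ => Finset.sum_comm
        _ = _ := Finset.sum_comm
    rw [hL]
    refine Finset.sum_congr rfl fun k _ => Finset.sum_congr rfl fun l _ =>
      Finset.sum_congr rfl fun j _ => Finset.sum_congr rfl fun i _ => ?_
    congr 1
    ring

lemma iotaPi_add (a b : Fam n M) : iotaPi P (a + b) = iotaPi P a + iotaPi P b := by
  funext e z
  simp [iotaPi, Finset.sum_add_distrib]

lemma iotaPi_smul (r : ℂ) (a : Fam n M) : iotaPi P (r • a) = r • iotaPi P a := by
  funext e z
  simp only [iotaPi, Pi.smul_apply, map_smul, Finset.smul_sum]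
  refine Finset.sum_congr rfl fun i _ => Finset.sum_congr rfl fun j _ => ?_
  module

/-- The component of type `(p,q)` of a form. -/
def famTypeProj (p q : ℕ) (w : Fam n M) : Fam n M := fun e z => typeProj p q (w e z)

lemma famTypeProj_mem_formsPQ [IsManifold (modelWithCornersSelf ℂ (Model n)) ω M] {w : Fam n M}
    (p q : ℕ) (hw : w ∈ forms n M) : famTypeProj p q w ∈ formsPQ n M p q := by
  refine ⟨⟨fun e => contDiffOn_linear _ (hw.1 e), fun e z hz => ?_, fun e e' z hz => ?_⟩,
    fun e z => typeProj_mem _ _ _⟩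
  · simp [famTypeProj, hw.2.1 e z hz]
  · simp only [famTypeProj]
    rw [hw.2.2 e e' z hz, fderiv_change_eq hz, typeProj_pull]

lemma famTypeProj_of_mem {p q : ℕ} {w : Fam n M} (hw : w ∈ formsPQ n M p q) :
    famTypeProj p q w = w := by
  funext e z
  exact typeProj_of_mem (hw.2 e z)

lemma famTypeProj_of_mem_of_ne {p q p' q' : ℕ} {w : Fam n M} (hw : w ∈ formsPQ n M p q)
    (h : p ≠ p' ∨ q ≠ q') : famTypeProj p' q' w = 0 := by
  funext e z
  exact typeProj_of_mem_of_ne (hw.2 e z) h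

lemma famTypeProj_famExtDer {p q p' q' : ℕ}
    (hc : ∀ i x, typeProj p' q' (incl (c i) * x) = incl (c i) * typeProj p q x)
    {w : Fam n M} (hw : SmoothFam w) :
    famTypeProj p' q' (famExtDer s c w) = famExtDer s c (famTypeProj p q w) := by
  funext e z
  by_cases hz : z ∈ e.1.target
  · have hd := hw.differentiableAt e hz
    rw [famTypeProj, famExtDer_apply _ hz, famExtDer_apply _ hz]
    simp only [extDer, map_sum, hc]
    refine Finset.sum_congr rfl fun i _ => ?_
    rw [← wirt_linear _ hd]
    rfl
  · simp [famTypeProj, famExtDer_of_notMem _ hz]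

lemma famTypeProj_del (p q : ℕ) {w : Fam n M} (hw : SmoothFam w) :
    famTypeProj (p + 1) q (del w) = del (famTypeProj p q w) := by
  rw [del_eq_famExtDer, del_eq_famExtDer]
  exact famTypeProj_famExtDer (fun i x => typeProj_dz_mul p q i x) hw

lemma famTypeProj_delbar (p q : ℕ) {w : Fam n M} (hw : SmoothFam w) :
    famTypeProj p (q + 1) (delbar w) = delbar (famTypeProj p q w) :=
  famTypeProj_famExtDer (fun i x => typeProj_dzbar_mul p q i x) hw

lemma famTypeProj_iotaPi (p q : ℕ) (w : Fam n M) :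
    famTypeProj p q (iotaPi P w) = iotaPi P (famTypeProj (p + 2) q w) := by
  funext e z
  simp only [famTypeProj, iotaPi, map_sum, map_smul, typeProj_contr]

lemma iotaPi_famTypeProj_of_lt_two {p : ℕ} (hp : p < 2) (q : ℕ) (w : Fam n M) :
    iotaPi P (famTypeProj p q w) = 0 := by
  funext e z
  have h : ∀ i j, contr (tangentVec j) (contr (tangentVec i) (typeProj p q (w e z))) = 0 := by
    intro i j
    interval_cases p
    · rw [contr_typeProj_zero, map_zero]
    · rw [← zero_add 1, ← typeProj_contr, contr_typeProj_zero]
  simp [iotaPi, famTypeProj, h]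

lemma mul_mem_formsPQ {p q p' q' : ℕ} {a b : Fam n M} (ha : a ∈ formsPQ n M p q)
    (hb : b ∈ formsPQ n M p' q') : a * b ∈ formsPQ n M (p + p') (q + q') :=
  ⟨mul_mem_forms ha.1 hb.1, fun e z => mul_mem_lamPQ (ha.2 e z) (hb.2 e z)⟩

variable [IsManifold (modelWithCornersSelf ℂ (Model n)) ω M]

lemma del_mem_formsPQ {p q : ℕ} {w : Fam n M} (hw : w ∈ formsPQ n M p q) :
    del w ∈ formsPQ n M (p + 1) q := by
  rw [← famTypeProj_of_mem hw, ← famTypeProj_del p q hw.1.1]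
  exact famTypeProj_mem_formsPQ _ _ (del_mem_forms hw.1)

lemma delbar_mem_formsPQ {p q : ℕ} {w : Fam n M} (hw : w ∈ formsPQ n M p q) :
    delbar w ∈ formsPQ n M p (q + 1) := by
  rw [← famTypeProj_of_mem hw, ← famTypeProj_delbar p q hw.1.1]
  exact famTypeProj_mem_formsPQ _ _ (delbar_mem_forms hw.1)

lemma iotaPi_mem_formsPQ {p q : ℕ} {w : Fam n M} (hw : w ∈ formsPQ n M (p + 2) q) :
    iotaPi P w ∈ formsPQ n M p q := by
  rw [← famTypeProj_of_mem hw, ← famTypeProj_iotaPi]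
  exact famTypeProj_mem_formsPQ _ _ (iotaPi_mem_forms P hw.1)

lemma delPi_mem_forms {w : Fam n M} (hw : w ∈ forms n M) : delPi P w ∈ forms n M :=
  sub_mem (iotaPi_mem_forms P (del_mem_forms hw)) (del_mem_forms (iotaPi_mem_forms P hw))

lemma delPi_mem_formsPQ {p q : ℕ} {w : Fam n M} (hw : w ∈ formsPQ n M (p + 1) q) :
    delPi P w ∈ formsPQ n M p q := by
  refine sub_mem (iotaPi_mem_formsPQ P (del_mem_formsPQ hw)) ?_
  rcases p with _ | p
  · rw [← famTypeProj_of_mem hw, iotaPi_famTypeProj_of_lt_two P (by norm_num)]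
    rw [del_eq_famExtDer, ← zero_smul ℂ (0 : Fam n M),
      famExtDer_smul (a := 0) (fun _ => contDiffOn_const), zero_smul]
    exact zero_mem _
  · exact del_mem_formsPQ (iotaPi_mem_formsPQ P hw)

end Operators

/-! ### The Koszul–Brylinski operator in coordinates -/

/-- Contraction of a form at a point with the bivector `½ ∑ c^{ij} ∂_i ∧ ∂_j`. -/
def contrBiv (c : Matrix (Fin n) (Fin n) ℂ) : Lam n →ₗ[ℂ] Lam n :=
  (1 / 2 : ℂ) • ∑ i, ∑ j, c i j • (contr (tangentVec j)).comp (contr (tangentVec i))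

lemma contrBiv_apply (c : Matrix (Fin n) (Fin n) ℂ) (x : Lam n) : contrBiv c x =
    (1 / 2 : ℂ) • ∑ i, ∑ j, c i j • contr (tangentVec j) (contr (tangentVec i) x) := by
  simp [contrBiv, LinearMap.sum_apply]

lemma contrBiv_contr (c : Matrix (Fin n) (Fin n) ℂ) (v : Module.Dual ℂ (Cotangent n)) (x : Lam n) :
    contrBiv c (contr v x) = contr v (contrBiv c x) := by
  simp only [contrBiv_apply, map_smul, map_sum]
  congr 1
  refine Finset.sum_congr rfl fun i _ => Finset.sum_congr rfl fun j _ => ?_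
  rw [contr_contr (tangentVec i) v, map_neg, contr_contr (tangentVec j) v, neg_neg]

lemma contrBiv_contrBiv (c d : Matrix (Fin n) (Fin n) ℂ) (x : Lam n) :
    contrBiv c (contrBiv d x) = contrBiv d (contrBiv c x) := by
  rw [contrBiv_apply c, contrBiv_apply c x]
  simp only [map_smul, map_sum, contrBiv_contr]

/-- The commutator of the contraction with a bivector `c` and the product with `dz_k` is the
contraction with the Hamiltonian vector `c(dz_k, ·)`. -/
lemma contrBiv_dz_mul {c : Matrix (Fin n) (Fin n) ℂ} (hc : ∀ i j, c i j = -c j i) (k : Fin n)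
    (x : Lam n) : contrBiv c (incl (dz k) * x) =
      incl (dz k) * contrBiv c x + ∑ j, c k j • contr (tangentVec j) x := by
  have h : ∀ i j, contr (tangentVec j) (contr (tangentVec i) (incl (dz k) * x)) =
      (if i = k then contr (tangentVec j) x else 0) - (if j = k then contr (tangentVec i) x else 0)
        + incl (dz k) * contr (tangentVec j) (contr (tangentVec i) x) := by
    intro i j
    rw [contr_incl_mul, map_sub, map_smul, contr_incl_mul, tangentVec_dz, tangentVec_dz]
    split_ifs <;> simp <;> abel
  have h1 : ∑ i, ∑ j, c i j • (if i = k then contr (tangentVec j) x else 0) =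
      ∑ j, c k j • contr (tangentVec j) x := by
    rw [Finset.sum_comm]
    simp
  have h2 : ∑ i, ∑ j, c i j • (if j = k then contr (tangentVec i) x else 0) =
      -∑ j, c k j • contr (tangentVec j) x := by
    rw [← Finset.sum_neg_distrib]
    refine Finset.sum_congr rfl fun i _ => ?_
    simp [hc i k]
  rw [contrBiv_apply, contrBiv_apply]
  simp only [h, smul_add, smul_sub, Finset.sum_add_distrib, Finset.sum_sub_distrib, h1, h2,
    mul_smul_comm, Finset.mul_sum]
  module

/-- The contraction with a bivector is an operator of order two; the last sum is its polarization.
-/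
lemma contrBiv_mul_of_even (c : Matrix (Fin n) (Fin n) ℂ) (hc : ∀ i j, c i j = -c j i) {x : Lam n}
    (hx : gradeInv x = x) (y : Lam n) :
    contrBiv c (x * y) = contrBiv c x * y + x * contrBiv c y -
      ∑ i, ∑ j, c i j • (contr (tangentVec i) x * contr (tangentVec j) y) := by
  have h : ∀ i j, contr (tangentVec j) (contr (tangentVec i) (x * y)) =
      contr (tangentVec j) (contr (tangentVec i) x) * y
        + x * contr (tangentVec j) (contr (tangentVec i) y)
        + contr (tangentVec j) x * contr (tangentVec i) y
        - contr (tangentVec i) x * contr (tangentVec j) y := by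
    intro i j
    rw [contr_mul, hx, map_add, contr_mul, contr_mul, gradeInv_contr, hx, neg_mul]
    abel
  have h1 : ∑ i, ∑ j, c i j • (contr (tangentVec j) x * contr (tangentVec i) y) =
      -∑ i, ∑ j, c i j • (contr (tangentVec i) x * contr (tangentVec j) y) := by
    rw [Finset.sum_comm, ← Finset.sum_neg_distrib]
    refine Finset.sum_congr rfl fun i _ => ?_
    rw [← Finset.sum_neg_distrib]
    refine Finset.sum_congr rfl fun j _ => ?_
    rw [hc j i, neg_smul]
  simp only [contrBiv_apply, h, smul_add, smul_sub, Finset.sum_add_distrib, Finset.sum_sub_distrib,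
    h1, smul_mul_assoc, mul_smul_comm, Finset.mul_sum, Finset.sum_mul, Finset.smul_sum]
  simp only [← Finset.smul_sum]
  module

section Koszul

variable {M : Type*} [TopologicalSpace M] [ChartedSpace (Model n) M] (P : PoissonBivector n M)

lemma iotaPi_eq_contrBiv (w : Fam n M) (e : atlas (Model n) M) (z : Model n) :
    iotaPi P w e z = contrBiv (P.coeff e z) (w e z) := by
  rw [contrBiv_apply]
  rfl

/-- The matrix of the derivatives `∂π^{ij}/∂z_k`. -/
def dCoeff (e : atlas (Model n) M) (z : Model n) (k : Fin n) : Matrix (Fin n) (Fin n) ℂ :=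
  Matrix.of fun i j => pdz k (fun y => P.coeff e y i j) z

lemma dCoeff_apply (e : atlas (Model n) M) (z : Model n) (k i j : Fin n) :
    dCoeff P e z k i j = wirt (-Complex.I) k (fun y => P.coeff e y i j) z := pdz_eq_wirt

variable {P} {e : atlas (Model n) M} {z : Model n}

lemma dCoeff_skew (hz : z ∈ e.1.target) (k i j : Fin n) :
    dCoeff P e z k i j = -dCoeff P e z k j i := by
  rw [dCoeff_apply, dCoeff_apply, ← wirt_neg]
  exact wirt_congr (Filter.eventuallyEq_of_mem (e.1.open_target.mem_nhds hz)
    fun y hy => P.skew e y hy i j)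

/-- The vanishing of the Schouten bracket `[π, π]` in coordinates. -/
lemma coeff_jacobi (hz : z ∈ e.1.target) (i j k : Fin n) :
    ∑ l, (P.coeff e z l i * dCoeff P e z l j k + P.coeff e z l j * dCoeff P e z l k i +
      P.coeff e z l k * dCoeff P e z l i j) = 0 := by
  have h := P.jacobi e z hz i j k
  simp only [schouten, ← Finset.sum_add_distrib] at h
  have h2 : (2 : ℂ) * ∑ l, (P.coeff e z l i * dCoeff P e z l j k +
      P.coeff e z l j * dCoeff P e z l k i + P.coeff e z l k * dCoeff P e z l i j) = 0 := by
    rw [Finset.mul_sum, ← h]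
    refine Finset.sum_congr rfl fun l _ => ?_
    simp only [dCoeff, Matrix.of_apply]
    ring
  exact (mul_eq_zero.mp h2).resolve_left two_ne_zero

lemma differentiableAt_iotaPi {w : Fam n M} (hw : DifferentiableAt ℝ (w e) z)
    (hz : z ∈ e.1.target) : DifferentiableAt ℝ (iotaPi P w e) z := by
  refine DifferentiableAt.const_smul (DifferentiableAt.fun_sum fun i _ =>
    DifferentiableAt.fun_sum fun j _ => ?_) (1 / 2 : ℂ)
  exact (differentiableAt_coeff P hz i j).fun_smul
    (differentiableAt_linear _ (differentiableAt_linear _ hw))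

lemma wirt_iotaPi {w : Fam n M} (hw : DifferentiableAt ℝ (w e) z) (hz : z ∈ e.1.target)
    (k : Fin n) : wirt (-Complex.I) k (iotaPi P w e) z =
      contrBiv (P.coeff e z) (wirt (-Complex.I) k (w e) z) + contrBiv (dCoeff P e z k) (w e z) := by
  have h1 : ∀ i j, DifferentiableAt ℝ
      (fun y => contr (tangentVec j) (contr (tangentVec i) (w e y))) z := fun i j =>
    differentiableAt_linear _ (differentiableAt_linear _ hw)
  have h2 : ∀ i j, DifferentiableAt ℝ
      (fun y => P.coeff e y i j • contr (tangentVec j) (contr (tangentVec i) (w e y))) z :=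
    fun i j => (differentiableAt_coeff P hz i j).fun_smul (h1 i j)
  have h3 : iotaPi P w e = fun y => (1 / 2 : ℂ) • ∑ i, ∑ j, P.coeff e y i j •
      contr (tangentVec j) (contr (tangentVec i) (w e y)) := rfl
  rw [h3, wirt_const_smul _ (DifferentiableAt.fun_sum fun i _ =>
      DifferentiableAt.fun_sum fun j _ => h2 i j),
    wirt_sum _ fun i _ => DifferentiableAt.fun_sum fun j _ => h2 i j, contrBiv_apply,
    contrBiv_apply, ← smul_add, ← Finset.sum_add_distrib]
  congr 1
  refine Finset.sum_congr rfl fun i _ => ?_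
  rw [wirt_sum _ fun j _ => h2 i j, ← Finset.sum_add_distrib]
  refine Finset.sum_congr rfl fun j _ => ?_
  rw [wirt_smul (differentiableAt_coeff P hz i j) (h1 i j),
    wirt_linear _ (differentiableAt_linear _ hw), wirt_linear _ hw, dCoeff_apply, add_comm]

lemma del_apply {w : Fam n M} (hz : z ∈ e.1.target) :
    del w e z = ∑ k, incl (dz k) * wirt (-Complex.I) k (w e) z := by
  rw [del_eq_famExtDer, famExtDer_apply _ hz, extDer]

/-- The operator `∂_π = ∑ π^{kj} ι_j ∂_k - ½ ∑ (∂_k π^{ij}) dz_k ∧ ι_j ι_i` in coordinates. -/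
lemma delPi_apply {w : Fam n M} (hw : DifferentiableAt ℝ (w e) z) (hz : z ∈ e.1.target) :
    delPi P w e z =
      ∑ k, (∑ j, P.coeff e z k j • contr (tangentVec j) (wirt (-Complex.I) k (w e) z) -
        incl (dz k) * contrBiv (dCoeff P e z k) (w e z)) := by
  rw [delPi, Pi.sub_apply, Pi.sub_apply, iotaPi_eq_contrBiv, del_apply hz, del_apply hz, map_sum,
    ← Finset.sum_sub_distrib]
  refine Finset.sum_congr rfl fun k _ => ?_
  rw [contrBiv_dz_mul (P.skew e z hz), wirt_iotaPi hw hz, mul_add]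
  abel

lemma sum_rotate {N : Type*} [AddCommMonoid N] (F : Fin n → Fin n → Fin n → N) :
    ∑ i, ∑ j, ∑ k, F i j k = ∑ i, ∑ j, ∑ k, F j k i := by
  conv_rhs => rw [Finset.sum_comm]
  exact Finset.sum_congr rfl fun _ _ => Finset.sum_comm

/-- The trivector `∑ π^{kj} (∂_k π^{ab}) ∂_j ∧ ∂_b ∧ ∂_a` vanishes by the Jacobi identity. -/
lemma sum_coeff_contr_contrBiv_dCoeff (hz : z ∈ e.1.target) (x : Lam n) :
    ∑ k, ∑ j, P.coeff e z k j • contr (tangentVec j) (contrBiv (dCoeff P e z k) x) = 0 := by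
  set T : Fin n → Fin n → Fin n → ℂ := fun j a b => ∑ k, P.coeff e z k j * dCoeff P e z k a b
    with hT
  set I : Fin n → Fin n → Fin n → Lam n := fun j a b =>
    contr (tangentVec j) (contr (tangentVec b) (contr (tangentVec a) x)) with hI
  -- `I` is cyclically invariant, and the cyclic sum of `T` is the Jacobi identity
  have hcyc : ∀ j a b, I j a b = I b j a := by
    intro j a b
    simp only [hI]
    rw [contr_contr (tangentVec a) (tangentVec j) x, map_neg,
      contr_contr (tangentVec b) (tangentVec j), neg_neg]
  have hJ : ∀ j a b, T j a b + T a b j + T b j a = 0 := by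
    intro j a b
    simp only [hT, ← Finset.sum_add_distrib]
    exact coeff_jacobi hz j a b
  have h1 : ∑ j, ∑ a, ∑ b, T j a b • I j a b = ∑ j, ∑ a, ∑ b, T a b j • I j a b := by
    refine (sum_rotate _).trans (Finset.sum_congr rfl fun j _ => Finset.sum_congr rfl fun a _ =>
      Finset.sum_congr rfl fun b _ => ?_)
    rw [hcyc a b j]
  have h2 : ∑ j, ∑ a, ∑ b, T j a b • I j a b = ∑ j, ∑ a, ∑ b, T b j a • I j a b := by
    refine ((sum_rotate _).trans (sum_rotate _)).trans (Finset.sum_congr rfl fun j _ =>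
      Finset.sum_congr rfl fun a _ => Finset.sum_congr rfl fun b _ => ?_)
    rw [hcyc j a b]
  have h3 : (3 : ℂ) • ∑ j, ∑ a, ∑ b, T j a b • I j a b = 0 := by
    have : (3 : ℂ) • ∑ j, ∑ a, ∑ b, T j a b • I j a b = ∑ j, ∑ a, ∑ b, T j a b • I j a b +
        ∑ j, ∑ a, ∑ b, T a b j • I j a b + ∑ j, ∑ a, ∑ b, T b j a • I j a b := by
      rw [← h1, ← h2]
      module
    rw [this]
    simp only [← Finset.sum_add_distrib, ← add_smul, hJ, zero_smul, Finset.sum_const_zero]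
  have h4 : ∑ k, ∑ j, P.coeff e z k j • contr (tangentVec j) (contrBiv (dCoeff P e z k) x) =
      (1 / 2 : ℂ) • ∑ j, ∑ a, ∑ b, T j a b • I j a b := by
    simp only [contrBiv_apply, map_smul, map_sum, hT, hI, Finset.sum_smul, Finset.smul_sum,
      smul_smul]
    rw [Finset.sum_comm]
    refine Finset.sum_congr rfl fun j _ => ?_
    rw [Finset.sum_comm]
    refine Finset.sum_congr rfl fun a _ => ?_
    rw [Finset.sum_comm]
    refine Finset.sum_congr rfl fun b _ => Finset.sum_congr rfl fun k _ => ?_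
    congr 1
    ring
  rw [h4, (smul_eq_zero.mp h3).resolve_left three_ne_zero, smul_zero]

/-- By the Jacobi identity for `π`, the operators `ι_π` and `∂_π` commute. -/
lemma iotaPi_delPi {w : Fam n M} (hw : w ∈ forms n M) :
    iotaPi P (delPi P w) = delPi P (iotaPi P w) := by
  funext e z
  by_cases hz : z ∈ e.1.target
  · have hd := SmoothFam.differentiableAt hw.1 e hz
    rw [iotaPi_eq_contrBiv, delPi_apply hd hz, delPi_apply (differentiableAt_iotaPi hd hz) hz,
      map_sum]
    simp only [map_sub, map_sum, map_smul, wirt_iotaPi hd hz, contrBiv_contr, map_add,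
      contrBiv_dz_mul (P.skew e z hz), iotaPi_eq_contrBiv, contrBiv_contrBiv (dCoeff P e z _),
      smul_add, Finset.sum_add_distrib, Finset.sum_sub_distrib, sum_coeff_contr_contrBiv_dCoeff hz]
    abel
  · rw [iotaPi_eq_contrBiv]
    simp [delPi, iotaPi_eq_contrBiv, del, hz]

/-- The bracket `[a, b]` in coordinates, for `a` even. It is an odd derivation in `b`. -/
lemma bracket_apply {a b : Fam n M} (ha : DifferentiableAt ℝ (a e) z)
    (hb : DifferentiableAt ℝ (b e) z) (hz : z ∈ e.1.target)
    (heven : ∀ᶠ y in nhds z, gradeInv (a e y) = a e y) :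
    bracket P 2 a b e z = ∑ k,
      (∑ j, P.coeff e z k j • (contr (tangentVec j) (a e z) * wirt (-Complex.I) k (b e) z +
          wirt (-Complex.I) k (a e) z * contr (tangentVec j) (b e z)) +
        incl (dz k) * ∑ i, ∑ j, dCoeff P e z k i j •
          (contr (tangentVec i) (a e z) * contr (tangentVec j) (b e z))) := by
  have hz0 : gradeInv (a e z) = a e z := heven.self_of_nhds
  have hD : ∀ k, gradeInv (wirt (-Complex.I) k (a e) z) = wirt (-Complex.I) k (a e) z := fun k => by
    have h := wirt_linear (s := -Complex.I) (i := k) (gradeInv (n := n)).toLinearMap ha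
    rw [AlgHom.toLinearMap_apply] at h
    rw [← h]
    exact wirt_congr heven
  have hab : DifferentiableAt ℝ ((a * b : Fam n M) e) z := differentiableAt_mul ha hb
  have hw : ∀ k, wirt (-Complex.I) k ((a * b : Fam n M) e) z =
      wirt (-Complex.I) k (a e) z * b e z + a e z * wirt (-Complex.I) k (b e) z := fun k =>
    wirt_mul ha hb
  have hm : (a * b : Fam n M) e z = a e z * b e z := rfl
  have hB : bracket P 2 a b e z =
      delPi P (a * b) e z - delPi P a e z * b e z - a e z * delPi P b e z := by
    simp [bracket]
  rw [hB, delPi_apply hab hz, delPi_apply ha hz, delPi_apply hb hz, Finset.sum_mul,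
    Finset.mul_sum, ← Finset.sum_sub_distrib, ← Finset.sum_sub_distrib]
  refine Finset.sum_congr rfl fun k _ => ?_
  rw [hw, hm, contrBiv_mul_of_even _ (dCoeff_skew hz k) hz0]
  simp only [map_add, contr_mul, hz0, hD, smul_add, Finset.sum_add_distrib, mul_sub, sub_mul,
    mul_add, Finset.sum_mul, Finset.mul_sum, smul_mul_assoc, mul_smul_comm]
  have hc : a e z * (incl (dz k) * contrBiv (dCoeff P e z k) (b e z)) =
      incl (dz k) * (a e z * contrBiv (dCoeff P e z k) (b e z)) := by
    rw [← mul_assoc, mul_comm_of_even hz0, mul_assoc]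
  rw [hc, mul_assoc]
  abel

end Koszul

/-! ### The operators `∂`, `\bar∂`, `ι_π` and `∂_π` as endomorphisms of the space of forms -/

section Endomorphisms

variable {M : Type*} [TopologicalSpace M] [ChartedSpace (Model n) M] (P : PoissonBivector n M)

lemma contrBiv_dzbar_mul (c : Matrix (Fin n) (Fin n) ℂ) (k : Fin n) (x : Lam n) :
    contrBiv c (incl (dzbar k) * x) = incl (dzbar k) * contrBiv c x := by
  simp [contrBiv_apply, contr_incl_mul, tangentVec_dzbar, Finset.mul_sum]

/-- `\bar∂` commutes with `ι_π`, as `π` is holomorphic. -/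
lemma delbar_iotaPi {w : Fam n M} (hw : SmoothFam w) :
    delbar (iotaPi P w) = iotaPi P (delbar w) := by
  funext e z
  by_cases hz : z ∈ e.1.target
  · have hd := hw.differentiableAt e hz
    have h1 : ∀ i j, DifferentiableAt ℝ
        (fun y => contr (tangentVec j) (contr (tangentVec i) (w e y))) z := fun i j =>
      differentiableAt_linear _ (differentiableAt_linear _ hd)
    have h2 : ∀ i j, DifferentiableAt ℝ
        (fun y => P.coeff e y i j • contr (tangentVec j) (contr (tangentVec i) (w e y))) z :=
      fun i j => (differentiableAt_coeff P hz i j).fun_smul (h1 i j)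
    have h3 : ∀ k, wirt Complex.I k (iotaPi P w e) z =
        contrBiv (P.coeff e z) (wirt Complex.I k (w e) z) := fun k => by
      have h4 : iotaPi P w e = fun y => (1 / 2 : ℂ) • ∑ i, ∑ j, P.coeff e y i j •
        contr (tangentVec j) (contr (tangentVec i) (w e y)) := rfl
      rw [h4, wirt_const_smul _ (DifferentiableAt.fun_sum fun i _ =>
          DifferentiableAt.fun_sum fun j _ => h2 i j),
        wirt_sum _ fun i _ => DifferentiableAt.fun_sum fun j _ => h2 i j, contrBiv_apply]
      congr 1
      refine Finset.sum_congr rfl fun i _ => ?_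
      rw [wirt_sum _ fun j _ => h2 i j]
      refine Finset.sum_congr rfl fun j _ => ?_
      rw [wirt_smul (differentiableAt_coeff P hz i j) (h1 i j),
        wirt_of_holomorphic (P.holomorphic e i j z hz).differentiableAt, zero_smul, zero_add,
        wirt_linear _ (differentiableAt_linear _ hd), wirt_linear _ hd]
    rw [iotaPi_eq_contrBiv, delbar_eq_famExtDer, delbar_eq_famExtDer, famExtDer_apply _ hz,
      famExtDer_apply _ hz, extDer, extDer, map_sum]
    simp only [h3, contrBiv_dzbar_mul]
  · rw [iotaPi_eq_contrBiv]
    simp [delbar, hz]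

lemma del_add {a b : Fam n M} (ha : SmoothFam a) (hb : SmoothFam b) :
    del (a + b) = del a + del b := by
  simp only [del_eq_famExtDer]
  exact famExtDer_add ha hb

lemma del_smul {a : Fam n M} (ha : SmoothFam a) (r : ℂ) : del (r • a) = r • del a := by
  simp only [del_eq_famExtDer]
  exact famExtDer_smul ha r

lemma bracket_eq {a b : Fam n M} :
    bracket P 2 a b = delPi P (a * b) - delPi P a * b - a * delPi P b := by
  simp [bracket]

lemma gradeInv_of_mem_formsPQ {p q : ℕ} {a : Fam n M} (ha : a ∈ formsPQ n M p q)
    (e : atlas (Model n) M) (z : Model n) : gradeInv (a e z) = (-1 : ℂ) ^ (p + q) • a e z :=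
  gradeInv_of_mem_lamPQ (ha.2 e z)

lemma mul_comm_of_formsPQ_one_one {a : Fam n M} (ha : a ∈ formsPQ n M 1 1) (b : Fam n M) :
    a * b = b * a := by
  funext e z
  exact mul_comm_of_even (by rw [gradeInv_of_mem_formsPQ ha]; norm_num) _

/-- If `d² = 0` and `i` commutes with `[i, d]`, then `[i, d]² = 0`. -/
lemma commutator_sq_eq_zero {R : Type*} [Ring R] [Algebra ℂ R] (i d : R) (hdd : d * d = 0)
    (h : i * (i * d - d * i) = (i * d - d * i) * i) :
    (i * d - d * i) * (i * d - d * i) = 0 := by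
  obtain ⟨D, hD⟩ : ∃ D, D = i * d - d * i := ⟨_, rfl⟩
  rw [← hD] at h ⊢
  have hdD : d * D = -(D * d) := by
    rw [hD, mul_sub, sub_mul, mul_assoc i d d, hdd, ← mul_assoc d d i, hdd, mul_assoc]
    simp
  have h1 : D * D = -(D * D) := by
    calc D * D = (i * d - d * i) * D := by rw [← hD]
      _ = i * (d * D) - d * (i * D) := by noncomm_ring
      _ = i * -(D * d) - d * (D * i) := by rw [hdD, h]
      _ = -(i * D * d) - d * D * i := by noncomm_ring
      _ = -(D * (i * d - d * i)) := by rw [h, hdD]; noncomm_ring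
      _ = -(D * D) := by rw [← hD]
  have h2 : (2 : ℂ) • (D * D) = 0 := by
    rw [two_smul]
    nth_rewrite 1 [h1]
    exact neg_add_cancel _
  exact (smul_eq_zero.mp h2).resolve_left two_ne_zero

lemma anticomm_commutator {R : Type*} [Ring R] (b i d : R) (h1 : b * i = i * b)
    (h2 : b * d = -(d * b)) : b * (i * d - d * i) = -((i * d - d * i) * b) := by
  calc b * (i * d - d * i) = b * i * d - b * d * i := by noncomm_ring
    _ = i * b * d - -(d * b) * i := by rw [h1, h2]
    _ = i * (b * d) + d * (b * i) := by noncomm_ring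
    _ = i * -(d * b) + d * (i * b) := by rw [h1, h2]
    _ = _ := by noncomm_ring

lemma delbar_mul_of_formsPQ_one_one {a b : Fam n M} (ha : a ∈ formsPQ n M 1 1)
    (hb : b ∈ forms n M) : delbar (a * b) = delbar a * b + a * delbar b := by
  have h := famExtDer_mul (s := Complex.I) (c := dzbar) ha.1.1 hb.1
  have he : famGradeInv a = a := by
    funext e z
    rw [famGradeInv, gradeInv_of_mem_formsPQ ha]
    norm_num
  rwa [he] at h

lemma del_mul_of_formsPQ_one_one {a b : Fam n M} (ha : a ∈ formsPQ n M 1 1)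
    (hb : b ∈ forms n M) : del (a * b) = del a * b + a * del b := by
  have h := famExtDer_mul (s := -Complex.I) (c := dz) ha.1.1 hb.1
  have he : famGradeInv a = a := by
    funext e z
    rw [famGradeInv, gradeInv_of_mem_formsPQ ha]
    norm_num
  rw [he] at h
  simp only [del_eq_famExtDer]
  exact h

variable [IsManifold (modelWithCornersSelf ℂ (Model n)) ω M]

variable (n M) in
/-- The operator `∂` on forms. -/
def delEnd : Module.End ℂ (forms n M) where
  toFun w := ⟨del w.1, del_mem_forms w.2⟩
  map_add' a b := Subtype.ext (del_add a.2.1 b.2.1)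
  map_smul' r a := Subtype.ext (del_smul a.2.1 r)

variable (n M) in
/-- The operator `\bar∂` on forms. -/
def delbarEnd : Module.End ℂ (forms n M) where
  toFun w := ⟨delbar w.1, delbar_mem_forms w.2⟩
  map_add' a b := Subtype.ext (delbar_add a.2.1 b.2.1)
  map_smul' r a := Subtype.ext (delbar_smul a.2.1 r)

/-- The contraction `ι_π` on forms. -/
def iotaPiEnd : Module.End ℂ (forms n M) where
  toFun w := ⟨iotaPi P w.1, iotaPi_mem_forms P w.2⟩
  map_add' a b := Subtype.ext (iotaPi_add P a.1 b.1)
  map_smul' r a := Subtype.ext (iotaPi_smul P r a.1)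

/-- The Koszul–Brylinski operator `∂_π` on forms. -/
def delPiEnd : Module.End ℂ (forms n M) :=
  iotaPiEnd P * delEnd n M - delEnd n M * iotaPiEnd P

lemma delEnd_sq : delEnd n M * delEnd n M = 0 := by
  ext w : 1
  refine Subtype.ext ?_
  have h : famExtDer (-Complex.I) dz (famExtDer (-Complex.I) dz w.1) +
    famExtDer (-Complex.I) dz (famExtDer (-Complex.I) dz w.1) = 0 := famExtDer_anticomm w.2.1
  rw [← two_smul ℂ] at h
  change del (del w.1) = 0
  rw [del_eq_famExtDer, del_eq_famExtDer]
  exact (smul_eq_zero.mp h).resolve_left two_ne_zero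

lemma delbarEnd_sq : delbarEnd n M * delbarEnd n M = 0 := by
  ext w : 1
  refine Subtype.ext ?_
  have h : famExtDer Complex.I dzbar (famExtDer Complex.I dzbar w.1) +
    famExtDer Complex.I dzbar (famExtDer Complex.I dzbar w.1) = 0 := famExtDer_anticomm w.2.1
  rw [← two_smul ℂ] at h
  exact (smul_eq_zero.mp h).resolve_left two_ne_zero

lemma delbarEnd_mul_delEnd : delbarEnd n M * delEnd n M = -(delEnd n M * delbarEnd n M) := by
  ext w : 1
  refine Subtype.ext ?_
  change delbar (del w.1) = -del (delbar w.1)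
  refine eq_neg_of_add_eq_zero_left ?_
  rw [del_eq_famExtDer, del_eq_famExtDer]
  exact famExtDer_anticomm w.2.1

lemma delbarEnd_mul_iotaPiEnd : delbarEnd n M * iotaPiEnd P = iotaPiEnd P * delbarEnd n M := by
  ext w : 1
  exact Subtype.ext (delbar_iotaPi P w.2.1)

lemma iotaPiEnd_mul_delPiEnd : iotaPiEnd P * delPiEnd P = delPiEnd P * iotaPiEnd P := by
  ext w : 1
  exact Subtype.ext (iotaPi_delPi w.2)

/-- `∂_π² = 0`: it follows from `∂² = 0` and `[ι_π, ∂_π] = 0`, since `∂_π = [ι_π, ∂]`. -/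
lemma delPiEnd_sq : delPiEnd P * delPiEnd P = 0 :=
  commutator_sq_eq_zero (iotaPiEnd P) (delEnd n M) delEnd_sq (iotaPiEnd_mul_delPiEnd P)

lemma delbarEnd_mul_delPiEnd : delbarEnd n M * delPiEnd P = -(delPiEnd P * delbarEnd n M) :=
  anticomm_commutator _ (iotaPiEnd P) (delEnd n M) (delbarEnd_mul_iotaPiEnd P)
    delbarEnd_mul_delEnd

lemma bracket_mem_forms {a b : Fam n M} (ha : a ∈ forms n M) (hb : b ∈ forms n M) :
    bracket P 2 a b ∈ forms n M := by
  rw [bracket_eq]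
  exact sub_mem (sub_mem (delPi_mem_forms P (mul_mem_forms ha hb))
    (mul_mem_forms (delPi_mem_forms P ha) hb)) (mul_mem_forms ha (delPi_mem_forms P hb))

/-- The bracket with a `(1,1)`-form is a derivation of degree one. -/
lemma bracket_mul {a b c : Fam n M} (ha : a ∈ formsPQ n M 1 1) (hb : b ∈ formsPQ n M 1 1)
    (hc : c ∈ forms n M) :
    bracket P 2 a (b * c) = bracket P 2 a b * c + b * bracket P 2 a c := by
  have hae : ∀ e z, gradeInv (a e z) = a e z := fun e z => by
    rw [gradeInv_of_mem_formsPQ ha]; norm_num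
  have hbe : ∀ e z, gradeInv (b e z) = b e z := fun e z => by
    rw [gradeInv_of_mem_formsPQ hb]; norm_num
  funext e z
  by_cases hz : z ∈ e.1.target
  · have da := SmoothFam.differentiableAt ha.1.1 e hz
    have db := SmoothFam.differentiableAt hb.1.1 e hz
    have dc := SmoothFam.differentiableAt hc.1 e hz
    have hw : ∀ k, wirt (-Complex.I) k ((b * c : Fam n M) e) z =
        wirt (-Complex.I) k (b e) z * c e z + b e z * wirt (-Complex.I) k (c e) z := fun k =>
      wirt_mul db dc
    have hm : (b * c : Fam n M) e z = b e z * c e z := rfl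
    have hev := Filter.Eventually.of_forall (f := nhds z) (hae e)
    have hL := bracket_apply (P := P) (b := b * c) da (differentiableAt_mul db dc) hz hev
    simp only [hw, hm] at hL
    change bracket P 2 a (b * c) e z = bracket P 2 a b e z * c e z + b e z * bracket P 2 a c e z
    rw [hL, bracket_apply da db hz hev, bracket_apply da dc hz hev, Finset.sum_mul,
      Finset.mul_sum, ← Finset.sum_add_distrib]
    refine Finset.sum_congr rfl fun k _ => ?_
    -- `b` is central, so it can be moved to the front
    have hcen : ∀ x y : Lam n, x * (b e z * y) = b e z * (x * y) := fun x y => by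
      rw [← mul_assoc, ← mul_comm_of_even (hbe e z), mul_assoc]
    simp only [contr_mul, hbe, mul_add, add_mul, smul_add, Finset.sum_add_distrib, Finset.mul_sum,
      Finset.sum_mul, smul_mul_assoc, mul_smul_comm, hcen, mul_assoc]
    abel
  · have h1 := (bracket_mem_forms P ha.1 (mul_mem_forms hb.1 hc)).2.1 e z hz
    have h2 := (bracket_mem_forms P ha.1 hb.1).2.1 e z hz
    have h3 := (bracket_mem_forms P ha.1 hc).2.1 e z hz
    simp [h1, h2, h3]

/-- The second-order property of `∂_π` on `∂_π`-closed forms of type `(1,1)`. -/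
lemma delPi_mul_mul {a b c : Fam n M} (ha : a ∈ formsPQ n M 1 1) (hb : b ∈ formsPQ n M 1 1)
    (hc : c ∈ formsPQ n M 1 1) (ha0 : delPi P a = 0) (hb0 : delPi P b = 0) (hc0 : delPi P c = 0) :
    delPi P (a * b * c) =
      delPi P (a * b) * c + delPi P (b * c) * a + delPi P (c * a) * b := by
  have h := bracket_mul P ha hb hc.1
  have hcom : delPi P (b * c) * a = a * delPi P (b * c) :=
    (mul_comm_of_formsPQ_one_one ha _).symm
  have hcom' : delPi P (c * a) * b = b * delPi P (a * c) := by
    rw [mul_comm_of_formsPQ_one_one ha c, mul_comm_of_formsPQ_one_one hb]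
  rw [bracket_eq, bracket_eq, bracket_eq, ha0, hb0, hc0] at h
  simp only [zero_mul, mul_zero, sub_zero] at h
  rw [hcom, hcom', mul_assoc, sub_eq_iff_eq_add.mp h]
  abel

end Endomorphisms

/-! ### Construction of Maurer–Cartan elements -/

/-- Recursive construction of a sequence whose `k`-th term solves a problem depending on the
previous ones. -/
lemma exists_seq_of_step {X : Type*} [Nonempty X] (p : ℕ → (ℕ → X) → X → Prop)
    (hloc : ∀ k f g x, (∀ i < k, f i = g i) → p k f x → p k g x)
    (hstep : ∀ k f, (∀ i < k, p i f (f i)) → ∃ x, p k f x) :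
    ∃ f : ℕ → X, ∀ k, p k f (f k) := by
  classical
  let F : ℕ → ℕ → X := fun k => Nat.rec (fun _ => Classical.arbitrary X)
    (fun k f => Function.update f k
      (if h : ∃ x, p k f x then h.choose else Classical.arbitrary X)) k
  have hF : ∀ k, F (k + 1) = Function.update (F k) k
      (if h : ∃ x, p k (F k) x then h.choose else Classical.arbitrary X) := fun _ => rfl
  have hlt : ∀ k i, i < k → F k i = F (i + 1) i := by
    intro k
    induction k with
    | zero => intro i hi; omega
    | succ k ih =>
      intro i hi
      by_cases h : i = k
      · rw [h]
      · rw [hF, Function.update_of_ne h]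
        exact ih i (by omega)
  refine ⟨fun k => F (k + 1) k, fun k => ?_⟩
  induction k using Nat.strong_induction_on with
  | _ k ih =>
    have hex : ∃ x, p k (F k) x := by
      refine hstep k (F k) fun i hi => ?_
      rw [hlt k i hi]
      exact hloc i _ _ _ (fun j hj => (hlt k j (hj.trans hi)).symm) (ih i hi)
    refine hloc k (F k) _ _ (fun i hi => hlt k i hi) ?_
    have : F (k + 1) k = hex.choose := by rw [hF, Function.update_self, dif_pos hex]
    simp only [this]
    exact hex.choose_spec

open Finset.HasAntidiagonal in
/-- A sum over all triples with `a + b + c = k` is invariant under cyclic permutations. -/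
lemma sum_antidiagonal_rotate {N : Type*} [AddCommMonoid N] (k : ℕ) (f : ℕ → ℕ → ℕ → N) :
    ∑ uc ∈ antidiagonal k, ∑ ab ∈ antidiagonal uc.1, f ab.1 ab.2 uc.2 =
      ∑ uc ∈ antidiagonal k, ∑ ab ∈ antidiagonal uc.1, f uc.2 ab.1 ab.2 := by
  rw [Finset.sum_sigma', Finset.sum_sigma']
  refine Finset.sum_bij' (fun x _ => ⟨(x.2.2 + x.1.2, x.2.1), (x.2.2, x.1.2)⟩)
    (fun x _ => ⟨(x.1.2 + x.2.1, x.2.2), (x.1.2, x.2.1)⟩) ?_ ?_ ?_ ?_ ?_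
  all_goals
    rintro ⟨⟨u, c⟩, ⟨a, b⟩⟩ h
    simp only [Finset.mem_sigma, mem_antidiagonal] at h ⊢
  · exact ⟨by omega, trivial⟩
  · exact ⟨by omega, trivial⟩
  · obtain ⟨h1, rfl⟩ := h; rfl
  · obtain ⟨h1, rfl⟩ := h; rfl

section MaurerCartan

variable {M : Type*} [TopologicalSpace M] [ChartedSpace (Model n) M] (P : PoissonBivector n M)
  [IsManifold (modelWithCornersSelf ℂ (Model n)) ω M]

lemma delPi_zero : delPi P (0 : Fam n M) = 0 :=
  congrArg Subtype.val (delPiEnd P).map_zero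

lemma delPi_add {a b : Fam n M} (ha : a ∈ forms n M) (hb : b ∈ forms n M) :
    delPi P (a + b) = delPi P a + delPi P b := by
  rw [delPi, delPi, delPi, del_add ha.1 hb.1, iotaPi_add, iotaPi_add,
    del_add (iotaPi_mem_forms P ha).1 (iotaPi_mem_forms P hb).1]
  abel

lemma delPi_smul (r : ℂ) {a : Fam n M} (ha : a ∈ forms n M) :
    delPi P (r • a) = r • delPi P a := by
  rw [delPi, delPi, del_smul ha.1, iotaPi_smul, iotaPi_smul,
    del_smul (iotaPi_mem_forms P ha).1, smul_sub]

lemma delPi_sum {κ : Type*} (S : Finset κ) {f : κ → Fam n M} (hf : ∀ i ∈ S, f i ∈ forms n M) :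
    delPi P (∑ i ∈ S, f i) = ∑ i ∈ S, delPi P (f i) := by
  classical
  induction S using Finset.induction_on with
  | empty => exact delPi_zero P
  | insert i S hi ih =>
    rw [Finset.sum_insert hi, Finset.sum_insert hi, delPi_add P (hf i (Finset.mem_insert_self _ _))
      (sum_mem fun j hj => hf j (Finset.mem_insert_of_mem hj)),
      ih fun j hj => hf j (Finset.mem_insert_of_mem hj)]

omit [IsManifold (modelWithCornersSelf ℂ (Model n)) ω M] in
lemma delbar_sum {κ : Type*} (S : Finset κ) {f : κ → Fam n M} (hf : ∀ i ∈ S, f i ∈ forms n M) :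
    delbar (∑ i ∈ S, f i) = ∑ i ∈ S, delbar (f i) := by
  classical
  induction S using Finset.induction_on with
  | empty => exact delbar_zero
  | insert i S hi ih =>
    have hS : ∑ i ∈ S, f i ∈ forms n M := sum_mem fun j hj => hf j (Finset.mem_insert_of_mem hj)
    rw [Finset.sum_insert hi, Finset.sum_insert hi,
      delbar_add (hf i (Finset.mem_insert_self _ _)).1 hS.1,
      ih fun j hj => hf j (Finset.mem_insert_of_mem hj)]

lemma delPi_delPi {w : Fam n M} (hw : w ∈ forms n M) : delPi P (delPi P w) = 0 :=
  congrArg Subtype.val (LinearMap.congr_fun (delPiEnd_sq P) ⟨w, hw⟩)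

lemma delbar_delPi {w : Fam n M} (hw : w ∈ forms n M) :
    delbar (delPi P w) = -delPi P (delbar w) :=
  congrArg Subtype.val (LinearMap.congr_fun (delbarEnd_mul_delPiEnd P) ⟨w, hw⟩)

open Finset.HasAntidiagonal in
/-- The obstruction to solving the Maurer–Cartan equation at order `k` is `\bar∂`-closed. -/
lemma delbar_sum_delPi_mul {β : ℕ → Fam n M} (hβ : ∀ i, β i ∈ formsPQ n M 1 1)
    (hβ0 : ∀ i, delPi P (β i) = 0) (h0 : β 0 = 0) (k : ℕ)
    (heq : ∀ i < k, delbar (β i) =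
      -((1 / 2 : ℂ) • ∑ ij ∈ antidiagonal i, delPi P (β ij.1 * β ij.2))) :
    delbar (∑ ij ∈ antidiagonal k, delPi P (β ij.1 * β ij.2)) = 0 := by
  have hm : ∀ i j, β i * β j ∈ forms n M := fun i j => mul_mem_forms (hβ i).1 (hβ j).1
  set S : Fam n M := ∑ uc ∈ antidiagonal k, ∑ ab ∈ antidiagonal uc.1,
    delPi P (β ab.1 * β ab.2) * β uc.2 with hS
  have hterm : ∀ a b c, delPi P (β a * β b) * β c ∈ forms n M := fun a b c =>
    mul_mem_forms (delPi_mem_forms P (hm a b)) (hβ c).1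
  have hSmem : S ∈ forms n M := sum_mem fun _ _ => sum_mem fun _ _ => hterm _ _ _
  -- by the second-order property of `∂_π`, three times `S` is `∂_π`-exact
  have h3 : (3 : ℂ) • S = delPi P (∑ uc ∈ antidiagonal k, ∑ ab ∈ antidiagonal uc.1,
      β ab.1 * β ab.2 * β uc.2) := by
    rw [delPi_sum P _ fun _ _ => sum_mem fun _ _ => mul_mem_forms (hm _ _) (hβ _).1]
    have e1 : S = ∑ uc ∈ antidiagonal k, ∑ ab ∈ antidiagonal uc.1,
        delPi P (β uc.2 * β ab.1) * β ab.2 :=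
      sum_antidiagonal_rotate k fun a b c => delPi P (β a * β b) * β c
    have e2 : S = ∑ uc ∈ antidiagonal k, ∑ ab ∈ antidiagonal uc.1,
        delPi P (β ab.2 * β uc.2) * β ab.1 :=
      e1.trans (sum_antidiagonal_rotate k fun a b c => delPi P (β c * β a) * β b)
    have e3 : (3 : ℂ) • S = S + (∑ uc ∈ antidiagonal k, ∑ ab ∈ antidiagonal uc.1,
        delPi P (β uc.2 * β ab.1) * β ab.2) + ∑ uc ∈ antidiagonal k, ∑ ab ∈ antidiagonal uc.1,
        delPi P (β ab.2 * β uc.2) * β ab.1 := by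
      rw [← e1, ← e2]
      module
    rw [e3, hS, ← Finset.sum_add_distrib, ← Finset.sum_add_distrib]
    refine Finset.sum_congr rfl fun uc _ => ?_
    rw [delPi_sum P _ fun _ _ => mul_mem_forms (hm _ _) (hβ _).1, ← Finset.sum_add_distrib,
      ← Finset.sum_add_distrib]
    refine Finset.sum_congr rfl fun ab _ => ?_
    rw [delPi_mul_mul P (hβ _) (hβ _) (hβ _) (hβ0 _) (hβ0 _) (hβ0 _)]
    abel
  have hS0 : delPi P S = 0 := by
    have h : delPi P ((3 : ℂ) • S) = 0 := by
      rw [h3]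
      exact delPi_delPi P (sum_mem fun _ _ => sum_mem fun _ _ => mul_mem_forms (hm _ _) (hβ _).1)
    rw [delPi_smul P _ hSmem] at h
    exact (smul_eq_zero.mp h).resolve_left three_ne_zero
  -- the equations of lower order suffice to compute `\bar∂ (∑ β_i β_j)`, because `β 0 = 0`
  have hX : ∑ ij ∈ antidiagonal k, β ij.1 * β ij.2 ∈ forms n M := sum_mem fun _ _ => hm _ _
  have hdX : delbar (∑ ij ∈ antidiagonal k, β ij.1 * β ij.2) = -S := by
    have e1 : ∀ i j, delbar (β i * β j) = delbar (β i) * β j + delbar (β j) * β i := fun i j => by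
      rw [delbar_mul_of_formsPQ_one_one (hβ i) (hβ j).1, mul_comm_of_formsPQ_one_one (hβ i)]
    have e2 : ∀ ij ∈ antidiagonal k, delbar (β ij.1) * β ij.2 =
        -((1 / 2 : ℂ) • ∑ ab ∈ antidiagonal ij.1, delPi P (β ab.1 * β ab.2) * β ij.2) := by
      rintro ⟨i, j⟩ hij
      rw [mem_antidiagonal] at hij
      simp only at hij ⊢
      rcases Nat.eq_zero_or_pos j with rfl | hj
      · simp [h0]
      · rw [heq i (by omega), neg_mul, smul_mul_assoc, Finset.sum_mul]
    rw [delbar_sum _ fun _ _ => hm _ _]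
    simp only [e1, Finset.sum_add_distrib]
    rw [← Finset.Nat.sum_antidiagonal_swap (f := fun ij : ℕ × ℕ => delbar (β ij.2) * β ij.1)]
    simp only [Prod.fst_swap, Prod.snd_swap]
    rw [Finset.sum_congr rfl e2, Finset.sum_neg_distrib, ← Finset.smul_sum, ← hS]
    module
  rw [← delPi_sum P _ fun _ _ => hm _ _, delbar_delPi P hX, hdX, ← neg_one_smul ℂ S,
    delPi_smul P _ hSmem, hS0, smul_zero, neg_zero]

open Finset.HasAntidiagonal in
/-- Existence of Maurer–Cartan elements with prescribed first-order term `a ∈ V`, for a space `V` of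
`∂_π`-closed forms of type `(1,1)` whose brackets lie in a space `W` such that every
`\bar∂`-closed element of `W` is `\bar∂v` for some `v ∈ V`. -/
theorem exists_isMaurerCartan (V W : Submodule ℂ (Fam n M)) (hV : V ≤ formsPQ n M 1 1)
    (hVclosed : ∀ a ∈ V, delPi P a = 0) (hW : ∀ a ∈ V, ∀ b ∈ V, delPi P (a * b) ∈ W)
    (hsolve : ∀ w ∈ W, delbar w = 0 → ∃ v ∈ V, delbar v = w)
    {a : Fam n M} (ha : a ∈ V) (hBa : delbar a = 0) :
    ∃ α : ℕ → Fam n M, IsMaurerCartan P α ∧ α 1 = a := by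
  -- the condition on the `k`-th term may involve only the earlier ones, although the sum over the
  -- antidiagonal of `k` runs over the indices `0` and `k` as well
  let trunc : ℕ → (ℕ → Fam n M) → ℕ → Fam n M := fun k f i => if i < k then f i else 0
  have htr : ∀ k f i, i < k → trunc k f i = f i := fun k f i hi => if_pos hi
  have htr' : ∀ k f i, ¬i < k → trunc k f i = 0 := fun k f i hi => if_neg hi
  let p : ℕ → (ℕ → Fam n M) → Fam n M → Prop := fun k f x =>
    x ∈ V ∧ (k = 0 → x = 0) ∧ (k = 1 → x = a) ∧
      delbar x = -((1 / 2 : ℂ) • ∑ ij ∈ antidiagonal k,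
        delPi P (trunc k f ij.1 * trunc k f ij.2))
  -- as `f 0 = 0`, the truncation does not change the sums
  have hmul : ∀ (f : ℕ → Fam n M) (k : ℕ), f 0 = 0 → ∀ ij ∈ antidiagonal k,
      trunc k f ij.1 * trunc k f ij.2 = f ij.1 * f ij.2 := by
    rintro f k hf ⟨i, j⟩ hij
    rw [mem_antidiagonal] at hij
    simp only at hij ⊢
    by_cases hi : i < k
    · by_cases hj : j < k
      · rw [htr _ _ _ hi, htr _ _ _ hj]
      · have : i = 0 := by omega
        subst this
        rw [htr' _ _ _ hj, htr _ _ _ hi, hf, mul_zero, zero_mul]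
    · have : j = 0 := by omega
      subst this
      rw [htr' _ _ _ hi, hf, mul_zero, zero_mul]
  have hsum : ∀ (f : ℕ → Fam n M) (k : ℕ), f 0 = 0 →
      ∑ ij ∈ antidiagonal k, delPi P (trunc k f ij.1 * trunc k f ij.2) =
        ∑ ij ∈ antidiagonal k, delPi P (f ij.1 * f ij.2) := fun f k hf =>
    Finset.sum_congr rfl fun ij hij => by rw [hmul f k hf ij hij]
  obtain ⟨f, hf⟩ : ∃ f : ℕ → Fam n M, ∀ k, p k f (f k) := by
    refine exists_seq_of_step p ?_ ?_
    · rintro k f g x hfg ⟨h1, h2, h3, h4⟩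
      refine ⟨h1, h2, h3, ?_⟩
      have : trunc k f = trunc k g := by
        funext i
        by_cases hi : i < k
        · rw [htr _ _ _ hi, htr _ _ _ hi, hfg i hi]
        · rw [htr' _ _ _ hi, htr' _ _ _ hi]
      rw [← this]
      exact h4
    · intro k f hf
      rcases k with _ | _ | k
      · refine ⟨0, zero_mem _, fun _ => rfl, fun h => by omega, ?_⟩
        simp [trunc, delPi_zero, delbar_zero]
      · refine ⟨a, ha, fun h => by omega, fun _ => rfl, ?_⟩
        rw [hBa]
        simp [trunc, Finset.Nat.antidiagonal_succ, delPi_zero]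
      · have hf0 : f 0 = 0 := (hf 0 (by omega)).2.1 rfl
        have hβ0 : trunc (k + 2) f 0 = 0 := by rw [htr _ _ _ (by omega), hf0]
        have hβ : ∀ i, trunc (k + 2) f i ∈ V := fun i => by
          by_cases hi : i < k + 2
          · rw [htr _ _ _ hi]
            exact (hf i hi).1
          · rw [htr' _ _ _ hi]
            exact zero_mem _
        have heq : ∀ i < k + 2, delbar (trunc (k + 2) f i) = -((1 / 2 : ℂ) •
            ∑ ij ∈ antidiagonal i,
              delPi P (trunc (k + 2) f ij.1 * trunc (k + 2) f ij.2)) := by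
          intro i hi
          have h := (hf i hi).2.2.2
          rw [hsum f i hf0] at h
          rw [htr _ _ _ hi, h]
          have e : ∑ ij ∈ antidiagonal i, delPi P (f ij.1 * f ij.2) =
              ∑ ij ∈ antidiagonal i, delPi P (trunc (k + 2) f ij.1 * trunc (k + 2) f ij.2) := by
            refine Finset.sum_congr rfl fun ij hij => ?_
            rw [mem_antidiagonal] at hij
            rw [htr _ _ _ (by omega), htr _ _ _ (by omega)]
          rw [e]
        have hcl := delbar_sum_delPi_mul P (fun i => hV (hβ i)) (fun i => hVclosed _ (hβ i)) hβ0
          (k + 2) heq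
        obtain ⟨v, hv, hvw⟩ := hsolve _ (sum_mem fun ij _ => hW _ (hβ ij.1) _ (hβ ij.2)) hcl
        refine ⟨(-(1 / 2) : ℂ) • v, Submodule.smul_mem _ _ hv, fun h => by omega,
          fun h => by omega, ?_⟩
        rw [delbar_smul (hV hv).1.1, hvw, neg_smul]
  have hf0 : f 0 = 0 := (hf 0).2.1 rfl
  refine ⟨f, ⟨hf0, fun k => hV (hf k).1, fun k => ?_⟩, (hf 1).2.2.1 rfl⟩
  have h := (hf k).2.2.2
  rw [hsum f k hf0] at h
  rw [h, neg_add_eq_zero]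
  have e : ∑ ij ∈ antidiagonal k, delPi P (f ij.1 * f ij.2) =
      ∑ ij ∈ antidiagonal k, bracket P 2 (f ij.1) (f ij.2) := by
    refine Finset.sum_congr rfl fun ij _ => ?_
    rw [bracket_eq, hVclosed _ (hf _).1, hVclosed _ (hf _).1, zero_mul, mul_zero, sub_zero,
      sub_zero]
  rw [e]

end MaurerCartan

/-! ### Consequences of the `∂\bar∂`-lemma and of the `∂_π\bar∂`-lemma -/

section Lemmas

variable {M : Type*} [TopologicalSpace M] [ChartedSpace (Model n) M] (P : PoissonBivector n M)
  [IsManifold (modelWithCornersSelf ℂ (Model n)) ω M]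

/-- A differential `D` on forms anticommuting with `\bar∂` for which the analogue of the
`∂\bar∂`-lemma holds. It will be `∂` or `∂_π`. -/
structure SatisfiesDelbarLemma (D : Fam n M → Fam n M) : Prop where
  mem : ∀ a ∈ forms n M, D a ∈ forms n M
  add : ∀ a ∈ forms n M, ∀ b ∈ forms n M, D (a + b) = D a + D b
  smul : ∀ (r : ℂ), ∀ a ∈ forms n M, D (r • a) = r • D a
  sq : ∀ a ∈ forms n M, D (D a) = 0
  anticomm : ∀ a ∈ forms n M, delbar (D a) = -D (delbar a)
  exact : ∀ b ∈ forms n M, D b = 0 → delbar b = 0 → (∃ a ∈ forms n M, b = D a + delbar a) →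
    ∃ c ∈ forms n M, b = D (delbar c)

lemma delbar_delbar {w : Fam n M} (hw : w ∈ forms n M) : delbar (delbar w) = 0 :=
  congrArg Subtype.val (LinearMap.congr_fun delbarEnd_sq ⟨w, hw⟩)

lemma del_del {w : Fam n M} (hw : w ∈ forms n M) : del (del w) = 0 :=
  congrArg Subtype.val (LinearMap.congr_fun delEnd_sq ⟨w, hw⟩)

lemma delbar_del {w : Fam n M} (hw : w ∈ forms n M) : delbar (del w) = -del (delbar w) :=
  congrArg Subtype.val (LinearMap.congr_fun delbarEnd_mul_delEnd ⟨w, hw⟩)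

lemma DelDelbarLemma.satisfiesDelbarLemma (h : DelDelbarLemma n M) :
    SatisfiesDelbarLemma (del : Fam n M → Fam n M) where
  mem _ ha := del_mem_forms ha
  add _ ha _ hb := del_add ha.1 hb.1
  smul r _ ha := del_smul ha.1 r
  sq _ ha := del_del ha
  anticomm _ ha := delbar_del ha
  exact _ hb h1 h2 h3 := h.subset ⟨hb, h1, h2, h3⟩

lemma DelPiDelbarLemma.satisfiesDelbarLemma {P : PoissonBivector n M} (h : DelPiDelbarLemma P) :
    SatisfiesDelbarLemma (delPi P) where
  mem _ ha := delPi_mem_forms P ha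
  add _ ha _ hb := delPi_add P ha hb
  smul r _ ha := delPi_smul P r ha
  sq _ ha := delPi_delPi P ha
  anticomm _ ha := delbar_delPi P ha
  exact _ hb h1 h2 h3 := h.subset ⟨hb, h1, h2, h3⟩

/-- A `\bar∂`-closed and `D`-exact form `Dy` is `D\bar∂`-exact: the lemma applies to
`(D + \bar∂) y`, whose component of the type of `Dy` is `Dy`. -/
lemma SatisfiesDelbarLemma.exists_eq {D : Fam n M → Fam n M} (hD : SatisfiesDelbarLemma D)
    {p p' : ℕ} (hproj : ∀ q, ∀ w ∈ forms n M, famTypeProj p' q (D w) = D (famTypeProj p q w))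
    {q : ℕ} {y : Fam n M} (hy : y ∈ formsPQ n M p (q + 1)) (hBy : delbar (D y) = 0) :
    ∃ z ∈ formsPQ n M p q, D y = D (delbar z) := by
  have hDy := hD.mem y hy.1
  have hy' := delbar_mem_forms hy.1
  have h1 : D (D y + delbar y) = 0 := by
    rw [hD.add _ hDy _ hy', hD.sq y hy.1, zero_add, ← neg_neg (D (delbar y)),
      ← hD.anticomm y hy.1, hBy, neg_zero]
  have h2 : delbar (D y + delbar y) = 0 := by
    rw [delbar_add hDy.1 hy'.1, hBy, delbar_delbar hy.1, add_zero]
  obtain ⟨c, hc, hyc⟩ := hD.exact _ (add_mem hDy hy') h1 h2 ⟨y, hy.1, rfl⟩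
  refine ⟨famTypeProj p q c, famTypeProj_mem_formsPQ p q hc, ?_⟩
  have h3 : famTypeProj p' (q + 1) (D y + delbar y) = D y := by
    have e : famTypeProj p' (q + 1) (D y + delbar y) =
        famTypeProj p' (q + 1) (D y) + famTypeProj p' (q + 1) (delbar y) := by
      funext e z
      exact map_add _ _ _
    rw [e, hproj _ y hy.1, famTypeProj_of_mem hy,
      famTypeProj_of_mem_of_ne (delbar_mem_formsPQ hy) (Or.inr (by omega)), add_zero]
  rw [← h3, hyc, hproj _ _ (delbar_mem_forms hc), famTypeProj_delbar p q hc.1]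

/-- Every `\bar∂`-closed form of type `(1,1)` is cohomologous to a `D`-closed form, which is the
first-order term of a Maurer–Cartan element. The operator `D` takes type `(1,q)` to `(p',q)`
and `(r,q)` to `(p,q)`: for `∂` these are `(1,q) → (2,q)` and `(0,q) → (1,q)`, for `∂_π` they
are `(1,q) → (0,q)` and `(2,q) → (1,q)`. -/
theorem SatisfiesDelbarLemma.exists_isMaurerCartan {D : Fam n M → Fam n M}
    (hD : SatisfiesDelbarLemma D) {p p' r : ℕ}
    (hproj : ∀ q, ∀ w ∈ forms n M, famTypeProj p' q (D w) = D (famTypeProj 1 q w))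
    (hproj' : ∀ q, ∀ w ∈ forms n M, famTypeProj p q (D w) = D (famTypeProj r q w))
    (htype : ∀ z ∈ formsPQ n M r 1, D z ∈ formsPQ n M 1 1)
    (hclosed : ∀ a ∈ formsPQ n M 1 1, D a = 0 → delPi P a = 0)
    (hexact : ∀ a ∈ formsPQ n M 1 1, ∀ b ∈ formsPQ n M 1 1, D a = 0 → D b = 0 →
      ∃ y ∈ formsPQ n M r 2, delPi P (a * b) = D y)
    {a : Fam n M} (ha : a ∈ cocycles n M 1 1) :
    ∃ α : ℕ → Fam n M, IsMaurerCartan P α ∧ ∃ z ∈ formsPQ n M 1 0, α 1 = a - delbar z := by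
  have hD0 : D 0 = 0 := by
    have h := hD.smul 0 0 (zero_mem _)
    rwa [zero_smul, zero_smul] at h
  -- `V` consists of the `D`-closed forms of type `(1,1)`, `W` contains their brackets
  let V : Submodule ℂ (Fam n M) :=
    { carrier := {x | x ∈ formsPQ n M 1 1 ∧ D x = 0}
      zero_mem' := ⟨zero_mem _, hD0⟩
      add_mem' := fun hx hy => ⟨add_mem hx.1 hy.1, by
        rw [hD.add _ hx.1.1 _ hy.1.1, hx.2, hy.2, add_zero]⟩
      smul_mem' := fun c _ hx => ⟨Submodule.smul_mem _ c hx.1, by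
        rw [hD.smul _ _ hx.1.1, hx.2, smul_zero]⟩ }
  let W : Submodule ℂ (Fam n M) :=
    { carrier := {x | ∃ y ∈ formsPQ n M r 2, x = D y}
      zero_mem' := ⟨0, zero_mem _, hD0.symm⟩
      add_mem' := by
        rintro _ _ ⟨x, hx, rfl⟩ ⟨y, hy, rfl⟩
        exact ⟨x + y, add_mem hx hy, (hD.add _ hx.1 _ hy.1).symm⟩
      smul_mem' := by
        rintro c _ ⟨x, hx, rfl⟩
        exact ⟨c • x, Submodule.smul_mem _ c hx, (hD.smul c _ hx.1).symm⟩ }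
  obtain ⟨z, hz, hDa⟩ := hD.exists_eq hproj ha.1 (by
    rw [hD.anticomm a ha.1.1, ha.2, hD0, neg_zero])
  have hBz := delbar_mem_formsPQ hz
  have hsub : a - delbar z = a + (-1 : ℂ) • delbar z := by rw [neg_one_smul, sub_eq_add_neg]
  have haV : a - delbar z ∈ V := by
    refine ⟨sub_mem ha.1 hBz, ?_⟩
    rw [hsub, hD.add _ ha.1.1 _ (Submodule.smul_mem _ _ hBz.1), hD.smul _ _ hBz.1, ← hDa,
      neg_one_smul, add_neg_cancel]
  have haB : delbar (a - delbar z) = 0 := by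
    rw [hsub, delbar_add ha.1.1.1 (Submodule.smul_mem _ _ hBz.1).1, delbar_smul hBz.1.1, ha.2,
      delbar_delbar hz.1, smul_zero, add_zero]
  obtain ⟨α, hα, hα1⟩ := HolomorphicPoisson.exists_isMaurerCartan P V W (fun _ hx => hx.1)
    (fun x hx => hclosed x hx.1 hx.2) (fun x hx y hy => hexact x hx.1 y hy.1 hx.2 hy.2) (by
      rintro _ ⟨y, hy, rfl⟩ hBy
      obtain ⟨x, hx, hyx⟩ := hD.exists_eq hproj' hy hBy
      have hDx := htype x hx
      refine ⟨(-1 : ℂ) • D x, ⟨Submodule.smul_mem _ _ hDx, ?_⟩, ?_⟩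
      · rw [hD.smul _ _ hDx.1, hD.sq _ hx.1, smul_zero]
      · rw [delbar_smul hDx.1.1, hD.anticomm _ hx.1, ← hyx, neg_one_smul, neg_neg]) haV haB
  exact ⟨α, hα, z, hz, hα1⟩

lemma del_zero : del (0 : Fam n M) = 0 :=
  congrArg Subtype.val (delEnd n M).map_zero

omit [IsManifold (modelWithCornersSelf ℂ (Model n)) ω M] in
lemma iotaPi_zero : iotaPi P (0 : Fam n M) = 0 := by
  funext e z
  simp [iotaPi]

omit [IsManifold (modelWithCornersSelf ℂ (Model n)) ω M] in
lemma mul_mem_formsPQ_two_two {a b : Fam n M} (ha : a ∈ formsPQ n M 1 1)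
    (hb : b ∈ formsPQ n M 1 1) : a * b ∈ formsPQ n M 2 2 := by
  have h := mul_mem_formsPQ ha hb
  rwa [one_add_one_eq_two] at h

omit [IsManifold (modelWithCornersSelf ℂ (Model n)) ω M] in
lemma famTypeProj_zero_del (q : ℕ) (w : Fam n M) :
    famTypeProj 0 q (del w) = 0 := by
  rw [del_eq_famExtDer]
  funext e z
  by_cases hz : z ∈ e.1.target
  · rw [famTypeProj, famExtDer_apply _ hz, extDer, map_sum]
    exact Finset.sum_eq_zero fun i _ => typeProj_zero_dz_mul _ _ _
  · simp [famTypeProj, famExtDer_of_notMem _ hz]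

lemma famTypeProj_delPi (p q : ℕ) {w : Fam n M} (hw : w ∈ forms n M) :
    famTypeProj p q (delPi P w) = delPi P (famTypeProj (p + 1) q w) := by
  have e : famTypeProj p q (delPi P w) =
      famTypeProj p q (iotaPi P (del w)) - famTypeProj p q (del (iotaPi P w)) := by
    funext e z
    exact map_sub _ _ _
  have hi := iotaPi_mem_forms P hw
  rw [e, delPi, famTypeProj_iotaPi, famTypeProj_del (p + 1) q hw.1]
  congr 1
  rcases p with _ | p
  · rw [famTypeProj_zero_del q, iotaPi_famTypeProj_of_lt_two P (by norm_num),
      del_zero]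
  · rw [famTypeProj_del p q hi.1, famTypeProj_iotaPi]

lemma delPi_eq_zero_of_del_eq_zero {a : Fam n M} (ha : a ∈ formsPQ n M 1 1) (hDa : del a = 0) :
    delPi P a = 0 := by
  rw [delPi, hDa, iotaPi_zero, ← famTypeProj_of_mem ha,
    iotaPi_famTypeProj_of_lt_two P (by norm_num), del_zero, sub_zero]

lemma delPi_mul_eq_del {a b : Fam n M} (ha : a ∈ formsPQ n M 1 1) (hb : b ∈ formsPQ n M 1 1)
    (hDa : del a = 0) (hDb : del b = 0) :
    ∃ y ∈ formsPQ n M 0 2, delPi P (a * b) = del y := by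
  have hi : iotaPi P (a * b) ∈ formsPQ n M 0 2 :=
    iotaPi_mem_formsPQ P (mul_mem_formsPQ_two_two ha hb)
  refine ⟨(-1 : ℂ) • iotaPi P (a * b), Submodule.smul_mem _ _ hi, ?_⟩
  rw [delPi, del_mul_of_formsPQ_one_one ha hb.1, hDa, hDb, zero_mul, mul_zero, add_zero,
    iotaPi_zero, del_smul hi.1.1, neg_one_smul, zero_sub]

theorem exists_isMaurerCartan_of_delDelbarLemma (h : DelDelbarLemma n M) {a : Fam n M}
    (ha : a ∈ cocycles n M 1 1) :
    ∃ α : ℕ → Fam n M, IsMaurerCartan P α ∧ ∃ z ∈ formsPQ n M 1 0, α 1 = a - delbar z :=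
  h.satisfiesDelbarLemma.exists_isMaurerCartan P (p' := 1 + 1) (p := 0 + 1) (r := 0)
    (fun q _ hw => famTypeProj_del 1 q hw.1) (fun q _ hw => famTypeProj_del 0 q hw.1)
    (fun _ hz => del_mem_formsPQ hz) (fun _ hx hDx => delPi_eq_zero_of_del_eq_zero P hx hDx)
    (fun _ hx _ hy hDx hDy => delPi_mul_eq_del P hx hy hDx hDy) ha

theorem exists_isMaurerCartan_of_delPiDelbarLemma {P : PoissonBivector n M}
    (h : DelPiDelbarLemma P) {a : Fam n M} (ha : a ∈ cocycles n M 1 1) :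
    ∃ α : ℕ → Fam n M, IsMaurerCartan P α ∧ ∃ z ∈ formsPQ n M 1 0, α 1 = a - delbar z :=
  h.satisfiesDelbarLemma.exists_isMaurerCartan P (p' := 0) (p := 1) (r := 1 + 1)
    (fun q _ hw => famTypeProj_delPi P 0 q hw) (fun q _ hw => famTypeProj_delPi P 1 q hw)
    (fun _ hz => delPi_mem_formsPQ P hz) (fun _ _ hDx => hDx)
    (fun x hx y hy _ _ => ⟨x * y, mul_mem_formsPQ_two_two hx hy, rfl⟩) ha

end Lemmas

/-! ### The map `π^♯` and the Kodaira–Spencer bracket -/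

section Sharp

variable {M : Type*} [TopologicalSpace M] [ChartedSpace (Model n) M] (P : PoissonBivector n M)

lemma sharp_apply (w : Fam n M) (e : atlas (Model n) M) (z : Model n) (j : Fin n) :
    sharp P w e z j = -∑ i, P.coeff e z i j • contr (tangentVec i) (w e z) := rfl

lemma pdz_sharp {w : Fam n M} {e : atlas (Model n) M} {z : Model n}
    (hw : DifferentiableAt ℝ (w e) z) (hz : z ∈ e.1.target) (k j : Fin n) :
    pdz k (fun y => sharp P w e y j) z =
      -∑ i, (dCoeff P e z k i j • contr (tangentVec i) (w e z) +
        P.coeff e z i j • contr (tangentVec i) (wirt (-Complex.I) k (w e) z)) := by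
  have h : ∀ i, DifferentiableAt ℝ (fun y => contr (tangentVec i) (w e y)) z := fun i =>
    differentiableAt_linear _ hw
  rw [pdz_eq_wirt]
  simp only [sharp_apply]
  rw [wirt_neg, wirt_sum _ fun i _ => (differentiableAt_coeff P hz i j).fun_smul (h i)]
  congr 1
  refine Finset.sum_congr rfl fun i _ => ?_
  rw [wirt_smul (differentiableAt_coeff P hz i j) (h i), wirt_linear _ hw, dCoeff_apply]

variable [IsManifold (modelWithCornersSelf ℂ (Model n)) ω M]

/-- `-π^♯` is compatible with the brackets on forms of type `(1,1)`. The terms without derivatives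
of the forms match by the Jacobi identity for `π`. -/
lemma sharp_bracket {a b : Fam n M} (ha : a ∈ formsPQ n M 1 1) (hb : b ∈ formsPQ n M 1 1) :
    sharp P (bracket P 2 a b) = -ksBracket 1 1 (sharp P a) (sharp P b) := by
  have heven : ∀ {w : Fam n M}, w ∈ formsPQ n M 1 1 → ∀ e z, gradeInv (w e z) = w e z :=
    fun hw e z => by rw [gradeInv_of_mem_formsPQ hw]; norm_num
  funext e z i
  by_cases hz : z ∈ e.1.target
  · have da := SmoothFam.differentiableAt ha.1.1 e hz
    have db := SmoothFam.differentiableAt hb.1.1 e hz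
    have hev := Filter.Eventually.of_forall (f := nhds z) (heven ha e)
    have hD : ∀ k, gradeInv (wirt (-Complex.I) k (a e) z) = wirt (-Complex.I) k (a e) z :=
      fun k => by
        have h := wirt_linear (s := -Complex.I) (i := k) (gradeInv (n := n)).toLinearMap da
        rw [AlgHom.toLinearMap_apply] at h
        rw [← h]
        exact wirt_congr hev
    set A : Fin n → Lam n := fun l => contr (tangentVec l) (a e z) with hA
    set B : Fin n → Lam n := fun l => contr (tangentVec l) (b e z) with hB
    set A' : Fin n → Fin n → Lam n :=
      fun k l => contr (tangentVec l) (wirt (-Complex.I) k (a e) z) with hA'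
    set B' : Fin n → Fin n → Lam n :=
      fun k l => contr (tangentVec l) (wirt (-Complex.I) k (b e) z) with hB'
    set c := P.coeff e z with hc
    set dc := dCoeff P e z with hdc
    have hcontr0 : ∀ {w : Fam n M}, w ∈ formsPQ n M 1 1 → ∀ l m,
        contr (tangentVec l) (contr (tangentVec m) (w e z)) = 0 := fun hw l m => by
      rw [← typeProj_of_mem (contr_lamPQ m (hw.2 e z)), contr_typeProj_zero]
    have hAodd : ∀ l, gradeInv (A l) = -A l := fun l => by rw [hA, gradeInv_contr, heven ha]
    have hA'odd : ∀ k l, gradeInv (A' k l) = -A' k l := fun k l => by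
      rw [hA', gradeInv_contr, hD]
    have hBodd : ∀ l, gradeInv (B l) = -B l := fun l => by rw [hB, gradeInv_contr, heven hb]
    have hBA : ∀ l m, B l * A m = -(A m * B l) := fun l m => by
      rw [mul_comm_of_odd (hBodd l), hAodd, neg_mul]
    have hBA' : ∀ l k m, B l * A' k m = -(A' k m * B l) := fun l k m => by
      rw [mul_comm_of_odd (hBodd l), hA'odd, neg_mul]
    have hcskew : ∀ k l, c k l = -c l k := P.skew e z hz
    have hdcskew : ∀ k l m, dc k l m = -dc k m l := fun k => dCoeff_skew hz k
    -- both sides are a sum with derivatives of `a` or `b` minus one with derivatives of `π`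
    have hleft : sharp P (bracket P 2 a b) e z i =
        ∑ l, ∑ k, ∑ j, (c l i * c k j) • (A j * B' k l - A' k l * B j) -
          ∑ m, ∑ j, (∑ k, c k i * dc k m j) • (A m * B j) := by
      have h1 : ∀ l, contr (tangentVec l) (bracket P 2 a b e z) =
          ∑ k, ∑ j, c k j • (A' k l * B j - A j * B' k l) +
            ∑ m, ∑ j, dc l m j • (A m * B j) := by
        intro l
        have e1 : ∀ j k, contr (tangentVec l) (A j * wirt (-Complex.I) k (b e) z) =
            -(A j * B' k l) := fun j k => by
          rw [contr_mul, hAodd, neg_mul, hA, hcontr0 ha, zero_mul, zero_add]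
        have e2 : ∀ j k, contr (tangentVec l) (wirt (-Complex.I) k (a e) z * B j) =
            A' k l * B j := fun j k => by
          rw [contr_mul, hB, hcontr0 hb, mul_zero, add_zero]
        have e3 : ∀ m j, contr (tangentVec l) (A m * B j) = 0 := fun m j => by
          rw [contr_mul, hA, hB, hcontr0 ha, hcontr0 hb, zero_mul, mul_zero, add_zero]
        have e4 : ∀ k, contr (tangentVec l) (incl (dz k) * ∑ m, ∑ j, dc k m j • (A m * B j)) =
            if l = k then ∑ m, ∑ j, dc k m j • (A m * B j) else 0 := fun k => by
          rw [contr_incl_mul, tangentVec_dz]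
          simp only [map_sum, map_smul, e3, smul_zero, Finset.sum_const_zero, mul_zero, sub_zero]
          split_ifs <;> simp
        rw [bracket_apply da db hz hev, map_sum]
        have e5 : ∀ k, contr (tangentVec l) (∑ j, c k j •
            (A j * wirt (-Complex.I) k (b e) z + wirt (-Complex.I) k (a e) z * B j)) =
            ∑ j, c k j • (A' k l * B j - A j * B' k l) := fun k => by
          rw [map_sum]
          refine Finset.sum_congr rfl fun j _ => ?_
          rw [map_smul, map_add, e1, e2, neg_add_eq_sub]
        refine (Finset.sum_congr rfl fun k _ => (map_add _ _ _).trans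
          (congrArg₂ (· + ·) (e5 k) (e4 k))).trans ?_
        rw [Finset.sum_add_distrib, Finset.sum_ite_eq, if_pos (Finset.mem_univ l)]
      rw [sharp_apply]
      simp only [h1, smul_add, Finset.smul_sum, smul_smul, Finset.sum_add_distrib, Finset.sum_smul,
        neg_add]
      rw [sub_eq_add_neg]
      congr 1
      · simp only [← Finset.sum_neg_distrib, ← smul_neg, neg_sub, hc]
      · rw [Finset.sum_comm]
        exact congrArg _ (Finset.sum_congr rfl fun m _ => Finset.sum_comm)
    have hright : ksBracket 1 1 (sharp P a) (sharp P b) e z i =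
        -∑ l, ∑ k, ∑ j, (c l i * c k j) • (A j * B' k l - A' k l * B j) +
          ∑ m, ∑ j, (∑ k, c k i * dc k m j) • (A m * B j) := by
      have hprod : ∀ (k : Fin n) (X Y Y' : Fin n → Lam n),
          (-∑ m, c m k • X m) * (-∑ l, (dc k l i • Y l + c l i • Y' l)) =
            ∑ m, ∑ l, (c m k * dc k l i) • (X m * Y l) +
              ∑ m, ∑ l, (c m k * c l i) • (X m * Y' l) := fun k X Y Y' => by
        rw [neg_mul_neg, Finset.sum_mul_sum]
        simp only [mul_add, smul_mul_smul_comm, Finset.sum_add_distrib]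
      -- the Jacobi identity
      have hcoef : ∀ m l, ∑ k, c k i * dc k m l =
          ∑ k, c m k * dc k l i - ∑ k, c l k * dc k m i := fun m l => by
        rw [← sub_eq_zero, ← coeff_jacobi hz i m l, ← Finset.sum_sub_distrib,
          ← Finset.sum_sub_distrib]
        refine Finset.sum_congr rfl fun k _ => ?_
        rw [← hc, ← hdc, hcskew m k, hcskew l k, hdcskew k m i]
        ring
      have hsplit : ksBracket 1 1 (sharp P a) (sharp P b) e z i =
          ∑ k, (∑ m, ∑ l, (c m k * dc k l i) • (A m * B l) +
              ∑ m, ∑ l, (c m k * c l i) • (A m * B' k l) +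
            (∑ m, ∑ l, (c m k * dc k l i) • (B m * A l) +
              ∑ m, ∑ l, (c m k * c l i) • (B m * A' k l))) := by
        rw [ksBracket, Set.indicator_of_mem hz]
        refine Finset.sum_congr rfl fun k _ => ?_
        rw [pdz_sharp P da hz, pdz_sharp P db hz, sharp_apply, sharp_apply, ← hprod, ← hprod,
          mul_one, pow_one, neg_one_smul, sub_neg_eq_add]
      rw [hsplit]
      simp only [Finset.sum_add_distrib]
      have hfirst : ∑ k, ∑ m, ∑ l, (c m k * dc k l i) • (A m * B l) +
          ∑ k, ∑ m, ∑ l, (c m k * dc k l i) • (B m * A l) =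
            ∑ m, ∑ j, (∑ k, c k i * dc k m j) • (A m * B j) := by
        simp only [hcoef, sub_smul, Finset.sum_smul, Finset.sum_sub_distrib]
        rw [sub_eq_add_neg]
        congr 1
        · rw [Finset.sum_comm]
          exact Finset.sum_congr rfl fun m _ => Finset.sum_comm
        · simp only [← Finset.sum_neg_distrib, ← smul_neg, ← hBA]
          rw [Finset.sum_comm]
          refine (Finset.sum_congr rfl fun m _ => Finset.sum_comm).trans ?_
          rw [Finset.sum_comm]
      have hsecond : ∑ k, ∑ m, ∑ l, (c m k * c l i) • (A m * B' k l) +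
          ∑ k, ∑ m, ∑ l, (c m k * c l i) • (B m * A' k l) =
            -∑ l, ∑ k, ∑ j, (c l i * c k j) • (A j * B' k l - A' k l * B j) := by
        simp only [← Finset.sum_neg_distrib, ← Finset.sum_add_distrib]
        refine Eq.trans (Finset.sum_congr rfl fun k _ => Finset.sum_comm) ?_
        rw [Finset.sum_comm]
        refine Finset.sum_congr rfl fun l _ => Finset.sum_congr rfl fun k _ =>
          Finset.sum_congr rfl fun m _ => ?_
        rw [hBA', hcskew m k, ← smul_add, ← sub_eq_add_neg, neg_mul, neg_smul, mul_comm]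
      rw [← hfirst, ← hsecond]
      abel
    rw [Pi.neg_apply, Pi.neg_apply, Pi.neg_apply, hleft, hright]
    abel
  · have h := (bracket_mem_forms P ha.1 hb.1).2.1 e z hz
    simp [sharp_apply, h, ksBracket, hz]

lemma IsMaurerCartan.isFormalDeformation {P : PoissonBivector n M} {α : ℕ → Fam n M}
    (hα : IsMaurerCartan P α) : IsFormalDeformation fun k => sharp P (α k) where
  zero := by rw [hα.zero, map_zero]
  mem k := sharp_mem P (hα.mem k)
  eqn k := by
    have h := congrArg (sharp P) (hα.eqn k)
    rw [map_add, map_smul, map_sum, map_zero] at h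
    simp only [sharp_bracket P (hα.mem _) (hα.mem _), Finset.sum_neg_distrib, smul_neg] at h
    rw [vdelbar_sharp P (hα.mem k).1.1, ← neg_eq_zero, neg_add, neg_neg]
    exact h

end Sharp

end HolomorphicPoisson

end

open HolomorphicPoisson in
theorem theorem1p4 (n : ℕ) (M : Type*) [TopologicalSpace M] [T2Space M]
    [SecondCountableTopology M]
    [ChartedSpace (HolomorphicPoisson.Model n) M]
    [IsManifold (modelWithCornersSelf ℂ (HolomorphicPoisson.Model n)) ω M]
    (P : HolomorphicPoisson.PoissonBivector n M)
    (h : HolomorphicPoisson.DelDelbarLemma n M ∨ HolomorphicPoisson.DelPiDelbarLemma P)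
    (c : HolomorphicPoisson.Dolbeault n M 1 1) :
    (∃ α : ℕ → HolomorphicPoisson.Fam n M, HolomorphicPoisson.IsMaurerCartan P α ∧
      ∃ h1 : α 1 ∈ HolomorphicPoisson.cocycles n M 1 1,
        Submodule.Quotient.mk ⟨α 1, h1⟩ = c) ∧
    HolomorphicPoisson.IsTangentToFormalDeformation
      (HolomorphicPoisson.sharpCohomology P 1 c) := by
  obtain ⟨⟨a, ha⟩, rfl⟩ := Submodule.Quotient.mk_surjective _ c
  obtain ⟨α, hα, z, hz, hα1⟩ : ∃ α : ℕ → Fam n M, IsMaurerCartan P α ∧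
      ∃ z ∈ formsPQ n M 1 0, α 1 = a - delbar z := by
    rcases h with h | h
    · exact exists_isMaurerCartan_of_delDelbarLemma P h ha
    · exact exists_isMaurerCartan_of_delPiDelbarLemma h ha
  have hBz : delbar z ∈ cocycles n M 1 1 := ⟨delbar_mem_formsPQ hz, delbar_delbar hz.1⟩
  have h1 : α 1 ∈ cocycles n M 1 1 := by
    rw [hα1]
    exact sub_mem ha hBz
  have hclass : (Submodule.Quotient.mk ⟨α 1, h1⟩ : Dolbeault n M 1 1) =
      Submodule.Quotient.mk ⟨a, ha⟩ := by
    refine (Submodule.Quotient.eq _).mpr ?_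
    have : α 1 - a ∈ coboundaries n M 1 1 := by
      rw [hα1, sub_sub_cancel_left]
      exact neg_mem ⟨z, hz, rfl⟩
    exact this
  refine ⟨⟨α, hα, h1, hclass⟩, fun k => sharp P (α k), hα.isFormalDeformation,
    sharp_mem_vcocycles P h1, ?_⟩
  rw [← hclass]
  rfl
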